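/- Let $\Delta(z)=\prod_{1\le i<j\le N}(z_i-z_j)$, $V(z)=\sum_{m\ge 0}t_mz^m$ with formal variables $t_0,t_1,t_2,\dots$, and let $$\hat L_n=\sum_{k\ge 1}k\,t_k\frac{\partial}{\partial t_{k+n}}+\sum_{k=0}^{n}\frac{\partial}{\partial t_k}\frac{\partial}{\partial t_{n-k}},\qquad n\ge -1,$$ be the Virasoro constraint operators of the Hermitian matrix model $Z=\int d^Nz\,\Delta(z)^2e^{\sum_{i=1}^N V(z_i)}$. For $r\ge 1$ and $n\ge -r$ consider the total derivative operators of order $r$, $$W_n^r=\sum_{k=0}^{r-1}(-1)^k\binom rk\sum_{i=1}^N\frac{\partial^{r-k}}{\partial z_i^{r-k}}\,z_i^{n+r}\,\Delta^{-1}\frac{\partial^k\Delta}{\partial z_i^k}.$$ By a differential operator in the times we mean a normally ordered operator $\sum_\alpha t^\alpha A_\alpha(\partial/\partial t_0,\partial/\partial t_1,\dots)$, a possibly infinite sum over the monomials $t^\alpha$ in the times, whose coefficients $A_\alpha$ are polynomials in the $\partial/\partial t_k$. Let $r\ge 2$ and $n\ge -r$. Then there is exactly one differential operator $\hat W_n^r$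 in the times (independent of $N$) such that for every $N$ $$\hat W_n^r\Bigl(\Delta(z)^2e^{\sum_{i=1}^N V(z_i)}\Bigr)=W_n^r\Bigl(\Delta(z)^2e^{\sum_{i=1}^N V(z_i)}\Bigr)$$ as formal power series in the times (at all $z\in\mathbb R^N$ with pairwise distinct entries); this is the constraint operator obtained by inserting $W_n^r$ into the matrix integral. It is reducible to the Virasoro constraint operators, that is, $$\hat W_n^r=\sum_{m\ge -1}O_m\,\hat L_m$$ for differential operators $O_m$ in the times whose degrees in the times and orders in the derivations are bounded uniformly in $m$, the sum being locally finite in the sense that each monomial in the times occurs in only finitely many of the $O_m$. -/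

import Mathlib

/-- The formal symbol `∑_α t^α A_α(∂/∂t₀, ∂/∂t₁, …)` of a normally ordered differential operator
in the times `t₀, t₁, t₂, …`: a power series in the times (infinite sums over the times
such as `∑ k t_k ∂/∂t_{k+n}` occur) whose coefficients are polynomials in the derivations
`∂/∂t_k`; the polynomial variable `X k` stands for `∂/∂t_k`. -/
abbrev TimeOp : Type := MvPowerSeries ℕ (MvPolynomial ℕ ℝ)

namespace TimeOp

/-- The action of a differential operator in the times on formal power series in the times with
coefficients in a commutative `ℝ`-algebra: the derivatives act first, then one multiplies by the
powers of the times. The coefficient of `t^b` in `∂^δ F` is `∏_k (b_k+δ_k)⋯(b_k+1)` times the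
coefficient of `t^(b+δ)` in `F`. -/
noncomputable def act {R : Type*} [CommRing R] [Algebra ℝ R] (A : TimeOp)
    (F : MvPowerSeries ℕ R) : MvPowerSeries ℕ R :=
  fun α => ∑ p ∈ Finset.HasAntidiagonal.antidiagonal α, ∑ δ ∈ (MvPowerSeries.coeff p.1 A).support,
    (MvPolynomial.coeff δ (MvPowerSeries.coeff p.1 A) *
        ∏ k ∈ δ.support, ((p.2 k + δ k).descFactorial (δ k) : ℝ)) •
      MvPowerSeries.coeff (p.2 + δ) F

/-- `A` has degree at most `d` in the times and order at most `d` in the derivations. -/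
def DegreeLE (d : ℕ) (A : TimeOp) : Prop :=
  ∀ α : ℕ →₀ ℕ, MvPowerSeries.coeff α A ≠ 0 →
    α.degree ≤ d ∧ (MvPowerSeries.coeff α A).totalDegree ≤ d

/-- The Virasoro constraint operator, for `n ≥ -1`,
`L_n = ∑_{k ≥ 1} k t_k ∂/∂t_{k+n} + ∑_{k=0}^{n} ∂/∂t_k ∂/∂t_{n-k}`
(the second sum is empty for `n = -1`). -/
noncomputable def virasoro (n : ℤ) : TimeOp :=
  fun α =>
    (if α = 0 then
      ∑ k ∈ Finset.range (n + 1).toNat, MvPolynomial.X k * MvPolynomial.X (n - k).toNat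
    else 0) +
    ∑ k ∈ α.support,
      if α = Finsupp.single k 1 then (k : MvPolynomial ℕ ℝ) * MvPolynomial.X (k + n).toNat else 0

/-- An operator is reducible to the Virasoro constraint operators if it is of the form
`∑_{n ≥ -1} O_n ∘ L_n`, where the `O_n` are differential operators in the times, of uniformly
bounded degree in the times and uniformly bounded order, and the (possibly infinite) sum is
locally finite: each monomial in the times occurs in only finitely many of the `O_n`.
Below, `O m` is the left factor of `L_{m-1}`. -/
def IsReducibleToVirasoro (A : TimeOp) : Prop :=
  ∃ O : ℕ → TimeOp,
    (∃ d : ℕ, ∀ m, DegreeLE d (O m)) ∧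
    (∀ α : ℕ →₀ ℕ, {m : ℕ | MvPowerSeries.coeff α (O m) ≠ 0}.Finite) ∧
    ∀ (F : MvPowerSeries ℕ ℝ) (α : ℕ →₀ ℕ),
      MvPowerSeries.coeff α (A.act F) =
        ∑ᶠ m : ℕ, MvPowerSeries.coeff α ((O m).act ((virasoro ((m : ℤ) - 1)).act F))

end TimeOp

namespace MatrixModel

/-- The Vandermonde determinant `Δ(z) = ∏_{i<j} (z_i - z_j)`. -/
noncomputable def vandermonde (N : ℕ) (z : Fin N → ℝ) : ℝ :=
  ∏ i : Fin N, ∏ j ∈ Finset.Ioi i, (z i - z j)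

/-- The iterated partial derivative `∂^k f / ∂z_i^k`. -/
noncomputable def partialD {N : ℕ} (i : Fin N) (k : ℕ) (f : (Fin N → ℝ) → ℝ) :
    (Fin N → ℝ) → ℝ :=
  fun z => iteratedDeriv k (fun s : ℝ => f (Function.update z i s)) (z i)

/-- The total derivative operator of order `r`,
`W_n^r = ∑_{k=0}^{r-1} (-1)^k C(r,k) ∑_i ∂_i^{r-k} z_i^{n+r} Δ⁻¹ (∂_i^k Δ)`, for `n ≥ -r`,
acting on functions of `z₁, …, z_N`, where `z` has pairwise distinct entries. -/
noncomputable def totalDerivative (N r : ℕ) (n : ℤ) (f : (Fin N → ℝ) → ℝ) :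
    (Fin N → ℝ) → ℝ :=
  fun z => ∑ k ∈ Finset.range r, (-1 : ℝ) ^ k * (r.choose k : ℝ) *
    ∑ i : Fin N, partialD i (r - k)
      (fun w => w i ^ (n + r) * (vandermonde N w)⁻¹ * partialD i k (vandermonde N) w * f w) z

/-- The integrand `Δ(z)² exp(∑_i V(z_i))`, `V(z) = ∑_{k ≥ 0} t_k z^k`, of the Hermitian matrix
model as a formal power series in the times whose coefficients are functions of `z`. Since
`∑_i V(z_i) = ∑_k t_k p_k(z)` with `p_k(z) = ∑_i z_i^k`, the coefficient of `t^α` in the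
exponential is `∏_k p_k(z)^{α_k} / α_k!`. -/
noncomputable def integrand (N : ℕ) : MvPowerSeries ℕ ((Fin N → ℝ) → ℝ) :=
  fun α z => vandermonde N z ^ 2 *
    α.prod fun k m => (∑ i : Fin N, z i ^ k) ^ m / (m.factorial : ℝ)

/-- `A` is the constraint operator obtained by inserting `W_n^r` into the matrix model: for every
number `N` of eigenvalues,
`A (Δ² exp(∑_i V(z_i))) = W_n^r (Δ² exp(∑_i V(z_i)))`,
where `A` acts on the times and `W_n^r` acts on `z`, coefficient by coefficient in the times. -/
def IsConstraintOperator (r : ℕ) (n : ℤ) (A : TimeOp) : Prop :=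
  ∀ (N : ℕ) (z : Fin N → ℝ), Function.Injective z → ∀ α : ℕ →₀ ℕ,
    MvPowerSeries.coeff α (A.act (integrand N)) z =
      totalDerivative N r n (MvPowerSeries.coeff α (integrand N)) z

end MatrixModel

/-! Write M = n + r and D = d/dx, let p_k stand for ∂/∂t_k, and put J(x) = ∑ p_k x^(-k-1), V'(x) = ∑
k t_k x^(k-1). The constraint operator is (-1)^(r+1)/(r+1) times the coefficient of x^(-M-1) in the
normally ordered field P_(r+1), where P_s = (D - J - V')^s 1 + (D + J)^s 1 (`constraintOp`,
`symmetrizedBell`).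

On the integrand each ∂/∂t_k multiplies by a power sum, so an operator in the times acts through its
symbol (`coeff_act_integrand`). With χ = ∏ (x - z_i), the symbol of (D + J)^s 1 is χ^(s)/χ, and that
of (D - J - V')^s 1 is formally e^V χ D^s(e^(-V) χ⁻¹). On the other side, an adjoint Leibniz rule
turns W_n^r f into ∑_i (Δ ∂_i^r g - (-1)^r g ∂_i^r Δ) with g = z_i^M Δ⁻¹ f. The second term is, up
to a factor, a sum of residues of x^M χ^(r+1)/χ. The first term matches (D - J - V')^(r+1) 1,
because V' - D is adjoint to D + V' for the residue pairing (`laurentCoeff_bell_dual`).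

For reducibility, K = J and K = -J - V' are the two solutions of K² + V'K = T with T = J² + V'J, the
energy-momentum tensor, whose negative powers of x carry the L_m with m ≥ -1. Composing a field f
with T, singular modes to the right of f and regular modes to the left, gives Tf + Ef in normal
order, for a derivation E with E(D^j K) = D^(j+2) K/(j+2) for both K. A generating series then
yields E on (D + K)^s 1, and with it a recursion (`bell_recursion`) for P_(s+2) in terms of P_s and
P_(s+1), using only D, multiplication by V' and composition with T. Each of these preserves the
fields whose negative coefficients are reducible, and P_0 = 2, P_1 = -V' have no negative
coefficients.

Uniqueness holds because the power sums, taken for all N together, satisfy no polynomial relation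
(`eq_zero_of_eval_powerSum`). -/

/-- Real derivations of a commutative algebra. -/
abbrev RealDerivation (A : Type*) [CommRing A] [Algebra ℝ A] : Type _ := Derivation ℝ A A

/-! ### Derivations acting on the coefficients of power series -/

namespace MvPowerSeries

/-- The derivation of a ring of formal power series that acts on each coefficient. -/
noncomputable def mapDerivation {σ A : Type*} [CommRing A] [Algebra ℝ A] (D : RealDerivation A) :
    RealDerivation (MvPowerSeries σ A) :=
  Derivation.mk'
    { toFun := fun f n => D (coeff n f)
      map_add' := fun f g => by ext n; exact map_add D _ _
      map_smul' := fun c f => by ext n; exact D.map_smul c _ }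
    (fun f g => by
      classical
      ext n
      change D (coeff n (f * g)) = coeff n (f * _ + g * _)
      rw [map_add, mul_comm g, coeff_mul, coeff_mul, coeff_mul, map_sum, ← Finset.sum_add_distrib]
      refine Finset.sum_congr rfl fun x _ => ?_
      rw [D.leibniz, smul_eq_mul, smul_eq_mul, mul_comm (coeff x.2 g)]
      rfl)

theorem coeff_mapDerivation {σ A : Type*} [CommRing A] [Algebra ℝ A] (D : RealDerivation A)
    (n : σ →₀ ℕ) (f : MvPowerSeries σ A) : coeff n (mapDerivation D f) = D (coeff n f) := rfl

theorem coeff_mapDerivation_powerSeries {A : Type*} [CommRing A] [Algebra ℝ A]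
    (D : RealDerivation A) (n : ℕ) (f : PowerSeries A) :
    PowerSeries.coeff n (mapDerivation D f) = D (PowerSeries.coeff n f) := rfl

end MvPowerSeries

/-! ### The differential polynomials (D + K)^s 1 and their generating series -/

section Bell

variable {A : Type*} [CommRing A] [Algebra ℝ A]

/-- The differential polynomials `(D + K)^s 1`. -/
noncomputable def bell (D : RealDerivation A) (K : A) : ℕ → A
  | 0 => 1
  | s + 1 => D (bell D K s) + K * bell D K s

theorem bell_zero (D : RealDerivation A) (K : A) : bell D K 0 = 1 := rfl

theorem bell_succ (D : RealDerivation A) (K : A) (s : ℕ) :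
    bell D K (s + 1) = D (bell D K s) + K * bell D K s := rfl

/-- The Taylor series `∑_j D^j K ε^j / j!`. -/
noncomputable def taylorSeries (D : RealDerivation A) (K : A) : PowerSeries A :=
  PowerSeries.mk fun j => ((j.factorial : ℝ)⁻¹) • D^[j] K

/-- The exponential generating series of the differential polynomials `(D + K)^s 1`. -/
noncomputable def bellSeries (D : RealDerivation A) (K : A) : PowerSeries A :=
  PowerSeries.mk fun j => ((j.factorial : ℝ)⁻¹) • bell D K j

open MvPowerSeries (mapDerivation)

theorem inv_factorial_succ_smul (j : ℕ) (x : A) :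
    ((((j + 1).factorial : ℕ) : ℝ)⁻¹ • x) * ((j : A) + 1) = ((j.factorial : ℝ)⁻¹) • x := by
  have : (j : A) + 1 = algebraMap ℝ A ((j : ℝ) + 1) := by simp
  rw [this, mul_comm, ← Algebra.smul_def, smul_smul]
  congr 1
  rw [Nat.factorial_succ]
  push_cast
  field_simp

/-- The series is K(x + ε), on which d/dε and d/dx agree. -/
theorem derivative_taylorSeries (D : RealDerivation A) (K : A) :
    PowerSeries.derivative A (taylorSeries D K) = mapDerivation D (taylorSeries D K) := by
  ext j
  rw [PowerSeries.coeff_derivative, MvPowerSeries.coeff_mapDerivation_powerSeries, taylorSeries,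
    PowerSeries.coeff_mk, PowerSeries.coeff_mk, inv_factorial_succ_smul, Derivation.map_smul,
    Function.iterate_succ_apply']

theorem derivative_bellSeries (D : RealDerivation A) (K : A) :
    PowerSeries.derivative A (bellSeries D K) =
      mapDerivation D (bellSeries D K) + PowerSeries.C K * bellSeries D K := by
  ext j
  rw [PowerSeries.coeff_derivative, map_add, MvPowerSeries.coeff_mapDerivation_powerSeries,
    PowerSeries.coeff_C_mul, bellSeries, PowerSeries.coeff_mk, PowerSeries.coeff_mk,
    inv_factorial_succ_smul, Derivation.map_smul, mul_smul_comm, ← smul_add]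
  rfl

theorem derivative_mapDerivation_comm (D : RealDerivation A) (f : PowerSeries A) :
    PowerSeries.derivative A (mapDerivation D f) = mapDerivation D (PowerSeries.derivative A f) := by
  ext j
  rw [PowerSeries.coeff_derivative, MvPowerSeries.coeff_mapDerivation_powerSeries,
    MvPowerSeries.coeff_mapDerivation_powerSeries, PowerSeries.coeff_derivative, D.leibniz]
  have : D ((j : A) + 1) = 0 := by
    rw [map_add, D.map_natCast, D.map_one_eq_zero, add_zero]
  rw [this, smul_zero, zero_add, smul_eq_mul, mul_comm]

theorem isUnit_succ (j : ℕ) : IsUnit ((j : A) + 1) := by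
  have : (j : A) + 1 = algebraMap ℝ A ((j : ℝ) + 1) := by simp
  rw [this]
  exact (IsUnit.mk0 _ (by positivity)).map _

/-- A power series solution of a linear homogeneous differential equation is determined by its
constant term. -/
theorem eq_zero_of_derivative_eq (T : PowerSeries A → PowerSeries A)
    (hT : ∀ f : PowerSeries A, ∀ n, (∀ m ≤ n, PowerSeries.coeff m f = 0) →
      PowerSeries.coeff n (T f) = 0)
    (f : PowerSeries A) (h0 : PowerSeries.coeff 0 f = 0)
    (hf : PowerSeries.derivative A f = T f) : f = 0 := by
  have key : ∀ n, ∀ m ≤ n, PowerSeries.coeff m f = 0 := by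
    intro n
    induction n with
    | zero => intro m hm; obtain rfl : m = 0 := by omega
              exact h0
    | succ n ih =>
      intro m hm
      rcases Nat.lt_or_ge m (n + 1) with h | h
      · exact ih m (by omega)
      · obtain rfl : m = n + 1 := by omega
        have h2 := congrArg (PowerSeries.coeff n) hf
        rw [hT f n ih, PowerSeries.coeff_derivative] at h2
        exact (isUnit_succ n).mul_left_eq_zero.1 h2
  ext n
  exact key n n le_rfl

theorem coeff_mul_eq_zero_of_le {A : Type*} [CommRing A] (G f : PowerSeries A) (n : ℕ)
    (h : ∀ m ≤ n, PowerSeries.coeff m f = 0) : PowerSeries.coeff n (G * f) = 0 := by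
  rw [PowerSeries.coeff_mul]
  refine Finset.sum_eq_zero fun x hx => ?_
  rw [h x.2 (by have := Finset.HasAntidiagonal.mem_antidiagonal.1 hx; omega), mul_zero]

/-- Formally the Bell series is exp(∫ K) over [x, x + ε], so its logarithmic ε-derivative is K(x +
ε). In the proof, the difference of the two sides satisfies ∂_ε f = D f + K f and has constant term
0. -/
theorem derivative_bellSeries_eq_taylorSeries_mul (D : RealDerivation A) (K : A) :
    PowerSeries.derivative A (bellSeries D K) = taylorSeries D K * bellSeries D K := by
  rw [← sub_eq_zero]
  refine eq_zero_of_derivative_eq (fun f => mapDerivation D f + PowerSeries.C K * f) ?_ _ ?_ ?_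
  · intro f n h
    rw [map_add, coeff_mul_eq_zero_of_le _ _ _ h, MvPowerSeries.coeff_mapDerivation_powerSeries,
      h n le_rfl, map_zero, zero_add]
  · rw [map_sub, PowerSeries.coeff_derivative, PowerSeries.coeff_mul]
    simp [bellSeries, taylorSeries, bell]
  · have h := derivative_bellSeries D K
    have e : PowerSeries.derivative A (PowerSeries.derivative A (bellSeries D K)) =
        mapDerivation D (PowerSeries.derivative A (bellSeries D K)) +
          PowerSeries.C K * PowerSeries.derivative A (bellSeries D K) := by
      conv_lhs => rw [h]
      rw [map_add, derivative_mapDerivation_comm, Derivation.leibniz, PowerSeries.derivative_C]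
      simp
    rw [map_sub, map_sub, e, Derivation.leibniz, Derivation.leibniz, derivative_taylorSeries]
    simp only [smul_eq_mul]
    rw [h]
    ring

/-- If a derivation sends the Taylor series of `K` to the derivative of a series `G` without
constant term, then it multiplies the Bell series by `G`. -/
theorem mapDerivation_bellSeries (D E : RealDerivation A) (K : A) (G : PowerSeries A)
    (h0 : PowerSeries.coeff 0 G = 0)
    (hG : PowerSeries.derivative A G = mapDerivation E (taylorSeries D K)) :
    mapDerivation E (bellSeries D K) = G * bellSeries D K := by
  rw [← sub_eq_zero]
  refine eq_zero_of_derivative_eq (fun f => taylorSeries D K * f)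
    (fun f n h => coeff_mul_eq_zero_of_le _ _ _ h) _ ?_ ?_
  · rw [map_sub, MvPowerSeries.coeff_mapDerivation_powerSeries, PowerSeries.coeff_mul]
    simp [bellSeries, bell, h0]
  · rw [map_sub, derivative_mapDerivation_comm, derivative_bellSeries_eq_taylorSeries_mul,
      Derivation.leibniz, Derivation.leibniz, derivative_bellSeries_eq_taylorSeries_mul, hG]
    simp only [smul_eq_mul]
    ring

/-- The action on the polynomials `(D + K)^s 1` of a derivation `E` with
`E (D^j K) = D^(j+2) K / (j+2)`. -/
theorem smul_derivation_bell (D E : RealDerivation A) (K : A)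
    (h : ∀ j : ℕ, ((j : ℝ) + 2) • E (D^[j] K) = D^[j + 2] K) (s : ℕ) :
    ((s : ℝ) + 1) • E (bell D K s) =
      D (bell D K (s + 1)) - ((s : ℝ) + 1) • (D K * bell D K s) := by
  -- G is the ε-primitive of E(K(x + ε)) without constant term; the hypothesis on E makes ε G = K(x
  -- + ε) - K - ε DK.
  set G : PowerSeries A := PowerSeries.mk fun j =>
    if j = 0 then 0 else ((((j + 1).factorial : ℕ) : ℝ)⁻¹) • D^[j + 1] K with hGdef
  have hE : mapDerivation E (bellSeries D K) = G * bellSeries D K := by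
    apply mapDerivation_bellSeries
    · simp [hGdef]
    · ext j
      rw [PowerSeries.coeff_derivative, MvPowerSeries.coeff_mapDerivation_powerSeries, hGdef,
        taylorSeries, PowerSeries.coeff_mk, PowerSeries.coeff_mk, if_neg (by omega), Derivation.map_smul]
      have h2 : E (D^[j] K) = ((j : ℝ) + 2)⁻¹ • D^[j + 2] K := by
        rw [← h j, smul_smul, inv_mul_cancel₀ (by positivity), one_smul]
      rw [h2, smul_smul]
      have : (j : A) + 1 = algebraMap ℝ A ((j : ℝ) + 1) := by simp
      rw [this, mul_comm, ← Algebra.smul_def, smul_smul]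
      congr 1
      rw [Nat.factorial_succ, Nat.factorial_succ]
      push_cast
      have : (j.factorial : ℝ) ≠ 0 := by positivity
      have : (j : ℝ) + 1 ≠ 0 := by positivity
      have : (j : ℝ) + 2 ≠ 0 := by positivity
      field_simp
      ring
  have hX : PowerSeries.X * G = taylorSeries D K - PowerSeries.C K -
      PowerSeries.X * PowerSeries.C (D K) := by
    ext j
    rcases j with _ | _ | j
    · simp [hGdef, taylorSeries]
    · simp [hGdef, taylorSeries, PowerSeries.coeff_succ_X_mul]
    · simp [hGdef, taylorSeries, PowerSeries.coeff_succ_X_mul, PowerSeries.coeff_X]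
  have hD : mapDerivation D (bellSeries D K) = (taylorSeries D K - PowerSeries.C K) *
      bellSeries D K := by
    have h1 := derivative_bellSeries D K
    rw [derivative_bellSeries_eq_taylorSeries_mul] at h1
    rw [sub_mul, h1]; ring
  -- For the Bell series B one has E B = G B and D B = (K(x + ε) - K) B, hence ε E B = D B - ε DK B.
  -- The claim is the coefficient of ε^(s+1).
  have hfin : PowerSeries.X * mapDerivation E (bellSeries D K) =
      mapDerivation D (bellSeries D K) -
        PowerSeries.X * (PowerSeries.C (D K) * bellSeries D K) := by
    rw [hE, hD, ← mul_assoc, hX]; ring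
  have h3 := congrArg (PowerSeries.coeff (s + 1)) hfin
  rw [PowerSeries.coeff_succ_X_mul, map_sub, PowerSeries.coeff_succ_X_mul,
    PowerSeries.coeff_C_mul, MvPowerSeries.coeff_mapDerivation_powerSeries,
    MvPowerSeries.coeff_mapDerivation_powerSeries, bellSeries, PowerSeries.coeff_mk,
    PowerSeries.coeff_mk, Derivation.map_smul, Derivation.map_smul] at h3
  have h4 := congrArg (fun x => (((s + 1).factorial : ℕ) : ℝ) • x) h3
  simp only [smul_sub, smul_smul, mul_smul_comm] at h4
  have e1 : ((((s + 1).factorial : ℕ) : ℝ)) * ((s.factorial : ℝ)⁻¹) = (s : ℝ) + 1 := by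
    rw [Nat.factorial_succ]; push_cast
    have : (s.factorial : ℝ) ≠ 0 := by positivity
    field_simp
  have e2 : ((((s + 1).factorial : ℕ) : ℝ)) * ((((s + 1).factorial : ℕ) : ℝ)⁻¹) = 1 :=
    mul_inv_cancel₀ (by positivity)
  rw [e1, e2, one_smul] at h4
  exact h4

end Bell

/-! ### Formal sums ∑ t_k F_k and partial derivatives in the times -/

namespace MvPowerSeries

open Finset.HasAntidiagonal (antidiagonal mem_antidiagonal)
open Finsupp (single)

/-- Splitting α = p + q and then removing one t_k from q is the same as first removing t_k from α.
This makes `timesSum` linear over multiplication. -/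
theorem sum_antidiagonal_sum_support {M : Type*} [AddCommMonoid M]
    (h : ℕ → (ℕ →₀ ℕ) → (ℕ →₀ ℕ) → M) (α : ℕ →₀ ℕ) :
    ∑ x ∈ antidiagonal α, ∑ k ∈ x.2.support, h k x.1 (x.2 - single k 1) =
      ∑ k ∈ α.support, ∑ x ∈ antidiagonal (α - single k 1), h k x.1 x.2 := by
  rw [Finset.sum_sigma', Finset.sum_sigma']
  refine Finset.sum_bij' (fun x _ => ⟨x.2, (x.1.1, x.1.2 - single x.2 1)⟩)
    (fun y _ => ⟨(y.2.1, y.2.2 + single y.1 1), y.1⟩) ?_ ?_ ?_ ?_ ?_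
  · rintro ⟨⟨p, q⟩, k⟩ hx
    simp only [Finset.mem_sigma, mem_antidiagonal, Finsupp.mem_support_iff] at hx ⊢
    obtain ⟨rfl, hk⟩ := hx
    refine ⟨by simp only [Finsupp.add_apply]; omega, ?_⟩
    rw [add_tsub_assoc_of_le]
    exact Finsupp.single_le_iff.2 (by omega)
  · rintro ⟨k, p, q⟩ hx
    simp only [Finset.mem_sigma, mem_antidiagonal, Finsupp.mem_support_iff] at hx ⊢
    obtain ⟨hk, hx⟩ := hx
    refine ⟨?_, by simp⟩
    rw [← add_assoc, hx, tsub_add_cancel_of_le]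
    exact Finsupp.single_le_iff.2 (by omega)
  · rintro ⟨⟨p, q⟩, k⟩ hx
    simp only [Finset.mem_sigma, mem_antidiagonal, Finsupp.mem_support_iff] at hx ⊢
    rw [tsub_add_cancel_of_le (Finsupp.single_le_iff.2 (by omega))]
  · rintro ⟨k, p, q⟩ hx
    simp
  · rintro ⟨⟨p, q⟩, k⟩ hx
    rfl

/-- Splittings whose second part misses b have weight zero, and the others come from splittings of
α. This is the reindexing behind the product rule for ∂/∂t_b. -/
theorem sum_antidiagonal_add_single {M : Type*} [AddCommMonoid M] (b : ℕ)
    (g : (ℕ →₀ ℕ) → (ℕ →₀ ℕ) → M) (α : ℕ →₀ ℕ) :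
    ∑ x ∈ antidiagonal (α + single b 1), (x.2 : ℕ →₀ ℕ) b • g x.1 x.2 =
      ∑ x ∈ antidiagonal α, (x.2 b + 1) • g x.1 (x.2 + single b 1) := by
  symm
  refine Finset.sum_bij_ne_zero (fun x _ _ => (x.1, x.2 + single b 1)) ?_ ?_ ?_ ?_
  · rintro ⟨p, q⟩ hx _
    simp only [mem_antidiagonal] at hx ⊢
    rw [← add_assoc, hx]
  · rintro ⟨p, q⟩ _ _ ⟨p', q'⟩ _ _ h
    simpa using h
  · rintro ⟨p, q⟩ hx h0
    simp only [mem_antidiagonal] at hx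
    have hq : q b ≠ 0 := by rintro h; simp [h] at h0
    have hle : single b 1 ≤ q := Finsupp.single_le_iff.2 (by omega)
    have hc := tsub_add_cancel_of_le hle
    refine ⟨(p, q - single b 1), ?_, ?_, ?_⟩
    · simp only [mem_antidiagonal]
      have : p + (q - single b 1) + single b 1 = α + single b 1 := by rw [add_assoc, hc, hx]
      exact add_right_cancel this
    · simp only [hc]
      have : (q - single b 1 : ℕ →₀ ℕ) b + 1 = q b := by
        conv_rhs => rw [← hc]
        simp
      rwa [this]
    · simp only [hc]
  · rintro ⟨p, q⟩ _ _
    simp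

/-- The formal sum `∑_k t_k F_k`. -/
noncomputable def timesSum {R : Type*} [AddCommMonoid R] (F : ℕ → MvPowerSeries ℕ R) :
    MvPowerSeries ℕ R :=
  fun α => ∑ k ∈ α.support, F k (α - single k 1)

section

variable {R : Type*} [CommRing R]

theorem coeff_timesSum (F : ℕ → MvPowerSeries ℕ R) (α : ℕ →₀ ℕ) :
    coeff α (timesSum F) = ∑ k ∈ α.support, coeff (α - single k 1) (F k) := rfl

theorem timesSum_add (F G : ℕ → MvPowerSeries ℕ R) :
    timesSum (fun k => F k + G k) = timesSum F + timesSum G := by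
  ext α
  simp [coeff_timesSum, Finset.sum_add_distrib]

theorem timesSum_smul {S : Type*} [Semiring S] [Module S R] (c : S) (F : ℕ → MvPowerSeries ℕ R) :
    timesSum (fun k => (c • F k : MvPowerSeries ℕ R)) = c • timesSum F := by
  ext α
  change ∑ k ∈ α.support, c • coeff (α - single k 1) (F k) =
    c • ∑ k ∈ α.support, coeff (α - single k 1) (F k)
  rw [Finset.smul_sum]

theorem mul_timesSum (f : MvPowerSeries ℕ R) (F : ℕ → MvPowerSeries ℕ R) :
    f * timesSum F = timesSum (fun k => f * F k) := by
  ext α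
  simp only [coeff_timesSum, coeff_mul, Finset.mul_sum]
  exact sum_antidiagonal_sum_support (fun k p q => coeff p f * coeff q (F k)) α

theorem timesSum_mul (f : MvPowerSeries ℕ R) (F : ℕ → MvPowerSeries ℕ R) :
    timesSum F * f = timesSum (fun k => F k * f) := by
  simp only [mul_comm _ f, mul_timesSum]

/-- The last summand is the commutator [∂/∂t_b, t_b] = 1. -/
theorem pderiv_timesSum (b : ℕ) (F : ℕ → MvPowerSeries ℕ R) :
    pderiv R b (timesSum F) = timesSum (fun k => pderiv R b (F k)) + F b := by
  classical
  ext α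
  rw [map_add, coeff_pderiv, coeff_timesSum, coeff_timesSum]
  have hs : (α + single b 1).support = insert b (α.support.erase b) := by
    ext k
    by_cases hk : k = b
    · subst hk; simp
    · simp [hk]
  have key : ∀ k ∈ α.support.erase b,
      coeff (α + single b 1 - single k 1) (F k) * ((α b : R) + 1) =
        coeff (α - single k 1) (pderiv R b (F k)) := by
    intro k hk
    simp only [Finset.mem_erase, Finsupp.mem_support_iff] at hk
    have hle : single k 1 ≤ α := Finsupp.single_le_iff.2 (by omega)
    rw [coeff_pderiv, tsub_add_eq_add_tsub hle]
    simp [hk.1]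
  rw [hs, Finset.sum_insert (by simp), add_mul, Finset.sum_mul, Finset.sum_congr rfl key,
    add_tsub_cancel_right]
  by_cases hb : b ∈ α.support
  · rw [← Finset.add_sum_erase _ _ hb, coeff_pderiv]
    have hb' := Finsupp.mem_support_iff.1 hb
    rw [tsub_add_cancel_of_le (Finsupp.single_le_iff.2 (by omega))]
    have : (((α - single b 1 : ℕ →₀ ℕ) b : ℕ) : R) + 1 = (α b : R) := by
      simp only [Finsupp.tsub_apply, Finsupp.single_eq_same]
      rw [Nat.cast_sub (by omega)]; simp
    rw [this]; ring
  · rw [Finset.erase_eq_of_notMem hb, Finsupp.notMem_support_iff.1 hb]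
    simp [add_comm]

theorem pderiv_smul [Algebra ℝ R] (c : ℝ) (b : ℕ) (F : MvPowerSeries ℕ R) :
    pderiv R b (c • F) = c • pderiv R b F := by
  ext α
  change coeff α (pderiv R b (c • F)) = c • coeff α (pderiv R b F)
  rw [coeff_pderiv, coeff_pderiv, ← smul_mul_assoc]
  rfl

theorem pderiv_comm (a b : ℕ) (F : MvPowerSeries ℕ R) :
    pderiv R a (pderiv R b F) = pderiv R b (pderiv R a F) := by
  ext α
  simp only [coeff_pderiv]
  rw [add_right_comm]
  by_cases h : a = b
  · subst h; ring
  · simp [h, Ne.symm h]; ring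

end

end MvPowerSeries

/-! ### Polynomials in the derivations ∂/∂t_k acting on series -/

namespace TimeOp

open MvPowerSeries
open Finset.HasAntidiagonal (antidiagonal mem_antidiagonal)
open Finsupp (single)

variable {R : Type*} [CommRing R] [Algebra ℝ R]

/-- The action of a polynomial in the derivations on formal power series in the times. -/
noncomputable def diffAct (f : MvPolynomial ℕ ℝ) (F : MvPowerSeries ℕ R) : MvPowerSeries ℕ R :=
  fun β => ∑ δ ∈ f.support,
    (MvPolynomial.coeff δ f * ∏ k ∈ δ.support, ((β k + δ k).descFactorial (δ k) : ℝ)) •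
      MvPowerSeries.coeff (β + δ) F

theorem coeff_diffAct (f : MvPolynomial ℕ ℝ) (F : MvPowerSeries ℕ R) (β : ℕ →₀ ℕ) :
    coeff β (diffAct f F) = ∑ δ ∈ f.support,
      (MvPolynomial.coeff δ f * ∏ k ∈ δ.support, ((β k + δ k).descFactorial (δ k) : ℝ)) •
        MvPowerSeries.coeff (β + δ) F := rfl

theorem coeff_diffAct_of_subset (f : MvPolynomial ℕ ℝ) (F : MvPowerSeries ℕ R) (β : ℕ →₀ ℕ)
    (S : Finset (ℕ →₀ ℕ)) (hS : f.support ⊆ S) :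
    coeff β (diffAct f F) = ∑ δ ∈ S,
      (MvPolynomial.coeff δ f * ∏ k ∈ δ.support, ((β k + δ k).descFactorial (δ k) : ℝ)) •
        MvPowerSeries.coeff (β + δ) F := by
  rw [coeff_diffAct]
  refine Finset.sum_subset hS fun δ _ h => ?_
  rw [MvPolynomial.notMem_support_iff.1 h, zero_mul, zero_smul]

theorem diffAct_add_left (f g : MvPolynomial ℕ ℝ) (F : MvPowerSeries ℕ R) :
    diffAct (f + g) F = diffAct f F + diffAct g F := by
  classical
  ext β
  rw [map_add, coeff_diffAct_of_subset (f + g) F β (f.support ∪ g.support)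
    MvPolynomial.support_add, coeff_diffAct_of_subset f F β (f.support ∪ g.support)
    Finset.subset_union_left, coeff_diffAct_of_subset g F β (f.support ∪ g.support)
    Finset.subset_union_right, ← Finset.sum_add_distrib]
  refine Finset.sum_congr rfl fun δ _ => ?_
  rw [MvPolynomial.coeff_add, add_mul, add_smul]

theorem diffAct_smul_left (c : ℝ) (f : MvPolynomial ℕ ℝ) (F : MvPowerSeries ℕ R) :
    diffAct (c • f) F = c • diffAct f F := by
  ext β
  rw [coeff_diffAct_of_subset (c • f) F β f.support MvPolynomial.support_smul]
  change _ = c • coeff β (diffAct f F)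
  rw [coeff_diffAct, Finset.smul_sum]
  refine Finset.sum_congr rfl fun δ _ => ?_
  rw [MvPolynomial.coeff_smul, smul_eq_mul, mul_assoc, mul_smul]

theorem diffAct_zero_left (F : MvPowerSeries ℕ R) : diffAct 0 F = 0 := by
  ext β
  rw [coeff_diffAct, MvPolynomial.support_zero, Finset.sum_empty, coeff_zero]

theorem diffAct_add_right (f : MvPolynomial ℕ ℝ) (F G : MvPowerSeries ℕ R) :
    diffAct f (F + G) = diffAct f F + diffAct f G := by
  ext β
  simp only [coeff_diffAct, map_add, smul_add, Finset.sum_add_distrib]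

theorem diffAct_monomial (δ : ℕ →₀ ℕ) (c : ℝ) (F : MvPowerSeries ℕ R) (β : ℕ →₀ ℕ) :
    coeff β (diffAct (MvPolynomial.monomial δ c) F) =
      (c * ∏ k ∈ δ.support, ((β k + δ k).descFactorial (δ k) : ℝ)) • coeff (β + δ) F := by
  classical
  rw [coeff_diffAct_of_subset _ F β {δ} MvPolynomial.support_monomial_subset,
    Finset.sum_singleton, MvPolynomial.coeff_monomial, if_pos rfl]

theorem diffAct_C (c : ℝ) (F : MvPowerSeries ℕ R) : diffAct (MvPolynomial.C c) F = c • F := by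
  ext β
  rw [MvPolynomial.C_apply, diffAct_monomial]
  simp only [Finsupp.support_zero, Finset.prod_empty, mul_one, add_zero]
  rfl

/-- One more derivative in t_b lengthens the falling factorial at b by its lowest factor β_b + 1. -/
theorem prod_descFactorial_add_single (β δ : ℕ →₀ ℕ) (b : ℕ) :
    ∏ k ∈ (δ + single b 1).support, ((β k + (δ + single b 1 : ℕ →₀ ℕ) k).descFactorial ((δ + single b 1 : ℕ →₀ ℕ) k) : ℝ)
      = (∏ k ∈ δ.support, (((β + single b 1 : ℕ →₀ ℕ) k + δ k).descFactorial (δ k) : ℝ)) * ((β b : ℝ) + 1) := by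
  classical
  have hs : (δ + single b 1).support = insert b (δ.support.erase b) := by
    ext k
    by_cases hk : k = b
    · subst hk; simp
    · simp [hk]
  have h2 : ∏ k ∈ δ.support, (((β + single b 1 : ℕ →₀ ℕ) k + δ k).descFactorial (δ k) : ℝ) =
      ∏ k ∈ insert b (δ.support.erase b),
        (((β + single b 1 : ℕ →₀ ℕ) k + δ k).descFactorial (δ k) : ℝ) := by
    by_cases hb : b ∈ δ.support
    · rw [Finset.insert_erase hb]
    · rw [Finset.erase_eq_of_notMem hb, Finset.prod_insert hb, Finsupp.notMem_support_iff.1 hb]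
      simp
  rw [hs, h2, Finset.prod_insert (by simp), Finset.prod_insert (by simp), mul_right_comm]
  congr 1
  · simp only [Finsupp.add_apply, Finsupp.single_eq_same]
    rw [← add_assoc, Nat.descFactorial_succ, add_right_comm (β b) 1 (δ b),
      show β b + δ b + 1 - δ b = β b + 1 by omega]
    push_cast; ring
  · refine Finset.prod_congr rfl fun k hk => ?_
    have : b ≠ k := (Finset.ne_of_mem_erase hk).symm
    simp [this]

/-- Identifies the explicit falling-factorial formula with iterated differentiation; all further
composition rules for `diffAct` rest on it. -/
theorem pderiv_diffAct (f : MvPolynomial ℕ ℝ) (b : ℕ) (F : MvPowerSeries ℕ R) :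
    pderiv R b (diffAct f F) = diffAct (f * MvPolynomial.X b) F := by
  induction f using MvPolynomial.induction_on' with
  | monomial δ c =>
    ext β
    rw [MvPolynomial.X, MvPolynomial.monomial_mul, mul_one, coeff_pderiv, diffAct_monomial,
      diffAct_monomial, prod_descFactorial_add_single, add_right_comm, add_assoc]
    have : (β b : R) + 1 = algebraMap ℝ R ((β b : ℝ) + 1) := by simp
    rw [this, mul_comm, ← Algebra.smul_def, smul_smul]
    congr 1
    ring
  | add p q hp hq => rw [add_mul, diffAct_add_left, diffAct_add_left, map_add, hp, hq]

theorem diffAct_mul_X (f : MvPolynomial ℕ ℝ) (b : ℕ) (F : MvPowerSeries ℕ R) :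
    diffAct (f * MvPolynomial.X b) F = diffAct f (pderiv R b F) := by
  induction f using MvPolynomial.induction_on with
  | C c =>
    rw [← pderiv_diffAct, diffAct_C, diffAct_C, pderiv_smul]
  | add p q hp hq => rw [add_mul, diffAct_add_left, hp, hq, diffAct_add_left]
  | mul_X p j hp => rw [mul_right_comm, ← pderiv_diffAct, hp, pderiv_diffAct]

end TimeOp

/-! ### Composition of operators in the times with ∂/∂t_b and with the Virasoro operators -/

namespace TimeOp

open MvPowerSeries
open Finset.HasAntidiagonal (antidiagonal mem_antidiagonal)
open Finsupp (single)

variable {R : Type*} [CommRing R] [Algebra ℝ R]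

theorem coeff_act (A : TimeOp) (F : MvPowerSeries ℕ R) (α : ℕ →₀ ℕ) :
    coeff α (A.act F) = ∑ x ∈ antidiagonal α, coeff x.2 (diffAct (coeff x.1 A) F) := rfl

theorem act_add_left (A B : TimeOp) (F : MvPowerSeries ℕ R) :
    (A + B).act F = A.act F + B.act F := by
  ext α
  simp only [coeff_act, map_add, diffAct_add_left, Finset.sum_add_distrib]

theorem act_add_right (A : TimeOp) (F G : MvPowerSeries ℕ R) :
    A.act (F + G) = A.act F + A.act G := by
  ext α
  simp only [coeff_act, map_add, diffAct_add_right, Finset.sum_add_distrib]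

theorem act_smul_left (c : ℝ) (A : TimeOp) (F : MvPowerSeries ℕ R) :
    (c • A).act F = c • A.act F := by
  ext α
  change coeff α ((c • A).act F) = c • coeff α (A.act F)
  rw [coeff_act, coeff_act, Finset.smul_sum]
  refine Finset.sum_congr rfl fun x _ => ?_
  change coeff x.2 (diffAct (c • coeff x.1 A) F) = _
  rw [diffAct_smul_left]
  rfl

theorem act_zero_left (F : MvPowerSeries ℕ R) : (0 : TimeOp).act F = 0 := by
  ext α
  simp only [coeff_act, coeff_zero, diffAct_zero_left, Finset.sum_const_zero]

theorem act_sum_left {ι : Type*} (s : Finset ι) (A : ι → TimeOp) (F : MvPowerSeries ℕ R) :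
    (∑ i ∈ s, A i).act F = ∑ i ∈ s, (A i).act F := by
  classical
  induction s using Finset.induction_on with
  | empty => rw [Finset.sum_empty, Finset.sum_empty, act_zero_left]
  | insert i s hi ih => rw [Finset.sum_insert hi, Finset.sum_insert hi, act_add_left, ih]

theorem sum_antidiagonal_sum_support_left {M : Type*} [AddCommMonoid M]
    (h : ℕ → (ℕ →₀ ℕ) → (ℕ →₀ ℕ) → M) (α : ℕ →₀ ℕ) :
    ∑ x ∈ antidiagonal α, ∑ k ∈ x.1.support, h k (x.1 - single k 1) x.2 =
      ∑ k ∈ α.support, ∑ x ∈ antidiagonal (α - single k 1), h k x.1 x.2 := by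
  rw [Finsupp.sum_antidiagonal_swap α
    fun p q => ∑ k ∈ p.support, h k (p - single k 1) q]
  rw [sum_antidiagonal_sum_support (fun k p q => h k q p) α]
  exact Finset.sum_congr rfl fun k _ => Finsupp.sum_antidiagonal_swap _ fun p q => h k q p

theorem diffAct_sum_left {ι : Type*} (s : Finset ι) (f : ι → MvPolynomial ℕ ℝ)
    (F : MvPowerSeries ℕ R) : diffAct (∑ i ∈ s, f i) F = ∑ i ∈ s, diffAct (f i) F := by
  classical
  induction s using Finset.induction_on with
  | empty => rw [Finset.sum_empty, Finset.sum_empty, diffAct_zero_left]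
  | insert i s hi ih => rw [Finset.sum_insert hi, Finset.sum_insert hi, diffAct_add_left, ih]

theorem act_timesSum (A : ℕ → TimeOp) (F : MvPowerSeries ℕ R) :
    TimeOp.act (timesSum A) F = timesSum fun k => (A k).act F := by
  ext α
  simp only [coeff_act, coeff_timesSum, diffAct_sum_left, map_sum]
  exact sum_antidiagonal_sum_support_left
    (fun k p q => coeff q (diffAct (coeff p (A k)) F)) α

/-- The composition of `∂/∂t_b` with a differential operator in the times. -/
noncomputable def diffComp (b : ℕ) (A : TimeOp) : TimeOp :=
  C (MvPolynomial.X b) * A + pderiv (MvPolynomial ℕ ℝ) b A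

theorem coeff_diffComp (b : ℕ) (A : TimeOp) (α : ℕ →₀ ℕ) :
    coeff α (diffComp b A) = coeff α A * MvPolynomial.X b +
      ((α b : ℝ) + 1) • coeff (α + single b 1) A := by
  rw [diffComp, map_add, coeff_C_mul, coeff_pderiv, mul_comm, Algebra.smul_def, mul_comm (coeff _ A)]
  simp [mul_comm]

theorem act_diffComp (b : ℕ) (A : TimeOp) (F : MvPowerSeries ℕ R) :
    (diffComp b A).act F = pderiv R b (A.act F) := by
  ext α
  rw [coeff_pderiv, coeff_act]
  simp only [coeff_diffComp, diffAct_add_left, diffAct_smul_left, map_add, ← pderiv_diffAct,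
    coeff_pderiv]
  have h1 := sum_antidiagonal_add_single b (fun p q => coeff q (diffAct (coeff p A) F)) α
  have h2 := sum_antidiagonal_add_single b (fun q p => coeff q (diffAct (coeff p A) F)) α
  rw [Finsupp.sum_antidiagonal_swap _ fun p q => q b • coeff p (diffAct (coeff q A) F),
    Finsupp.sum_antidiagonal_swap α
      fun p q => (q b + 1) • coeff p (diffAct (coeff (q + single b 1) A) F)] at h2
  -- Leibniz rule: the exponent α_b + 1 splits into the exponents of the two factors.
  have h3 : coeff (α + single b 1) (A.act F) * ((α b : R) + 1) =
      ∑ x ∈ antidiagonal (α + single b 1), (x.2 : ℕ →₀ ℕ) b • coeff x.2 (diffAct (coeff x.1 A) F) +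
      ∑ x ∈ antidiagonal (α + single b 1), (x.1 : ℕ →₀ ℕ) b • coeff x.2 (diffAct (coeff x.1 A) F) := by
    rw [coeff_act, Finset.sum_mul, ← Finset.sum_add_distrib]
    refine Finset.sum_congr rfl fun x hx => ?_
    rw [← add_smul, ← Finsupp.add_apply, add_comm x.2, mem_antidiagonal.1 hx, nsmul_eq_mul,
      mul_comm]
    simp
  rw [h3, h1, h2, ← Finset.sum_add_distrib]
  refine Finset.sum_congr rfl fun x _ => ?_
  congr 1
  · rw [nsmul_eq_mul, mul_comm]; simp
  · change ((x.1 b : ℝ) + 1) • coeff x.2 (diffAct (coeff (x.1 + single b 1) A) F) = _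
    rw [← Nat.cast_smul_eq_nsmul ℝ]
    push_cast
    rfl

/-- The derivation `X_k ↦ k X_{k+i-1}` by which the commutator with the linear part of the
Virasoro operator `L_{i-1}` acts on polynomials in the derivations. -/
noncomputable def virasoroDerivation (i : ℕ) :
    RealDerivation (MvPolynomial ℕ ℝ) :=
  MvPolynomial.mkDerivation ℝ fun k => (k : ℝ) • MvPolynomial.X (k + i - 1)

/-- The composition of a differential operator in the times with the Virasoro operator
`L_{i-1}`. -/
noncomputable def virasoroComp (i : ℕ) (A : TimeOp) : TimeOp :=
  C (∑ k ∈ Finset.range i, MvPolynomial.X k * MvPolynomial.X (i - 1 - k)) * A +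
    timesSum (fun k => C ((k : MvPolynomial ℕ ℝ) * MvPolynomial.X (k + i - 1)) * A) +
    mapDerivation (virasoroDerivation i) A

theorem act_C (f : MvPolynomial ℕ ℝ) (F : MvPowerSeries ℕ R) :
    TimeOp.act (C f) F = diffAct f F := by
  classical
  ext α
  rw [coeff_act, Finset.sum_eq_single (0, α)]
  · rw [coeff_zero_C]
  · rintro ⟨p, q⟩ hx hne
    have : p ≠ 0 := by
      rintro rfl
      simp only [mem_antidiagonal, zero_add] at hx
      exact hne (by rw [hx])
    rw [coeff_C_of_ne_zero this, diffAct_zero_left, coeff_zero]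
  · intro h
    simp [mem_antidiagonal] at h

/-- The index i = n + 1 runs over ℕ. The subtraction k + i - 1 truncates only for k = i = 0, where
the coefficient k is zero. -/
theorem virasoro_eq (i : ℕ) : virasoro ((i : ℤ) - 1) =
    C (∑ k ∈ Finset.range i, MvPolynomial.X k * MvPolynomial.X (i - 1 - k)) +
    timesSum (fun k => C ((k : MvPolynomial ℕ ℝ) * MvPolynomial.X (k + i - 1))) := by
  classical
  ext1 α
  rw [map_add, coeff_C, coeff_timesSum]
  change (if α = 0 then ∑ k ∈ Finset.range ((i : ℤ) - 1 + 1).toNat,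
      MvPolynomial.X k * MvPolynomial.X ((i : ℤ) - 1 - k).toNat else 0) +
    ∑ k ∈ α.support, (if α = single k 1 then
      (k : MvPolynomial ℕ ℝ) * MvPolynomial.X ((k : ℤ) + ((i : ℤ) - 1)).toNat else 0) = _
  congr 1
  · split_ifs
    · rw [sub_add_cancel, Int.toNat_natCast]
      refine Finset.sum_congr rfl fun k hk => ?_
      have := Finset.mem_range.1 hk
      congr 2
      omega
    · rfl
  · refine Finset.sum_congr rfl fun k hk => ?_
    rw [coeff_C]
    have hle : single k 1 ≤ α :=
      Finsupp.single_le_iff.2 (Nat.one_le_iff_ne_zero.2 (Finsupp.mem_support_iff.1 hk))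
    have : α - single k 1 = 0 ↔ α = single k 1 := by
      rw [tsub_eq_zero_iff_le]
      exact ⟨fun h => le_antisymm h hle, fun h => h.le⟩
    simp only [this]
    split_ifs
    · congr 2
      omega
    · rfl

theorem act_virasoro (i : ℕ) (F : MvPowerSeries ℕ R) :
    (virasoro ((i : ℤ) - 1)).act F =
      ∑ k ∈ Finset.range i, diffAct (MvPolynomial.X k * MvPolynomial.X (i - 1 - k)) F +
      timesSum (fun k => (k : ℝ) • pderiv R (k + i - 1) F) := by
  rw [virasoro_eq, act_add_left, act_C, diffAct_sum_left, act_timesSum]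
  congr 2
  funext k
  have : (k : MvPolynomial ℕ ℝ) = MvPolynomial.C (k : ℝ) := by simp
  rw [act_C, this, diffAct_mul_X, diffAct_C]

theorem diffAct_mul (f g : MvPolynomial ℕ ℝ) (F : MvPowerSeries ℕ R) :
    diffAct (f * g) F = diffAct f (diffAct g F) := by
  induction g using MvPolynomial.induction_on generalizing F with
  | C c => rw [diffAct_C, mul_comm, MvPolynomial.C_mul', diffAct_smul_left]
           ext β
           change c • coeff β (diffAct f F) = _
           simp only [coeff_diffAct, Finset.smul_sum]
           refine Finset.sum_congr rfl fun δ _ => ?_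
           change _ = _ • (c • coeff (β + δ) F)
           rw [smul_comm]
  | add p q hp hq => rw [mul_add, diffAct_add_left, hp, hq, diffAct_add_left, diffAct_add_right]
  | mul_X p j hp => rw [← mul_assoc, diffAct_mul_X, hp, ← diffAct_mul_X]

theorem act_C_mul (f : MvPolynomial ℕ ℝ) (A : TimeOp) (F : MvPowerSeries ℕ R) :
    TimeOp.act (C f * A) F = A.act (diffAct f F) := by
  ext α
  rw [coeff_act, coeff_act]
  refine Finset.sum_congr rfl fun x _ => ?_
  rw [coeff_C_mul, mul_comm, diffAct_mul]

theorem pderiv_virasoro_linear (i b : ℕ) (F : MvPowerSeries ℕ R) :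
    pderiv R b (timesSum (fun k => (k : ℝ) • pderiv R (k + i - 1) F)) =
      timesSum (fun k => (k : ℝ) • pderiv R (k + i - 1) (pderiv R b F)) +
        (b : ℝ) • pderiv R (b + i - 1) F := by
  rw [pderiv_timesSum]
  congr 2
  funext k
  rw [pderiv_smul, pderiv_comm]

/-- Moving f(∂) to the right past each t_k differentiates f, since [∂_k, t_k] = 1; the commutators
add up to a derivation of f. -/
theorem diffAct_timesSum_pderiv (i : ℕ) (f : MvPolynomial ℕ ℝ) (F : MvPowerSeries ℕ R) :
    diffAct f (timesSum (fun k => (k : ℝ) • pderiv R (k + i - 1) F)) =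
      timesSum (fun k => (k : ℝ) • pderiv R (k + i - 1) (diffAct f F)) +
        diffAct (virasoroDerivation i f) F := by
  induction f using MvPolynomial.induction_on generalizing F with
  | C c =>
    have : virasoroDerivation i (MvPolynomial.C c) = 0 := MvPolynomial.derivation_C _ _
    rw [this, diffAct_zero_left, add_zero, diffAct_C, diffAct_C, ← timesSum_smul]
    congr 1
    funext k
    rw [pderiv_smul, smul_comm]
  | add p q hp hq =>
    rw [diffAct_add_left, hp, hq, map_add, diffAct_add_left, diffAct_add_left]
    simp only [map_add, smul_add, timesSum_add]
    abel
  | mul_X p b hp =>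
    have hX : virasoroDerivation i (MvPolynomial.X b) = (b : ℝ) • MvPolynomial.X (b + i - 1) :=
      MvPolynomial.mkDerivation_X _ _ _
    rw [diffAct_mul_X, pderiv_virasoro_linear, diffAct_add_right, hp, Derivation.leibniz, hX,
      smul_eq_mul, smul_eq_mul, mul_comm (MvPolynomial.X b), diffAct_add_left, diffAct_mul_X,
      diffAct_mul_X, mul_smul_comm, diffAct_smul_left, diffAct_mul_X, ← diffAct_C (b : ℝ),
      ← diffAct_mul, mul_comm p, MvPolynomial.C_mul', diffAct_smul_left]
    abel

/-- The quadratic part of L_(i-1) commutes with the derivations in A; bringing the times of the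
linear part to the left produces the commutator term of `virasoroComp`. -/
theorem act_virasoroComp (i : ℕ) (A : TimeOp) (F : MvPowerSeries ℕ R) :
    (virasoroComp i A).act F = A.act ((virasoro ((i : ℤ) - 1)).act F) := by
  rw [virasoroComp, act_add_left, act_add_left, act_C_mul, act_virasoro, diffAct_sum_left,
    act_add_right, add_assoc, act_timesSum]
  congr 1
  ext α
  rw [map_add, coeff_act A]
  simp only [diffAct_timesSum_pderiv, map_add, Finset.sum_add_distrib]
  congr 1
  simp only [coeff_timesSum]
  rw [sum_antidiagonal_sum_support (fun k p q =>
    coeff q ((k : ℝ) • pderiv R (k + i - 1) (diffAct (coeff p A) F))) α]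
  refine Finset.sum_congr rfl fun k _ => ?_
  rw [coeff_act]
  refine Finset.sum_congr rfl fun x _ => ?_
  have : (k : MvPolynomial ℕ ℝ) = MvPolynomial.C (k : ℝ) := by simp
  rw [coeff_C_mul, this, mul_assoc, MvPolynomial.C_mul', diffAct_smul_left, mul_comm,
    ← pderiv_diffAct]

end TimeOp

/-! Formal Laurent series in `1/x` whose coefficients are formal power series in the times. -/

namespace TimesField

open MvPowerSeries
open Finset.HasAntidiagonal (antidiagonal mem_antidiagonal)
open Finsupp (single)

/-- A field of the matrix model: the power series variable of the coefficients is `1/x`, and the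
`k`-th variable stands for `t_k x^k`. -/
abbrev _root_.TimesField (R : Type*) : Type _ := MvPowerSeries ℕ (PowerSeries R)

variable {R : Type*} [CommRing R]

/-- The weight `∑_k k α_k` of a monomial in the times. -/
noncomputable def weight : (ℕ →₀ ℕ) →+ ℕ := Finsupp.weight fun k : ℕ => k

theorem weight_single (k : ℕ) : weight (single k 1) = k := by
  simp [weight, Finsupp.weight_single]

/-- The coefficient of a power series at an integer exponent. -/
noncomputable def intCoeff (n : ℤ) : PowerSeries R →ₗ[R] R :=
  if 0 ≤ n then PowerSeries.coeff n.toNat else 0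

theorem intCoeff_natCast (n : ℕ) (g : PowerSeries R) :
    intCoeff (n : ℤ) g = PowerSeries.coeff n g := by
  simp [intCoeff]

theorem intCoeff_of_neg {n : ℤ} (hn : n < 0) (g : PowerSeries R) : intCoeff n g = 0 := by
  simp [intCoeff, not_le.2 hn]

theorem intCoeff_X_mul (n : ℤ) (g : PowerSeries R) :
    intCoeff n (PowerSeries.X * g) = intCoeff (n - 1) g := by
  rcases lt_or_ge n 0 with hn | hn
  · rw [intCoeff_of_neg hn, intCoeff_of_neg (by omega)]
  · lift n to ℕ using hn
    rw [intCoeff_natCast]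
    cases n with
    | zero => rw [intCoeff_of_neg (by simp)]; simp
    | succ n =>
      rw [PowerSeries.coeff_succ_X_mul, show ((n + 1 : ℕ) : ℤ) - 1 = (n : ℤ) by push_cast; ring,
        intCoeff_natCast]

/-- Terms beyond n have a negative exponent and vanish, so the bound is free; this lets one
truncation serve several monomials in the times. -/
theorem intCoeff_mul (n : ℤ) (A g : PowerSeries R) (B : ℕ) (hB : n < B) :
    intCoeff n (A * g) = ∑ i ∈ Finset.range B, PowerSeries.coeff i A * intCoeff (n - i) g := by
  rcases lt_or_ge n 0 with hn | hn
  · rw [intCoeff_of_neg hn]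
    refine (Finset.sum_eq_zero fun i _ => ?_).symm
    rw [intCoeff_of_neg (by omega), mul_zero]
  · lift n to ℕ using hn
    rw [intCoeff_natCast, PowerSeries.coeff_mul, Finset.Nat.sum_antidiagonal_eq_sum_range_succ
      (fun i j => PowerSeries.coeff i A * PowerSeries.coeff j g)]
    have hsub : Finset.range n.succ ⊆ Finset.range B := by
      intro i hi; simp only [Finset.mem_range] at hi ⊢; omega
    rw [← Finset.sum_subset hsub]
    · refine Finset.sum_congr rfl fun i hi => ?_
      have := Finset.mem_range.1 hi
      rw [← Nat.cast_sub (by omega), intCoeff_natCast]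
    · intro i _ hi
      rw [Finset.mem_range] at hi
      rw [intCoeff_of_neg (by omega), mul_zero]

/-- The coefficient of `x^(-j)` of a field. -/
noncomputable def laurentCoeff (j : ℤ) : TimesField R →+ MvPowerSeries ℕ R where
  -- The k-th variable stands for t_k x^k, so t^α comes with x^(weight α), and x^(-j) is found at
  -- exponent j + weight α of 1/x.
  toFun f := fun α => intCoeff (j + weight α) (coeff α f)
  map_zero' := by ext α; exact map_zero (intCoeff (R := R) (j + weight α))
  map_add' f g := by ext α; exact map_add (intCoeff (j + weight α)) (coeff α f) (coeff α g)

theorem coeff_laurentCoeff (j : ℤ) (f : TimesField R) (α : ℕ →₀ ℕ) :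
    coeff α (laurentCoeff j f) = intCoeff (j + weight α) (coeff α f) := rfl

theorem coeff_laurentCoeff_of_neg {j : ℤ} (f : TimesField R) {α : ℕ →₀ ℕ}
    (h : j + weight α < 0) : coeff α (laurentCoeff j f) = 0 := intCoeff_of_neg h _

/-- The field `1/x`. -/
noncomputable def invX : TimesField R := C PowerSeries.X

theorem laurentCoeff_invX_mul (j : ℤ) (f : TimesField R) :
    laurentCoeff j (invX * f) = laurentCoeff (j - 1) f := by
  ext α
  rw [coeff_laurentCoeff, coeff_laurentCoeff, invX, coeff_C_mul, intCoeff_X_mul]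
  congr 1
  ring_nf

theorem weight_sub_single {α : ℕ →₀ ℕ} {k : ℕ} (hk : k ∈ α.support) :
    weight α = weight (α - single k 1) + k := by
  have hle : single k 1 ≤ α :=
    Finsupp.single_le_iff.2 (Nat.one_le_iff_ne_zero.2 (Finsupp.mem_support_iff.1 hk))
  conv_lhs => rw [← tsub_add_cancel_of_le hle]
  rw [map_add, weight_single]

theorem laurentCoeff_timesSum (j : ℤ) (F : ℕ → TimesField R) :
    laurentCoeff j (timesSum F) = timesSum fun k => laurentCoeff (j + k) (F k) := by
  ext α
  rw [coeff_laurentCoeff, coeff_timesSum, coeff_timesSum, map_sum]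
  refine Finset.sum_congr rfl fun k hk => ?_
  rw [coeff_laurentCoeff, weight_sub_single hk]
  push_cast
  congr 1
  ring_nf

/-- The derivative in the variable t_b x^b is x^(-b) ∂/∂t_b, hence the shift by b. -/
theorem laurentCoeff_pderiv (j : ℤ) (b : ℕ) (f : TimesField R) :
    laurentCoeff j (pderiv (PowerSeries R) b f) = pderiv R b (laurentCoeff (j - b) f) := by
  ext α
  rw [coeff_laurentCoeff, coeff_pderiv, coeff_pderiv, coeff_laurentCoeff, map_add weight,
    weight_single]
  have : (α b : PowerSeries R) + 1 = PowerSeries.C ((α b : R) + 1) := by simp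
  rw [this, mul_comm, ← PowerSeries.smul_eq_C_mul, map_smul, smul_eq_mul, mul_comm]
  push_cast
  congr 2
  ring_nf

variable [Algebra ℝ R]

theorem intCoeff_smul (n : ℤ) (c : ℝ) (g : PowerSeries R) :
    intCoeff n (c • g) = c • intCoeff n g := by
  rw [← algebraMap_smul R c g, map_smul, algebraMap_smul]

theorem laurentCoeff_smul (j : ℤ) (c : ℝ) (f : TimesField R) :
    laurentCoeff j (c • f) = c • laurentCoeff j f := by
  ext α
  exact intCoeff_smul _ c (coeff α f)

theorem coeff_coeff_mul {R : Type*} [CommRing R] (f g : TimesField R) (α : ℕ →₀ ℕ) (n : ℕ) :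
    PowerSeries.coeff n (coeff α (f * g)) = ∑ x ∈ antidiagonal α, ∑ y ∈ antidiagonal n,
      PowerSeries.coeff y.1 (coeff x.1 f) * PowerSeries.coeff y.2 (coeff x.2 g) := by
  rw [coeff_mul, map_sum]
  exact Finset.sum_congr rfl fun x _ => PowerSeries.coeff_mul _ _ _

/-- The function underlying the Euler operator `x d/dx`. -/
noncomputable def eulerFun (f : TimesField R) : TimesField R :=
  fun α => PowerSeries.mk fun n => ((weight α : ℝ) - n) • PowerSeries.coeff n (coeff α f)

theorem coeff_coeff_eulerFun (f : TimesField R) (α : ℕ →₀ ℕ) (n : ℕ) :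
    PowerSeries.coeff n (coeff α (eulerFun f)) =
      ((weight α : ℝ) - n) • PowerSeries.coeff n (coeff α f) :=
  PowerSeries.coeff_mk n fun n => ((weight α : ℝ) - n) • PowerSeries.coeff n (coeff α f)

theorem coeff_coeff_smul (c : ℝ) (f : TimesField R) (α : ℕ →₀ ℕ) (n : ℕ) :
    PowerSeries.coeff n (coeff α (c • f)) = c • PowerSeries.coeff n (coeff α f) := rfl

variable (R) in
/-- The Euler operator `x d/dx`. -/
noncomputable def euler : RealDerivation (TimesField R) :=
  Derivation.mk'
    { toFun := eulerFun
      map_add' := fun f g => by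
        ext α n
        simp only [coeff_coeff_eulerFun, map_add, smul_add]
      map_smul' := fun c f => by
        ext α n
        rw [coeff_coeff_eulerFun, RingHom.id_apply, coeff_coeff_smul, coeff_coeff_smul,
          coeff_coeff_eulerFun, smul_comm] }
    (fun f g => by
      ext α n
      change PowerSeries.coeff n (coeff α (eulerFun (f * g))) =
        PowerSeries.coeff n (coeff α (f * eulerFun g + g * eulerFun f))
      rw [coeff_coeff_eulerFun, mul_comm g, map_add, map_add, coeff_coeff_mul, coeff_coeff_mul,
        coeff_coeff_mul, ← Finset.sum_add_distrib, Finset.smul_sum]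
      refine Finset.sum_congr rfl fun x hx => ?_
      rw [← Finset.sum_add_distrib, Finset.smul_sum]
      refine Finset.sum_congr rfl fun y hy => ?_
      rw [coeff_coeff_eulerFun, coeff_coeff_eulerFun, mul_smul_comm, smul_mul_assoc, ← add_smul]
      congr 1
      rw [← mem_antidiagonal.1 hx, ← mem_antidiagonal.1 hy, map_add]
      push_cast
      ring)

theorem coeff_coeff_euler (f : TimesField R) (α : ℕ →₀ ℕ) (n : ℕ) :
    PowerSeries.coeff n (coeff α (euler R f)) =
      ((weight α : ℝ) - n) • PowerSeries.coeff n (coeff α f) :=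
  coeff_coeff_eulerFun f α n

variable (R) in
/-- The derivation `d/dx`. -/
noncomputable def deriv : RealDerivation (TimesField R) := (invX : TimesField R) • euler R

theorem deriv_apply (f : TimesField R) : deriv R f = invX * euler R f := rfl

theorem laurentCoeff_euler (j : ℤ) (f : TimesField R) :
    laurentCoeff j (euler R f) = (-j : ℝ) • laurentCoeff j f := by
  ext α
  change _ = (-j : ℝ) • coeff α (laurentCoeff j f)
  rw [coeff_laurentCoeff, coeff_laurentCoeff]
  rcases lt_or_ge (j + weight α) 0 with h | h
  · rw [intCoeff_of_neg h, intCoeff_of_neg h, smul_zero]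
  · obtain ⟨n, hn⟩ := Int.eq_ofNat_of_zero_le h
    rw [hn, intCoeff_natCast, intCoeff_natCast, coeff_coeff_euler]
    congr 1
    have : ((j + weight α : ℤ) : ℝ) = ((n : ℤ) : ℝ) := by rw [hn]
    push_cast at this
    linarith

/-- The factor vanishes at j = 1: a derivative has no residue, so its negative powers see only
negative powers of f. -/
theorem laurentCoeff_deriv (j : ℤ) (f : TimesField R) :
    laurentCoeff j (deriv R f) = (1 - j : ℝ) • laurentCoeff (j - 1) f := by
  rw [deriv_apply, laurentCoeff_invX_mul, laurentCoeff_euler]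
  congr 1
  push_cast
  ring

variable (R) in
/-- The field `V'(x) = ∑_k k t_k x^(k-1)`. -/
noncomputable def potential : TimesField R :=
  invX * timesSum fun k => C (k : PowerSeries R)

theorem potential_mul (f : TimesField R) :
    potential R * f = timesSum fun k => (k : ℝ) • (invX * f) := by
  rw [potential, mul_assoc, timesSum_mul, mul_timesSum]
  congr 1
  funext k
  rw [Algebra.smul_def]
  have : (algebraMap ℝ (TimesField R)) (k : ℝ) = C (k : PowerSeries R) := by simp
  rw [this]
  ring

theorem laurentCoeff_potential_mul (j : ℤ) (f : TimesField R) :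
    laurentCoeff j (potential R * f) =
      timesSum fun k => (k : ℝ) • laurentCoeff (j + k - 1) f := by
  rw [potential_mul, laurentCoeff_timesSum]
  congr 1
  funext k
  rw [laurentCoeff_smul, laurentCoeff_invX_mul]

end TimesField

/-! ### The current and the energy-momentum tensor -/

namespace TimesField

open MvPowerSeries TimeOp
open Finset.HasAntidiagonal (antidiagonal mem_antidiagonal)
open Finsupp (single)

section

variable {R : Type*} [CommRing R]

/-- The power series `∑_k p_k x^(-k)`. -/
noncomputable def powerSumSeries (p : ℕ → R) : PowerSeries R := PowerSeries.mk p

/-- The current `J(x) = ∑_k p_k x^(-k-1)`. -/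
noncomputable def current (p : ℕ → R) : TimesField R := invX * C (powerSumSeries p)

theorem coeff_X_mul_powerSumSeries_mul (p : ℕ → R) (i : ℕ) :
    PowerSeries.coeff i (PowerSeries.X * (powerSumSeries p * powerSumSeries p)) =
      ∑ k ∈ Finset.range i, p k * p (i - 1 - k) := by
  cases i with
  | zero => simp
  | succ i =>
    rw [PowerSeries.coeff_succ_X_mul, PowerSeries.coeff_mul,
      Finset.Nat.sum_antidiagonal_eq_sum_range_succ
        (fun a b => PowerSeries.coeff a (powerSumSeries p) * PowerSeries.coeff b (powerSumSeries p))]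
    simp [powerSumSeries]

theorem coeff_laurentCoeff_C_mul (A : PowerSeries R) (f : TimesField R) (j : ℤ) (α : ℕ →₀ ℕ)
    (B : ℕ) (hB : j + weight α < B) :
    coeff α (laurentCoeff j (C A * f)) =
      ∑ i ∈ Finset.range B, PowerSeries.coeff i A * coeff α (laurentCoeff (j - i) f) := by
  rw [coeff_laurentCoeff, coeff_C_mul, intCoeff_mul _ _ _ B hB]
  refine Finset.sum_congr rfl fun i _ => ?_
  rw [coeff_laurentCoeff]
  congr 2
  ring_nf

theorem coeff_laurentCoeff_current_mul (p : ℕ → R) (f : TimesField R) (j : ℤ) (α : ℕ →₀ ℕ)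
    (B : ℕ) (hB : j + weight α ≤ B) :
    coeff α (laurentCoeff j (current p * f)) =
      ∑ i ∈ Finset.range B, p i * coeff α (laurentCoeff (j - 1 - i) f) := by
  rw [current, mul_assoc, laurentCoeff_invX_mul, coeff_laurentCoeff_C_mul _ _ _ _ B (by omega)]
  simp [powerSumSeries]

theorem coeff_laurentCoeff_current_mul_current_mul (p : ℕ → R) (f : TimesField R) (j : ℤ)
    (α : ℕ →₀ ℕ) (B : ℕ) (hB : j + weight α ≤ B) :
    coeff α (laurentCoeff j (current p * (current p * f))) =
      ∑ i ∈ Finset.range B, (∑ k ∈ Finset.range i, p k * p (i - 1 - k)) *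
        coeff α (laurentCoeff (j - 1 - i) f) := by
  have : current p * (current p * f) =
      invX * (C (PowerSeries.X * (powerSumSeries p * powerSumSeries p)) * f) := by
    rw [current, map_mul, map_mul, invX]; ring
  rw [this, laurentCoeff_invX_mul, coeff_laurentCoeff_C_mul _ _ _ _ B (by omega)]
  simp only [coeff_X_mul_powerSumSeries_mul]

end

section Nabla

/-- The function underlying `virasoroField`. -/
noncomputable def virasoroFieldFun (g : PowerSeries (MvPolynomial ℕ ℝ)) :
    PowerSeries (MvPolynomial ℕ ℝ) :=
  PowerSeries.mk fun n =>
    ∑ i ∈ Finset.range n, virasoroDerivation i (PowerSeries.coeff (n - 1 - i) g)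

theorem coeff_virasoroFieldFun (g : PowerSeries (MvPolynomial ℕ ℝ)) (n : ℕ) :
    PowerSeries.coeff n (virasoroFieldFun g) =
      ∑ i ∈ Finset.range n, virasoroDerivation i (PowerSeries.coeff (n - 1 - i) g) :=
  PowerSeries.coeff_mk _ _

/-- Up to any fixed order the infinite sum agrees with a finite sum of derivations; this gives the
Leibniz rule for `virasoroField`. -/
theorem coeff_virasoroFieldFun_eq (g : PowerSeries (MvPolynomial ℕ ℝ)) {n N : ℕ} (h : n ≤ N) :
    PowerSeries.coeff n (virasoroFieldFun g) = PowerSeries.coeff n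
      (∑ i ∈ Finset.range N, PowerSeries.X ^ (i + 1) * mapDerivation (virasoroDerivation i) g) := by
  rw [coeff_virasoroFieldFun, map_sum]
  have hsub : Finset.range n ⊆ Finset.range N := by
    intro i hi; simp only [Finset.mem_range] at hi ⊢; omega
  rw [← Finset.sum_subset hsub]
  · refine Finset.sum_congr rfl fun i hi => ?_
    have := Finset.mem_range.1 hi
    rw [PowerSeries.coeff_X_pow_mul', if_pos (by omega), coeff_mapDerivation_powerSeries,
      show n - (i + 1) = n - 1 - i by omega]
  · intro i _ hi
    rw [Finset.mem_range] at hi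
    rw [PowerSeries.coeff_X_pow_mul', if_neg (by omega)]

/-- The derivation `∑_{m ≥ -1} x^(-m-2) δ_m`, where `δ_m` sends `p_k` to `k p_{k+m}`. -/
noncomputable def virasoroField :
    RealDerivation (PowerSeries (MvPolynomial ℕ ℝ)) :=
  Derivation.mk'
    { toFun := virasoroFieldFun
      map_add' := fun f g => by
        ext1 n
        simp only [coeff_virasoroFieldFun, map_add, Finset.sum_add_distrib]
      map_smul' := fun c f => by
        ext1 n
        change PowerSeries.coeff n (virasoroFieldFun (c • f)) =
          c • PowerSeries.coeff n (virasoroFieldFun f)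
        rw [coeff_virasoroFieldFun, coeff_virasoroFieldFun, Finset.smul_sum]
        refine Finset.sum_congr rfl fun i _ => ?_
        rw [← Derivation.map_smul]
        rfl }
    (fun f g => by
      ext1 n
      change PowerSeries.coeff n (virasoroFieldFun (f * g)) =
        PowerSeries.coeff n (f * virasoroFieldFun g + g * virasoroFieldFun f)
      set T := fun h : PowerSeries (MvPolynomial ℕ ℝ) =>
        ∑ i ∈ Finset.range n, PowerSeries.X ^ (i + 1) * mapDerivation (virasoroDerivation i) h
        with hT
      have key : ∀ a b : PowerSeries (MvPolynomial ℕ ℝ),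
          PowerSeries.coeff n (a * virasoroFieldFun b) = PowerSeries.coeff n (a * T b) := by
        intro a b
        rw [PowerSeries.coeff_mul, PowerSeries.coeff_mul]
        refine Finset.sum_congr rfl fun x hx => ?_
        rw [coeff_virasoroFieldFun_eq b (N := n)]
        have := mem_antidiagonal.1 hx
        omega
      rw [map_add, key, key, coeff_virasoroFieldFun_eq (f * g) le_rfl, ← map_add]
      congr 1
      simp only [hT, Finset.mul_sum, ← Finset.sum_add_distrib]
      refine Finset.sum_congr rfl fun i _ => ?_
      rw [Derivation.leibniz, smul_eq_mul, smul_eq_mul]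
      ring)

theorem coeff_virasoroField (g : PowerSeries (MvPolynomial ℕ ℝ)) (n : ℕ) :
    PowerSeries.coeff n (virasoroField g) =
      ∑ i ∈ Finset.range n, virasoroDerivation i (PowerSeries.coeff (n - 1 - i) g) :=
  coeff_virasoroFieldFun g n

theorem intCoeff_virasoroField (n : ℤ) (g : PowerSeries (MvPolynomial ℕ ℝ)) (B : ℕ) (hB : n ≤ B) :
    intCoeff n (virasoroField g) =
      ∑ i ∈ Finset.range B, virasoroDerivation i (intCoeff (n - 1 - i) g) := by
  rcases lt_or_ge n 0 with hn | hn
  · rw [intCoeff_of_neg hn]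
    refine (Finset.sum_eq_zero fun i _ => ?_).symm
    rw [intCoeff_of_neg (by omega), map_zero]
  · lift n to ℕ using hn
    rw [intCoeff_natCast, coeff_virasoroField]
    have hsub : Finset.range n ⊆ Finset.range B := by
      intro i hi; simp only [Finset.mem_range] at hi ⊢; omega
    rw [← Finset.sum_subset hsub]
    · refine Finset.sum_congr rfl fun i hi => ?_
      have := Finset.mem_range.1 hi
      rw [show (n : ℤ) - 1 - i = ((n - 1 - i : ℕ) : ℤ) by omega, intCoeff_natCast]
    · intro i _ hi
      rw [Finset.mem_range] at hi
      rw [intCoeff_of_neg (by omega), map_zero]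

/-- The derivation `t_b ↦ ∑_{k ≥ b+2} k t_k x^(k-2-b)`. -/
noncomputable def timesField (R : Type*) [CommRing R] [Algebra ℝ R] :
    RealDerivation (TimesField R) :=
  Derivation.mk'
    { toFun := fun f => timesSum fun k => (k : ℝ) •
        -- The outer variable t_k x^k, the two factors 1/x and the derivative x^(-b) ∂/∂t_b combine
        -- to k t_k x^(k-2-b) ∂/∂t_b. The range b ≤ k - 2 selects the nonnegative powers of x.
        ∑ b ∈ Finset.range (k - 1), invX * (invX * pderiv (PowerSeries R) b f)
      map_add' := fun f g => by
        simp only [map_add, mul_add, Finset.sum_add_distrib, smul_add, timesSum_add]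
      map_smul' := fun c f => by
        rw [RingHom.id_apply, ← timesSum_smul]
        congr 1
        funext k
        rw [smul_comm c]
        simp only [pderiv_smul, mul_smul_comm, Finset.smul_sum] }
    (fun f g => by
      change timesSum _ = f * timesSum _ + g * timesSum _
      rw [mul_timesSum, mul_timesSum, ← timesSum_add]
      congr 1
      funext k
      simp only [Derivation.leibniz, smul_eq_mul, mul_smul_comm, ← smul_add, Finset.mul_sum,
        ← Finset.sum_add_distrib]
      congr 1
      refine Finset.sum_congr rfl fun b _ => ?_
      ring)

theorem timesField_apply {R : Type*} [CommRing R] [Algebra ℝ R] (f : TimesField R) :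
    timesField R f = timesSum fun k => (k : ℝ) •
      ∑ b ∈ Finset.range (k - 1), invX * (invX * pderiv (PowerSeries R) b f) := rfl

/-- The derivation of fields by which the energy-momentum tensor at `x` acts on the times and the
power sums. -/
noncomputable def stressDerivation :
    RealDerivation (TimesField (MvPolynomial ℕ ℝ)) :=
  mapDerivation virasoroField + timesField _

theorem stressDerivation_apply (f : TimesField (MvPolynomial ℕ ℝ)) :
    stressDerivation f = mapDerivation virasoroField f + timesField _ f := rfl

theorem coeff_virasoroComp (i : ℕ) (A : TimeOp) (α : ℕ →₀ ℕ) :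
    coeff α (virasoroComp i A) =
      (∑ k ∈ Finset.range i, MvPolynomial.X k * MvPolynomial.X (i - 1 - k)) * coeff α A +
      (∑ k ∈ α.support, (k : MvPolynomial ℕ ℝ) *
        (MvPolynomial.X (k + i - 1) * coeff (α - single k 1) A)) +
      virasoroDerivation i (coeff α A) := by
  rw [virasoroComp, map_add, map_add, coeff_C_mul, coeff_timesSum, coeff_mapDerivation]
  simp only [coeff_C_mul, mul_assoc]

theorem coeff_real_smul {R : Type*} [CommRing R] [Algebra ℝ R] (c : ℝ) (f : MvPowerSeries ℕ R)
    (α : ℕ →₀ ℕ) : coeff α (c • f) = c • coeff α f := rfl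

/-- V'J = ∑ k t_k p_b x^(k-2-b) is split at exponent zero: b ≤ k - 2 gives the regular modes, and b
= k + i - 1 gives the linear part of L_(i-1). -/
theorem coeff_laurentCoeff_potential_mul_current_mul {R : Type*} [CommRing R] [Algebra ℝ R]
    (p : ℕ → R) (f : TimesField R) (j : ℤ) (α : ℕ →₀ ℕ) (B : ℕ) (hB : j + weight α ≤ B) :
    coeff α (laurentCoeff j (potential R * (current p * f))) =
      ∑ k ∈ α.support, (k : ℝ) • (∑ b ∈ Finset.range (k - 1),
        p b * coeff (α - single k 1) (laurentCoeff (j + k - 2 - b) f) +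
      ∑ i ∈ Finset.range B,
        p (k + i - 1) * coeff (α - single k 1) (laurentCoeff (j - 1 - i) f)) := by
  rw [laurentCoeff_potential_mul, coeff_timesSum]
  refine Finset.sum_congr rfl fun k hk => ?_
  rw [coeff_real_smul]
  rcases Nat.eq_zero_or_pos k with rfl | hk0
  · rw [Nat.cast_zero, zero_smul, zero_smul]
  have hB' : j + k - 1 + weight (α - single k 1) ≤ ((k - 1 + B : ℕ) : ℤ) := by
    rw [weight_sub_single hk] at hB
    push_cast [Nat.cast_sub hk0] at hB ⊢
    linarith
  rw [coeff_laurentCoeff_current_mul _ _ _ _ (k - 1 + B) hB', Finset.sum_range_add]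
  congr 2
  · refine Finset.sum_congr rfl fun b _ => ?_
    rw [show j + k - 1 - 1 - b = j + k - 2 - b by ring]
  · refine Finset.sum_congr rfl fun i _ => ?_
    rw [show k + i - 1 = k - 1 + i by omega,
      show j + k - 1 - 1 - ((k - 1 + i : ℕ) : ℤ) = j - 1 - i by
        push_cast [Nat.cast_sub hk0]; ring]

/-- The Laurent coefficients of the composition of a field with the energy-momentum tensor, split
into the part that is regular in `x` and the Virasoro operators. -/
theorem coeff_laurentCoeff_stress (f : TimesField (MvPolynomial ℕ ℝ)) (j : ℤ) (α : ℕ →₀ ℕ) (B : ℕ)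
    (hB : j + weight α ≤ B) :
    coeff α (laurentCoeff j (current MvPolynomial.X * (current MvPolynomial.X * f) +
        potential _ * (current MvPolynomial.X * f) + stressDerivation f)) =
      coeff α (timesSum fun k => (k : ℝ) • ∑ b ∈ Finset.range (k - 1),
        diffComp b (laurentCoeff (j + k - 2 - b) f)) +
      ∑ i ∈ Finset.range B, coeff α (virasoroComp i (laurentCoeff (j - 1 - i) f)) := by
  -- The two parts of E are the two reordering terms: the first moves f past the times of the
  -- singular modes on its right, the second moves the derivations of the regular modes on the left
  -- past f.
  have h1 : coeff α (laurentCoeff j (mapDerivation virasoroField f)) =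
      ∑ i ∈ Finset.range B, virasoroDerivation i (coeff α (laurentCoeff (j - 1 - i) f)) := by
    rw [coeff_laurentCoeff, coeff_mapDerivation, intCoeff_virasoroField _ _ B hB]
    refine Finset.sum_congr rfl fun i _ => ?_
    rw [coeff_laurentCoeff]
    congr 2
    ring_nf
  have h2 : laurentCoeff j (timesField _ f) = timesSum fun k => (k : ℝ) •
      ∑ b ∈ Finset.range (k - 1), pderiv (MvPolynomial ℕ ℝ) b (laurentCoeff (j + k - 2 - b) f) := by
    rw [timesField_apply, laurentCoeff_timesSum]
    congr 1
    funext k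
    rw [laurentCoeff_smul, map_sum]
    congr 1
    refine Finset.sum_congr rfl fun b _ => ?_
    rw [laurentCoeff_invX_mul, laurentCoeff_invX_mul, laurentCoeff_pderiv]
    congr 2
    ring_nf
  rw [map_add, map_add, map_add, map_add, stressDerivation_apply, map_add, map_add, h1, h2,
    coeff_laurentCoeff_potential_mul_current_mul _ _ _ _ B hB,
    coeff_laurentCoeff_current_mul_current_mul _ _ _ _ B hB]
  simp only [coeff_virasoroComp, Finset.sum_add_distrib, coeff_timesSum, diffComp, map_sum,
    coeff_real_smul, map_add, coeff_C_mul, smul_add]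
  rw [Finset.sum_comm (s := Finset.range B)]
  simp only [Algebra.smul_def, Finset.mul_sum]
  simp only [map_natCast]
  abel

end Nabla

end TimesField

/-! ### The action of E on the derivatives of J and V' -/

namespace TimesField

open MvPowerSeries TimeOp
open Finsupp (single)

/-- The discrete primitive of a falling factorial. It is the source of the factor j + 2 in the
action of E on both J and V'. -/
theorem add_two_mul_sum_range_descFactorial (j m : ℕ) :
    (j + 2) * ∑ e ∈ Finset.range m, e.descFactorial (j + 1) = m.descFactorial (j + 2) := by
  induction m with
  | zero => simp
  | succ m ih =>
    rw [Finset.sum_range_succ, mul_add, ih, Nat.succ_descFactorial_succ, Nat.descFactorial_succ,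
      ← add_mul]
    rcases lt_or_ge m (j + 1) with h | h
    · rw [Nat.descFactorial_eq_zero_iff_lt.2 h]; simp
    · congr 1; omega

section

variable {R : Type*} [CommRing R] [Algebra ℝ R]

/-- The `j`-th derivative of the current, divided by `(-1)^j`. -/
noncomputable def currentDerivSeries (p : ℕ → R) (j : ℕ) : PowerSeries R :=
  PowerSeries.mk fun n => if n = 0 then 0 else
    ((-1) ^ j * ((n - 1).descFactorial j : ℝ)) • p (n - 1 - j)

theorem deriv_C (g : PowerSeries R) : deriv R (C g) =
    C (PowerSeries.X * PowerSeries.mk fun n => (-n : ℝ) • PowerSeries.coeff n g) := by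
  rw [deriv_apply, map_mul]
  congr 1
  ext α n
  rw [coeff_coeff_euler]
  by_cases h : α = 0
  · subst h
    rw [coeff_zero_C, coeff_zero_C, PowerSeries.coeff_mk, map_zero]
    congr 1
    push_cast
    ring
  · rw [coeff_C_of_ne_zero h, coeff_C_of_ne_zero h, map_zero, smul_zero]

theorem iterate_deriv_current (p : ℕ → R) (j : ℕ) :
    (deriv R)^[j] (current p) = C (currentDerivSeries p j) := by
  induction j with
  | zero =>
    rw [Function.iterate_zero, id, current, invX, ← map_mul]
    congr 1
    ext n
    cases n <;> simp [currentDerivSeries, powerSumSeries, PowerSeries.coeff_succ_X_mul]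
  | succ j ih =>
    rw [Function.iterate_succ_apply', ih, deriv_C]
    congr 1
    ext n
    cases n with
    | zero => simp [currentDerivSeries]
    | succ n =>
      rw [PowerSeries.coeff_succ_X_mul, PowerSeries.coeff_mk, currentDerivSeries,
        currentDerivSeries, PowerSeries.coeff_mk, PowerSeries.coeff_mk,
        if_neg (Nat.succ_ne_zero n)]
      cases n with
      | zero => simp
      | succ n =>
        rw [if_neg (Nat.succ_ne_zero n), smul_smul, Nat.add_sub_cancel, Nat.add_sub_cancel,
          Nat.succ_descFactorial_succ, show n + 1 - (j + 1) = n - j by omega]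
        congr 1
        push_cast
        ring

theorem euler_timesSum (F : ℕ → TimesField R) :
    euler R (timesSum F) = timesSum fun k => (k : ℝ) • F k + euler R (F k) := by
  ext α n
  rw [coeff_coeff_euler, coeff_timesSum, coeff_timesSum, map_sum, map_sum, Finset.smul_sum]
  refine Finset.sum_congr rfl fun k hk => ?_
  rw [map_add, map_add, coeff_coeff_euler, coeff_coeff_smul, ← add_smul, weight_sub_single hk]
  congr 1
  push_cast
  ring

theorem euler_invX : euler R (invX : TimesField R) = -invX := by
  ext α n
  rw [coeff_coeff_euler, map_neg, map_neg, invX]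
  by_cases h : α = 0
  · subst h
    rw [coeff_zero_C, PowerSeries.coeff_X, map_zero]
    split_ifs with h1
    · subst h1; simp
    · simp
  · rw [coeff_C_of_ne_zero h, map_zero, smul_zero, neg_zero]

theorem iterate_deriv_potential (j : ℕ) : (deriv R)^[j] (potential R) = invX ^ (j + 1) *
    timesSum fun k => (k.descFactorial (j + 1) : ℝ) • (1 : TimesField R) := by
  induction j with
  | zero =>
    rw [Function.iterate_zero, id, potential, pow_one]
    congr 2
    funext k
    rw [Algebra.smul_def]
    simp
  | succ j ih =>
    rw [Function.iterate_succ_apply', ih, deriv_apply, Derivation.leibniz, Derivation.leibniz_pow,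
      euler_invX, euler_timesSum]
    simp only [Derivation.map_smul, Derivation.map_one_eq_zero, smul_zero, add_zero, smul_smul,
      smul_eq_mul, Nat.add_sub_cancel]
    have h : (timesSum fun k => (k.descFactorial (j + 1 + 1) : ℝ) • (1 : TimesField R)) =
        (timesSum fun k => ((k : ℝ) * k.descFactorial (j + 1)) • (1 : TimesField R)) -
        ((j : ℝ) + 1) • timesSum fun k => (k.descFactorial (j + 1) : ℝ) • (1 : TimesField R) := by
      rw [eq_sub_iff_add_eq, ← timesSum_smul, ← timesSum_add]
      congr 1
      funext k
      rw [smul_smul, ← add_smul]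
      congr 1
      rw [Nat.descFactorial_succ k (j + 1)]
      rcases lt_or_ge k (j + 1) with h | h
      · rw [Nat.descFactorial_eq_zero_iff_lt.2 h]; simp
      · push_cast [Nat.cast_sub h]; ring
    rw [h, Algebra.smul_def, nsmul_eq_mul]
    simp only [map_add, map_natCast, map_one]
    push_cast
    ring

end

theorem _root_.MvPowerSeries.mapDerivation_C {A : Type*} [CommRing A] [Algebra ℝ A] (D : RealDerivation A) (a : A) :
    mapDerivation D (C a : MvPowerSeries ℕ A) = C (D a) := by
  classical
  ext n
  rw [coeff_mapDerivation, coeff_C, coeff_C]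
  split_ifs <;> simp

/-- J does not involve the times, so only `virasoroField` acts. All its contributions to a given
power of x carry the same p_k, and their coefficients sum by `add_two_mul_sum_range_descFactorial`.
-/
theorem stressDerivation_current (j : ℕ) :
    ((j : ℝ) + 2) • stressDerivation ((deriv _)^[j] (current MvPolynomial.X)) =
      (deriv _)^[j + 2] (current MvPolynomial.X) := by
  rw [iterate_deriv_current, iterate_deriv_current, stressDerivation_apply, mapDerivation_C,
    timesField_apply]
  simp only [pderiv_C, mul_zero, Finset.sum_const_zero, smul_zero]
  have h0 : (timesSum fun _ => 0 : TimesField (MvPolynomial ℕ ℝ)) = 0 := by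
    ext1 α
    simp [coeff_timesSum]
  rw [h0, add_zero]
  ext α n : 2
  rw [coeff_coeff_smul]
  by_cases h : α = 0
  · subst h
    rw [coeff_zero_C, coeff_zero_C, coeff_virasoroField]
    cases n with
    | zero => simp [currentDerivSeries]
    | succ n =>
      rw [← Finset.sum_range_reflect, currentDerivSeries, currentDerivSeries,
        PowerSeries.coeff_mk, if_neg (Nat.succ_ne_zero n), Finset.sum_range_succ']
      have key : ∀ e ∈ Finset.range n, virasoroDerivation (n + 1 - 1 - (e + 1))
          (PowerSeries.coeff (n + 1 - 1 - (n + 1 - 1 - (e + 1))) (PowerSeries.mk fun n =>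
            if n = 0 then 0 else
              ((-1) ^ j * ((n - 1).descFactorial j : ℝ)) •
                (MvPolynomial.X (n - 1 - j) : MvPolynomial ℕ ℝ))) =
          ((-1) ^ j * (e.descFactorial (j + 1) : ℝ)) • MvPolynomial.X (n - (j + 2)) := by
        intro e he
        have he' := Finset.mem_range.1 he
        rw [PowerSeries.coeff_mk, if_neg (show n + 1 - 1 - (n + 1 - 1 - (e + 1)) ≠ 0 by omega), Derivation.map_smul,
          show n + 1 - 1 - (n + 1 - 1 - (e + 1)) - 1 = e by omega, virasoroDerivation,
          MvPolynomial.mkDerivation_X, smul_smul, Nat.descFactorial_succ]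
        rcases lt_or_ge e (j + 1) with h | h
        · rw [show e - j = 0 by omega]; simp
        · rw [show e - j + (n + 1 - 1 - (e + 1)) - 1 = n - (j + 2) by omega]
          congr 1
          push_cast
          ring
      rw [Finset.sum_congr rfl key, ← Finset.sum_smul, ← Finset.mul_sum]
      have h1 : PowerSeries.coeff (n + 1 - 1 - (n + 1 - 1 - 0)) (PowerSeries.mk fun n =>
            if n = 0 then 0 else
              ((-1) ^ j * ((n - 1).descFactorial j : ℝ)) •
                (MvPolynomial.X (n - 1 - j) : MvPolynomial ℕ ℝ)) = 0 := by
        rw [PowerSeries.coeff_mk, if_pos (by omega)]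
      rw [h1, map_zero, add_zero, smul_smul, Nat.add_sub_cancel,
        ← add_two_mul_sum_range_descFactorial]
      congr 1
      push_cast
      ring
  · rw [coeff_C_of_ne_zero h, coeff_C_of_ne_zero h, map_zero, smul_zero]

theorem virasoroField_X : virasoroField PowerSeries.X = 0 := by
  ext1 n
  rw [coeff_virasoroField, map_zero]
  refine Finset.sum_eq_zero fun i _ => ?_
  rw [PowerSeries.coeff_X]
  split_ifs
  · exact Derivation.map_one_eq_zero _
  · exact map_zero _

theorem stressDerivation_invX : stressDerivation invX = 0 := by
  rw [stressDerivation_apply, invX, mapDerivation_C, virasoroField_X, timesField_apply]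
  ext1 α
  simp [coeff_timesSum]

theorem mapDerivation_timesSum {A : Type*} [CommRing A] [Algebra ℝ A] (D : RealDerivation A)
    (F : ℕ → MvPowerSeries ℕ A) :
    mapDerivation D (timesSum F) = timesSum fun k => mapDerivation D (F k) := by
  ext1 α
  rw [coeff_mapDerivation, coeff_timesSum, coeff_timesSum, map_sum]
  rfl

/-- V' does not involve the power sums, so only `timesField` acts, and the same sum of falling
factorials appears. -/
theorem stressDerivation_potential (j : ℕ) :
    ((j : ℝ) + 2) • stressDerivation ((deriv _)^[j] (potential (MvPolynomial ℕ ℝ))) =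
      (deriv _)^[j + 2] (potential _) := by
  rw [iterate_deriv_potential, iterate_deriv_potential, Derivation.leibniz, Derivation.leibniz_pow,
    stressDerivation_invX, smul_zero, smul_zero, smul_zero, add_zero, stressDerivation_apply,
    mapDerivation_timesSum]
  simp only [Derivation.map_smul, Derivation.map_one_eq_zero, smul_zero]
  have h0 : (timesSum fun _ => 0 : TimesField (MvPolynomial ℕ ℝ)) = 0 := by
    ext1 α
    simp [coeff_timesSum]
  rw [h0, zero_add, timesField_apply, smul_eq_mul, ← mul_smul_comm, ← timesSum_smul]
  have h1 : (invX : TimesField (MvPolynomial ℕ ℝ)) ^ (j + 2 + 1) =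
    invX ^ (j + 1) * (invX * invX) := by ring
  rw [h1, mul_assoc, mul_timesSum (invX * invX)]
  refine congrArg (fun x => invX ^ (j + 1) * timesSum x) ?_
  funext k
  simp only [pderiv_timesSum, pderiv_smul, pderiv_one, smul_zero, h0, zero_add, mul_smul_comm,
    mul_one, smul_smul]
  rw [← Finset.sum_smul, smul_smul]
  congr 1
  cases k with
  | zero => simp
  | succ k =>
    rw [Nat.add_sub_cancel, Nat.succ_descFactorial_succ, ← add_two_mul_sum_range_descFactorial]
    push_cast
    ring

end TimesField

/-- The recursion in `s` satisfied by the differential polynomials `(D + K)^s 1`, when the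
derivation `E` satisfies `E (D^j K) = D^(j+2) K / (j+2)`. -/
theorem bell_recursion {A : Type*} [CommRing A] [Algebra ℝ A] (D E : RealDerivation A)
    (K J V : A) (hK : ∀ j : ℕ, ((j : ℝ) + 2) • E (D^[j] K) = D^[j + 2] K)
    (hK2 : K * K + V * K = J * J + V * J) (s : ℕ) :
    bell D K (s + 2) = (2 : ℝ) • D (bell D K (s + 1)) - D (D (bell D K s)) + V * D (bell D K s) -
      V * bell D K (s + 1) - ((s : ℝ) + 1)⁻¹ • D (bell D K (s + 1)) +
      (J * (J * bell D K s) + V * (J * bell D K s) + E (bell D K s)) := by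
  have h1 := smul_derivation_bell D E K hK s
  -- E is used to remove DK · P_s, the one term that is not expressible through D, V', T and the
  -- polynomials P_s = (D + K)^s 1 themselves.
  have h2 : E (bell D K s) =
      ((s : ℝ) + 1)⁻¹ • D (bell D K (s + 1)) - D K * bell D K s := by
    have h3 := congrArg (fun x => ((s : ℝ) + 1)⁻¹ • x) h1
    simp only [smul_sub, smul_smul] at h3
    rw [inv_mul_cancel₀ (by positivity), one_smul, one_smul] at h3
    exact h3
  have e1 := bell_succ D K (s + 1)
  have e2 := bell_succ D K s
  have e3 : D (bell D K (s + 1)) = D (D (bell D K s)) + (K * D (bell D K s) +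
        bell D K s * D K) := by
    rw [e2, map_add, Derivation.leibniz, smul_eq_mul, smul_eq_mul]
  rw [h2, e1, two_smul]
  generalize ((s : ℝ) + 1)⁻¹ • D (bell D K (s + 1)) = Y
  rw [e3, e2]
  linear_combination bell D K s * hK2

/-! ### Degree bounds and families of reducible operators -/

namespace TimeOp

open MvPowerSeries TimesField
open Finset.HasAntidiagonal (antidiagonal mem_antidiagonal)
open Finsupp (single)

theorem DegreeLE.mono {d e : ℕ} (h : d ≤ e) {A : TimeOp} (hA : DegreeLE d A) : DegreeLE e A :=
  fun α hα => ⟨(hA α hα).1.trans h, (hA α hα).2.trans h⟩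

theorem degreeLE_zero (d : ℕ) : DegreeLE d 0 := fun α hα => absurd (coeff_zero α) hα

theorem DegreeLE.add {d : ℕ} {A B : TimeOp} (hA : DegreeLE d A) (hB : DegreeLE d B) :
    DegreeLE d (A + B) := by
  intro α hα
  rw [map_add] at hα ⊢
  by_cases h1 : coeff α A = 0
  · rw [h1, zero_add] at hα ⊢
    exact hB α hα
  · refine ⟨(hA α h1).1, (MvPolynomial.totalDegree_add _ _).trans (max_le (hA α h1).2 ?_)⟩
    by_cases h2 : coeff α B = 0
    · rw [h2, MvPolynomial.totalDegree_zero]; exact Nat.zero_le _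
    · exact (hB α h2).2

theorem DegreeLE.smul {d : ℕ} (c : ℝ) {A : TimeOp} (hA : DegreeLE d A) : DegreeLE d (c • A) := by
  intro α hα
  rw [coeff_real_smul] at hα ⊢
  have h := hA α (fun h => hα (by rw [h, smul_zero]))
  exact ⟨h.1, (MvPolynomial.totalDegree_smul_le _ _).trans h.2⟩

theorem DegreeLE.sum {ι : Type*} {d : ℕ} (s : Finset ι) {A : ι → TimeOp}
    (hA : ∀ i ∈ s, DegreeLE d (A i)) : DegreeLE d (∑ i ∈ s, A i) := by
  classical
  induction s using Finset.induction_on with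
  | empty => exact degreeLE_zero d
  | insert i s hi ih =>
    rw [Finset.sum_insert hi]
    exact (hA i (Finset.mem_insert_self _ _)).add
      (ih fun j hj => hA j (Finset.mem_insert_of_mem hj))

theorem totalDegree_sum_le {ι : Type*} (s : Finset ι) (f : ι → MvPolynomial ℕ ℝ) (d : ℕ)
    (h : ∀ i ∈ s, (f i).totalDegree ≤ d) : (∑ i ∈ s, f i).totalDegree ≤ d :=
  MvPolynomial.totalDegree_finsetSum_le h

theorem DegreeLE.timesSum {d : ℕ} {A : ℕ → TimeOp} (hA : ∀ k, DegreeLE d (A k)) :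
    DegreeLE (d + 1) (MvPowerSeries.timesSum A) := by
  intro α hα
  rw [coeff_timesSum] at hα ⊢
  refine ⟨?_, totalDegree_sum_le _ _ _ fun k _ => ?_⟩
  · obtain ⟨k, hk, hne⟩ := Finset.exists_ne_zero_of_sum_ne_zero hα
    have hle : single k 1 ≤ α :=
      Finsupp.single_le_iff.2 (Nat.one_le_iff_ne_zero.2 (Finsupp.mem_support_iff.1 hk))
    have h := (hA k _ hne).1
    rw [← tsub_add_cancel_of_le hle, map_add, Finsupp.degree_single]
    omega
  · by_cases h : coeff (α - single k 1) (A k) = 0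
    · rw [h, MvPolynomial.totalDegree_zero]; exact Nat.zero_le _
    · exact (hA k _ h).2.trans (Nat.le_succ d)

theorem DegreeLE.diffComp {d : ℕ} {A : TimeOp} (hA : DegreeLE d A) (b : ℕ) :
    DegreeLE (d + 1) (TimeOp.diffComp b A) := by
  intro α hα
  rw [coeff_diffComp] at hα ⊢
  by_cases h1 : coeff α A = 0
  · rw [h1, zero_mul, zero_add] at hα ⊢
    have h2 : coeff (α + single b 1) A ≠ 0 := fun h => hα (by rw [h, smul_zero])
    have h := hA _ h2
    rw [map_add, Finsupp.degree_single] at h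
    exact ⟨by omega, (MvPolynomial.totalDegree_smul_le _ _).trans (by omega)⟩
  · have h := hA _ h1
    refine ⟨by omega, (MvPolynomial.totalDegree_add _ _).trans (max_le ?_ ?_)⟩
    · refine (MvPolynomial.totalDegree_mul _ _).trans ?_
      rw [MvPolynomial.totalDegree_X]
      omega
    · by_cases h2 : coeff (α + single b 1) A = 0
      · rw [h2, smul_zero, MvPolynomial.totalDegree_zero]; exact Nat.zero_le _
      · exact (MvPolynomial.totalDegree_smul_le _ _).trans ((hA _ h2).2.trans (Nat.le_succ d))

/-- A family of differential operators in the times that are reducible to the Virasoro constraint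
operators, with degrees and orders of the left factors that are bounded uniformly in the family. -/
def IsReducibleFamily {ι : Type*} (A : ι → TimeOp) : Prop :=
  ∃ (d : ℕ) (O : ι → ℕ → TimeOp), (∀ i m, DegreeLE d (O i m)) ∧
    (∀ i α, ∃ B, ∀ m, B ≤ m → coeff α (O i m) = 0) ∧
    ∀ i (F : MvPowerSeries ℕ ℝ) α, ∃ B₀, ∀ B, B₀ ≤ B → coeff α ((A i).act F) =
      ∑ m ∈ Finset.range B, coeff α ((O i m).act ((virasoro ((m : ℤ) - 1)).act F))

theorem exists_forall_finset {κ : Type*} (s : Finset κ) (P : κ → ℕ → Prop)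
    (h : ∀ k ∈ s, ∃ B₀, ∀ B, B₀ ≤ B → P k B) : ∃ B₀, ∀ B, B₀ ≤ B → ∀ k ∈ s, P k B := by
  have h' : ∀ k ∈ s, ∀ᶠ B in Filter.atTop, P k B :=
    fun k hk => Filter.eventually_atTop.2 (h k hk)
  exact Filter.eventually_atTop.1 ((Filter.eventually_all_finset s).2 h')

namespace IsReducibleFamily

variable {ι κ : Type*}

theorem zero : IsReducibleFamily (fun _ : ι => (0 : TimeOp)) := by
  refine ⟨0, fun _ _ => 0, fun _ _ => degreeLE_zero 0, fun _ α => ⟨0, fun _ _ => coeff_zero α⟩,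
    fun _ F α => ⟨0, fun B _ => ?_⟩⟩
  simp only [act_zero_left, coeff_zero, Finset.sum_const_zero]

theorem add {A A' : ι → TimeOp} (hA : IsReducibleFamily A) (hA' : IsReducibleFamily A') :
    IsReducibleFamily fun i => A i + A' i := by
  obtain ⟨d, O, h1, h2, h3⟩ := hA
  obtain ⟨d', O', h1', h2', h3'⟩ := hA'
  refine ⟨max d d', fun i m => O i m + O' i m, fun i m =>
    ((h1 i m).mono (le_max_left _ _)).add ((h1' i m).mono (le_max_right _ _)), ?_, ?_⟩
  · intro i α
    obtain ⟨B, hB⟩ := h2 i α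
    obtain ⟨B', hB'⟩ := h2' i α
    refine ⟨max B B', fun m hm => ?_⟩
    rw [map_add, hB m ((le_max_left _ _).trans hm), hB' m ((le_max_right _ _).trans hm), add_zero]
  · intro i F α
    obtain ⟨B, hB⟩ := h3 i F α
    obtain ⟨B', hB'⟩ := h3' i F α
    refine ⟨max B B', fun m hm => ?_⟩
    simp only [act_add_left, map_add, Finset.sum_add_distrib]
    rw [hB m ((le_max_left _ _).trans hm), hB' m ((le_max_right _ _).trans hm)]

theorem smul (c : ι → ℝ) {A : ι → TimeOp} (hA : IsReducibleFamily A) :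
    IsReducibleFamily fun i => c i • A i := by
  obtain ⟨d, O, h1, h2, h3⟩ := hA
  refine ⟨d, fun i m => c i • O i m, fun i m => (h1 i m).smul _, ?_, ?_⟩
  · intro i α
    obtain ⟨B, hB⟩ := h2 i α
    exact ⟨B, fun m hm => by rw [coeff_real_smul, hB m hm, smul_zero]⟩
  · intro i F α
    obtain ⟨B, hB⟩ := h3 i F α
    refine ⟨B, fun m hm => ?_⟩
    simp only [act_smul_left, coeff_real_smul]
    rw [hB m hm, Finset.smul_sum]

theorem comp {A : ι → TimeOp} (hA : IsReducibleFamily A) (g : κ → ι) :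
    IsReducibleFamily fun k => A (g k) := by
  obtain ⟨d, O, h1, h2, h3⟩ := hA
  exact ⟨d, fun k => O (g k), fun k => h1 (g k), fun k => h2 (g k), fun k => h3 (g k)⟩

theorem sum {A : ι × κ → TimeOp} (hA : IsReducibleFamily A) (s : ι → Finset κ) :
    IsReducibleFamily fun i => ∑ k ∈ s i, A (i, k) := by
  obtain ⟨d, O, h1, h2, h3⟩ := hA
  refine ⟨d, fun i m => ∑ k ∈ s i, O (i, k) m, fun i m => .sum _ fun k _ => h1 (i, k) m, ?_, ?_⟩
  · intro i α
    obtain ⟨B, hB⟩ := exists_forall_finset (s i) (fun k m => coeff α (O (i, k) m) = 0)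
      fun k _ => h2 (i, k) α
    exact ⟨B, fun m hm => by rw [map_sum]; exact Finset.sum_eq_zero (hB m hm)⟩
  · intro i F α
    obtain ⟨B, hB⟩ := exists_forall_finset (s i) _ fun k _ => h3 (i, k) F α
    refine ⟨B, fun m hm => ?_⟩
    simp only [act_sum_left, map_sum]
    rw [Finset.sum_comm]
    exact Finset.sum_congr rfl (hB m hm)

/-- The sum over k is infinite, but a monomial t^α involves only the k in its support, so local
finiteness survives. The uniform degree bound of a family is what keeps the degree of the sum
bounded. -/
theorem timesSum {A : ι × ℕ → TimeOp} (hA : IsReducibleFamily A) :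
    IsReducibleFamily fun i => (MvPowerSeries.timesSum fun k => A (i, k) : TimeOp) := by
  obtain ⟨d, O, h1, h2, h3⟩ := hA
  refine ⟨d + 1, fun i m => MvPowerSeries.timesSum fun k => O (i, k) m,
    fun i m => .timesSum fun k => h1 (i, k) m, ?_, ?_⟩
  · intro i α
    obtain ⟨B, hB⟩ := exists_forall_finset α.support
      (fun k m => coeff (α - single k 1) (O (i, k) m) = 0) fun k _ => h2 (i, k) _
    exact ⟨B, fun m hm => by rw [coeff_timesSum]; exact Finset.sum_eq_zero (hB m hm)⟩
  · intro i F α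
    obtain ⟨B, hB⟩ := exists_forall_finset α.support _
      fun k _ => h3 (i, k) F (α - single k 1)
    refine ⟨B, fun m hm => ?_⟩
    simp only [act_timesSum, coeff_timesSum]
    rw [Finset.sum_comm]
    exact Finset.sum_congr rfl (hB m hm)

theorem diffComp {A : ι → TimeOp} (hA : IsReducibleFamily A) :
    IsReducibleFamily fun i : ι × ℕ => TimeOp.diffComp i.2 (A i.1) := by
  obtain ⟨d, O, h1, h2, h3⟩ := hA
  refine ⟨d + 1, fun i m => TimeOp.diffComp i.2 (O i.1 m),
    fun i m => (h1 i.1 m).diffComp i.2, ?_, ?_⟩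
  · rintro ⟨i, b⟩ α
    obtain ⟨B, hB⟩ := h2 i α
    obtain ⟨B', hB'⟩ := h2 i (α + single b 1)
    refine ⟨max B B', fun m hm => ?_⟩
    rw [coeff_diffComp, hB m ((le_max_left _ _).trans hm), hB' m ((le_max_right _ _).trans hm),
      zero_mul, smul_zero, add_zero]
  · rintro ⟨i, b⟩ F α
    obtain ⟨B, hB⟩ := h3 i F (α + single b 1)
    refine ⟨B, fun m hm => ?_⟩
    simp only [act_diffComp, coeff_pderiv]
    rw [hB m hm, Finset.sum_mul]

theorem congr {A A' : ι → TimeOp} (hA : IsReducibleFamily A) (h : ∀ i, A' i = A i) :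
    IsReducibleFamily A' := by
  obtain rfl : A' = A := funext h
  exact hA

theorem isReducibleToVirasoro {A : ι → TimeOp} (hA : IsReducibleFamily A) (i : ι) :
    (A i).IsReducibleToVirasoro := by
  obtain ⟨d, O, h1, h2, h3⟩ := hA
  refine ⟨O i, ⟨d, h1 i⟩, fun α => ?_, fun F α => ?_⟩
  · obtain ⟨B, hB⟩ := h2 i α
    refine (Set.finite_Iio B).subset fun m hm => ?_
    by_contra h
    exact hm (hB m (not_lt.1 h))
  · obtain ⟨B, hB⟩ := h3 i F α
    -- The coefficient at t^α of a composite sees only the coefficients of O_m at the finitely many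
    -- β ≤ α, and these vanish for large m.
    obtain ⟨B', hB'⟩ := exists_forall_finset ((antidiagonal α).image Prod.fst)
      (fun β m => coeff β (O i m) = 0) fun β _ => h2 i β
    rw [hB (max B B') (le_max_left _ _)]
    symm
    apply finsum_eq_sum_of_support_subset
    intro m hm
    rw [Finset.coe_range, Set.mem_Iio]
    by_contra h
    refine hm ?_
    beta_reduce
    rw [coeff_act]
    refine Finset.sum_eq_zero fun x hx => ?_
    rw [hB' m ((le_max_right _ _).trans (not_lt.1 h)) x.1 (Finset.mem_image_of_mem _ hx),
      diffAct_zero_left, coeff_zero]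

end IsReducibleFamily

end TimeOp

/-! ### Bounded and reducible fields, and the induction on s -/

namespace TimesField

open MvPowerSeries TimeOp
open Finset.HasAntidiagonal (antidiagonal mem_antidiagonal)
open Finsupp (single)

/-- A field whose degree in the times and in the power sums is bounded. -/
def IsBounded (f : TimesField (MvPolynomial ℕ ℝ)) : Prop :=
  ∃ d : ℕ, ∀ α n, PowerSeries.coeff n (coeff α f) ≠ 0 →
    α.degree ≤ d ∧ (PowerSeries.coeff n (coeff α f)).totalDegree ≤ d

namespace IsBounded

variable {f g : TimesField (MvPolynomial ℕ ℝ)}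

theorem add (hf : IsBounded f) (hg : IsBounded g) : IsBounded (f + g) := by
  obtain ⟨d, hd⟩ := hf
  obtain ⟨e, he⟩ := hg
  refine ⟨max d e, fun α n h => ?_⟩
  rw [map_add, map_add] at h ⊢
  by_cases h1 : PowerSeries.coeff n (coeff α f) = 0
  · rw [h1, zero_add] at h ⊢
    exact ⟨(he α n h).1.trans (le_max_right _ _), (he α n h).2.trans (le_max_right _ _)⟩
  · refine ⟨(hd α n h1).1.trans (le_max_left _ _),
      (MvPolynomial.totalDegree_add _ _).trans (max_le_max (hd α n h1).2 ?_)⟩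
    by_cases h2 : PowerSeries.coeff n (coeff α g) = 0
    · rw [h2, MvPolynomial.totalDegree_zero]; exact Nat.zero_le _
    · exact (he α n h2).2

theorem mul (hf : IsBounded f) (hg : IsBounded g) : IsBounded (f * g) := by
  obtain ⟨d, hd⟩ := hf
  obtain ⟨e, he⟩ := hg
  refine ⟨d + e, fun α n h => ?_⟩
  rw [coeff_coeff_mul] at h ⊢
  refine ⟨?_, totalDegree_sum_le _ _ _ fun x _ => totalDegree_sum_le _ _ _ fun y _ => ?_⟩
  · obtain ⟨x, hx, h⟩ := Finset.exists_ne_zero_of_sum_ne_zero h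
    obtain ⟨y, hy, h⟩ := Finset.exists_ne_zero_of_sum_ne_zero h
    rw [← mem_antidiagonal.1 hx, map_add]
    exact add_le_add (hd _ _ (left_ne_zero_of_mul h)).1 (he _ _ (right_ne_zero_of_mul h)).1
  · by_cases h1 : PowerSeries.coeff y.1 (coeff x.1 f) = 0
    · rw [h1, zero_mul, MvPolynomial.totalDegree_zero]; exact Nat.zero_le _
    by_cases h2 : PowerSeries.coeff y.2 (coeff x.2 g) = 0
    · rw [h2, mul_zero, MvPolynomial.totalDegree_zero]; exact Nat.zero_le _
    exact (MvPolynomial.totalDegree_mul _ _).trans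
      (add_le_add (hd _ _ h1).2 (he _ _ h2).2)

theorem C {g : PowerSeries (MvPolynomial ℕ ℝ)} {d : ℕ}
    (h : ∀ n, (PowerSeries.coeff n g).totalDegree ≤ d) : IsBounded (MvPowerSeries.C g) := by
  classical
  refine ⟨d, fun α n h' => ?_⟩
  rw [coeff_C] at h' ⊢
  split_ifs at h' ⊢ with h0
  · subst h0
    exact ⟨by simp, h n⟩
  · exact absurd (map_zero _) h'

theorem one : IsBounded 1 := by
  rw [← map_one MvPowerSeries.C]
  refine C (d := 0) fun n => ?_
  rw [PowerSeries.coeff_one]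
  split_ifs <;> simp

theorem neg (hf : IsBounded f) : IsBounded (-f) := by
  obtain ⟨d, hd⟩ := hf
  refine ⟨d, fun α n h => ?_⟩
  rw [map_neg, map_neg] at h ⊢
  rw [MvPolynomial.totalDegree_neg]
  exact hd α n (neg_ne_zero.1 h)

theorem sub (hf : IsBounded f) (hg : IsBounded g) : IsBounded (f - g) := by
  rw [sub_eq_add_neg]; exact hf.add hg.neg

theorem invX : IsBounded TimesField.invX := by
  refine C (d := 0) fun n => ?_
  rw [PowerSeries.coeff_X]
  split_ifs <;> simp

theorem current : IsBounded (TimesField.current MvPolynomial.X) := by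
  refine invX.mul (C (d := 1) fun n => ?_)
  rw [powerSumSeries, PowerSeries.coeff_mk, MvPolynomial.totalDegree_X]

theorem potential : IsBounded (TimesField.potential (MvPolynomial ℕ ℝ)) := by
  refine invX.mul ⟨1, fun α n h => ?_⟩
  classical
  rw [coeff_timesSum, map_sum] at h ⊢
  have key : ∀ k ∈ α.support, ∀ β, β = α - single k 1 → PowerSeries.coeff n
      (coeff β (MvPowerSeries.C (k : PowerSeries (MvPolynomial ℕ ℝ)))) =
      if β = 0 ∧ n = 0 then (k : MvPolynomial ℕ ℝ) else 0 := by
    intro k _ β _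
    rw [coeff_C]
    split_ifs with h1 h2 h2
    · rw [h2.2]; simp
    · rw [← map_natCast (PowerSeries.C (R := MvPolynomial ℕ ℝ)), PowerSeries.coeff_C, if_neg]
      exact fun h => h2 ⟨h1, h⟩
    · exact absurd h2.1 h1
    · exact map_zero _
  constructor
  · obtain ⟨k, hk, h⟩ := Finset.exists_ne_zero_of_sum_ne_zero h
    rw [key k hk _ rfl] at h
    have h0 : α - single k 1 = 0 := by
      by_contra h0
      exact h (if_neg fun h => h0 h.1)
    have := tsub_eq_zero_iff_le.1 h0
    have := Finsupp.degree_mono this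
    rwa [Finsupp.degree_single] at this
  · refine totalDegree_sum_le _ _ _ fun k hk => ?_
    rw [key k hk _ rfl]
    split_ifs
    · rw [← map_natCast (MvPolynomial.C (R := ℝ) (σ := ℕ)), MvPolynomial.totalDegree_C]
      exact Nat.zero_le _
    · rw [MvPolynomial.totalDegree_zero]; exact Nat.zero_le _

theorem deriv (hf : IsBounded f) : IsBounded (TimesField.deriv (MvPolynomial ℕ ℝ) f) := by
  rw [deriv_apply]
  refine invX.mul ?_
  obtain ⟨d, hd⟩ := hf
  refine ⟨d, fun α n h => ?_⟩
  rw [coeff_coeff_euler] at h ⊢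
  have h' := hd α n (fun h' => h (by rw [h', smul_zero]))
  exact ⟨h'.1, (MvPolynomial.totalDegree_smul_le _ _).trans h'.2⟩

theorem bell {K : TimesField (MvPolynomial ℕ ℝ)} (hK : IsBounded K) (s : ℕ) :
    IsBounded (_root_.bell (TimesField.deriv _) K s) := by
  induction s with
  | zero => exact one
  | succ s ih => exact ih.deriv.add (hK.mul ih)

theorem exists_degreeLE (hf : IsBounded f) : ∃ d : ℕ, ∀ j, TimeOp.DegreeLE d (laurentCoeff j f) := by
  obtain ⟨d, hd⟩ := hf
  refine ⟨d, fun j α h => ?_⟩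
  rw [coeff_laurentCoeff] at h ⊢
  rcases lt_or_ge (j + weight α) 0 with h0 | h0
  · exact absurd (intCoeff_of_neg h0 _) h
  · obtain ⟨n, hn⟩ := Int.eq_ofNat_of_zero_le h0
    rw [hn, intCoeff_natCast] at h ⊢
    exact hd α n h

end IsBounded

/-- A field all of whose coefficients of negative powers of `x` are reducible to the Virasoro
operators. -/
def IsReducible (f : TimesField (MvPolynomial ℕ ℝ)) : Prop :=
  IsReducibleFamily fun m : ℕ => laurentCoeff ((m : ℤ) + 1) f

namespace IsReducible

variable {f g : TimesField (MvPolynomial ℕ ℝ)}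

theorem add (hf : IsReducible f) (hg : IsReducible g) : IsReducible (f + g) :=
  (IsReducibleFamily.add hf hg).congr fun m => map_add (laurentCoeff ((m : ℤ) + 1)) f g

theorem smul (c : ℝ) (hf : IsReducible f) : IsReducible (c • f) :=
  (IsReducibleFamily.smul (fun _ => c) hf).congr fun m => laurentCoeff_smul ((m : ℤ) + 1) c f

theorem neg (hf : IsReducible f) : IsReducible (-f) := by
  rw [← neg_one_smul ℝ f]; exact hf.smul _

theorem sub (hf : IsReducible f) (hg : IsReducible g) : IsReducible (f - g) := by
  rw [sub_eq_add_neg]; exact hf.add hg.neg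

theorem deriv (hf : IsReducible f) : IsReducible (TimesField.deriv (MvPolynomial ℕ ℝ) f) := by
  -- The truncated index at m = 0 is harmless, its factor being -m.
  refine ((IsReducibleFamily.comp hf (fun m : ℕ => m - 1)).smul
    (fun m : ℕ => -(m : ℝ))).congr fun m => ?_
  rw [laurentCoeff_deriv]
  cases m with
  | zero => simp
  | succ m =>
    rw [Nat.add_sub_cancel]
    push_cast
    congr 1
    · ring
    · congr 2; ring

/-- V' contains no negative power of x, so the negative coefficients of V'f are built from those of
f. -/
theorem potential_mul (hf : IsReducible f) :
    IsReducible (TimesField.potential (MvPolynomial ℕ ℝ) * f) := by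
  refine (IsReducibleFamily.timesSum ((IsReducibleFamily.comp hf
    (fun q : ℕ × ℕ => q.1 + q.2 - 1)).smul (fun q : ℕ × ℕ => (q.2 : ℝ)))).congr fun m => ?_
  rw [laurentCoeff_potential_mul]
  congr 1
  funext k
  rcases Nat.eq_zero_or_pos k with rfl | hk
  · simp
  · congr 3
    dsimp only
    push_cast [Nat.cast_sub (show 1 ≤ m + k by omega)]
    ring

/-- The part of the `x^(-j)`-coefficient of the product of a field with the energy-momentum tensor
in which the latter is regular. -/
noncomputable def _root_.TimesField.regularPart (f : TimesField (MvPolynomial ℕ ℝ)) (j : ℤ) : TimeOp :=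
  timesSum fun k => (k : ℝ) • ∑ b ∈ Finset.range (k - 1),
    TimeOp.diffComp b (laurentCoeff (j + k - 2 - b) f)

/-- The product of a field with the energy-momentum tensor. -/
noncomputable def _root_.TimesField.stressMul (f : TimesField (MvPolynomial ℕ ℝ)) : TimesField (MvPolynomial ℕ ℝ) :=
  current MvPolynomial.X * (current MvPolynomial.X * f) +
    potential _ * (current MvPolynomial.X * f) + stressDerivation f

theorem coeff_laurentCoeff_stressMul (j : ℤ) (α : ℕ →₀ ℕ) (B : ℕ) (hB : j + weight α ≤ B) :
    coeff α (laurentCoeff j (stressMul f) - regularPart f j) =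
      coeff α (∑ i ∈ Finset.range B, virasoroComp i (laurentCoeff (j - 1 - i) f)) := by
  rw [map_sub, map_sum, sub_eq_iff_eq_add']
  exact coeff_laurentCoeff_stress f j α B hB

/-- For b ≤ k - 2 the index j + k - 2 - b is at least j, so only negative coefficients of f occur.
They are multiplied by t_k ∂/∂t_b on the left, which keeps the Virasoro operators on the right. -/
theorem isReducibleFamily_regularPart (hf : IsReducible f) :
    IsReducibleFamily fun m : ℕ => regularPart f ((m : ℤ) + 1) := by
  have e1 : IsReducibleFamily fun i : ℕ × ℕ =>
      TimeOp.diffComp i.2 (laurentCoeff ((i.1 : ℤ) + 1) f) :=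
    IsReducibleFamily.diffComp (A := fun m : ℕ => laurentCoeff ((m : ℤ) + 1) f) hf
  have e2 : IsReducibleFamily fun q : (ℕ × ℕ) × ℕ => TimeOp.diffComp q.2
      (laurentCoeff (((q.1.1 + (q.1.2 - 2 - q.2) : ℕ) : ℤ) + 1) f) :=
    IsReducibleFamily.comp (A := fun i : ℕ × ℕ =>
      TimeOp.diffComp i.2 (laurentCoeff ((i.1 : ℤ) + 1) f)) e1
      fun q : (ℕ × ℕ) × ℕ => (q.1.1 + (q.1.2 - 2 - q.2), q.2)
  have e3 : IsReducibleFamily fun q : ℕ × ℕ => ∑ b ∈ Finset.range (q.2 - 1),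
      TimeOp.diffComp b (laurentCoeff (((q.1 + (q.2 - 2 - b) : ℕ) : ℤ) + 1) f) :=
    IsReducibleFamily.sum (A := fun q : (ℕ × ℕ) × ℕ => TimeOp.diffComp q.2
      (laurentCoeff (((q.1.1 + (q.1.2 - 2 - q.2) : ℕ) : ℤ) + 1) f)) e2
      fun q : ℕ × ℕ => Finset.range (q.2 - 1)
  refine (IsReducibleFamily.timesSum (e3.smul fun q : ℕ × ℕ => (q.2 : ℝ))).congr fun m => ?_
  refine congrArg (MvPowerSeries.timesSum (R := MvPolynomial ℕ ℝ)) (funext fun k => ?_)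
  refine congrArg (fun x : TimeOp => (k : ℝ) • x) (Finset.sum_congr rfl fun b hb => ?_)
  refine congrArg (fun x => TimeOp.diffComp b (laurentCoeff x f)) ?_
  have := Finset.mem_range.1 hb
  omega

/-- What remains is ∑_i f_(j-1-i) L_(i-1), reducible by its very form whatever f is. It is locally
finite because the powers of x accompanying a given t^α in f are bounded above. -/
theorem isReducibleFamily_sub_regularPart (hb : IsBounded f) : IsReducibleFamily fun m : ℕ =>
    laurentCoeff ((m : ℤ) + 1) (stressMul f) - regularPart f ((m : ℤ) + 1) := by
  obtain ⟨d, hd⟩ := hb.exists_degreeLE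
  refine ⟨d, fun m i => laurentCoeff ((m : ℤ) + 1 - 1 - i) f, fun m i => hd _, fun m α => ?_,
    fun m F α => ?_⟩
  · refine ⟨m + weight α + 1, fun i hi => ?_⟩
    have h : (m : ℤ) + 1 - 1 - i + weight α < 0 := by omega
    exact coeff_laurentCoeff_of_neg f h
  · obtain ⟨B₀, hB₀⟩ := exists_forall_finset ((antidiagonal α).image Prod.fst)
      (fun β B => (m : ℤ) + 1 + weight β ≤ B) fun β _ => ⟨m + 1 + weight β, fun B hB => by omega⟩
    refine ⟨B₀, fun B hB => ?_⟩
    have key : coeff α (TimeOp.act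
        (laurentCoeff ((m : ℤ) + 1) (stressMul f) - regularPart f ((m : ℤ) + 1)) F) =
        coeff α (TimeOp.act
          (∑ i ∈ Finset.range B, virasoroComp i (laurentCoeff ((m : ℤ) + 1 - 1 - i) f)) F) := by
      rw [coeff_act, coeff_act]
      refine Finset.sum_congr rfl fun x hx => ?_
      rw [coeff_laurentCoeff_stressMul _ _ _ (hB₀ B hB x.1 (Finset.mem_image_of_mem _ hx))]
    refine key.trans ?_
    rw [act_sum_left, map_sum]
    exact Finset.sum_congr rfl fun i _ => by rw [act_virasoroComp]

theorem stressMul (hf : IsReducible f) (hb : IsBounded f) : IsReducible (stressMul f) :=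
  (IsReducibleFamily.add (isReducibleFamily_regularPart hf)
    (isReducibleFamily_sub_regularPart hb)).congr fun _ => (add_sub_cancel _ _).symm

end IsReducible

/-- The sum of the two differential polynomials `(d/dx + K)^s 1` for the two solutions `K` of
`K² + V' K = J² + V' J`. -/
noncomputable def symmetrizedBell (s : ℕ) : TimesField (MvPolynomial ℕ ℝ) :=
  bell (deriv _) (-current MvPolynomial.X - potential _) s +
    bell (deriv _) (current MvPolynomial.X) s

theorem symmetrizedBell_recursion (s : ℕ) :
    symmetrizedBell (s + 2) = (2 : ℝ) • deriv _ (symmetrizedBell (s + 1)) -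
      deriv _ (deriv _ (symmetrizedBell s)) + potential _ * deriv _ (symmetrizedBell s) -
      potential _ * symmetrizedBell (s + 1) -
      ((s : ℝ) + 1)⁻¹ • deriv _ (symmetrizedBell (s + 1)) +
      stressMul (symmetrizedBell s) := by
  have h1 := bell_recursion (deriv (MvPolynomial ℕ ℝ)) stressDerivation
    (-current MvPolynomial.X - potential _) (current MvPolynomial.X) (potential _)
    (fun j => by
      rw [iterate_map_sub, iterate_map_sub, iterate_map_neg, iterate_map_neg, map_sub, map_neg,
        smul_sub, smul_neg, stressDerivation_current, stressDerivation_potential])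
    (by ring) s
  have h2 := bell_recursion (deriv (MvPolynomial ℕ ℝ)) stressDerivation
    (current MvPolynomial.X) (current MvPolynomial.X) (potential _)
    stressDerivation_current rfl s
  simp only [stressMul, symmetrizedBell, map_add, smul_add, mul_add]
  rw [h1, h2]
  abel

theorem isReducible_symmetrizedBell (s : ℕ) : IsReducible (symmetrizedBell s) := by
  have hb : ∀ s, IsBounded (symmetrizedBell s) := fun s =>
    ((IsBounded.current.neg.sub .potential).bell s).add (IsBounded.current.bell s)
  have h0 : IsReducible (symmetrizedBell 0) := by
    refine IsReducibleFamily.zero.congr fun m => ?_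
    rw [symmetrizedBell, bell_zero, bell_zero, ← map_one C, ← map_add C]
    ext1 α
    classical
    rw [coeff_laurentCoeff, coeff_C, show (m : ℤ) + 1 + weight α = ((m + 1 + weight α : ℕ) : ℤ) by
      push_cast; ring, intCoeff_natCast]
    split_ifs
    · rw [map_add, PowerSeries.coeff_one, if_neg (by omega), add_zero, coeff_zero]
    · rw [map_zero, coeff_zero]
  have key : ∀ s, IsReducible (symmetrizedBell s) ∧ IsReducible (symmetrizedBell (s + 1)) := by
    intro s
    induction s with
    | zero =>
      refine ⟨h0, ?_⟩
      -- The two currents cancel, (-J - V') + J = -V', and P_0 = 2. The sum over both K is taken for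
      -- this start: J itself has negative powers of x.
      have : symmetrizedBell (0 + 1) = (-(2 : ℝ)⁻¹) • (potential _ * symmetrizedBell 0) := by
        rw [symmetrizedBell, symmetrizedBell, bell_succ, bell_succ, bell_zero, bell_zero,
          Derivation.map_one_eq_zero, mul_one, mul_one, mul_add, mul_one, ← two_smul ℝ, smul_smul]
        norm_num
        abel
      rw [this]
      exact h0.potential_mul.smul _
    | succ s ih =>
      refine ⟨ih.2, ?_⟩
      rw [symmetrizedBell_recursion]
      exact (((((ih.2.deriv.smul 2).sub ih.1.deriv.deriv).add ih.1.deriv.potential_mul).sub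
        ih.2.potential_mul).sub (ih.2.deriv.smul _)).add (ih.1.stressMul (hb s))
  exact (key s).1

end TimesField

/-! ### The exponential of ∑ t_k p_k -/

/-- The exponential `exp(∑_k t_k p_k)` as a formal power series in the times. -/
noncomputable def expSeries {R : Type*} [CommRing R] [Algebra ℝ R] (p : ℕ → R) :
    MvPowerSeries ℕ R :=
  fun α => α.prod fun k m => ((m.factorial : ℝ)⁻¹) • p k ^ m

section ExpSeries

open MvPowerSeries
open Finset.HasAntidiagonal (antidiagonal mem_antidiagonal)
open Finsupp (single)

variable {R : Type*} [CommRing R] [Algebra ℝ R]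

theorem coeff_expSeries (p : ℕ → R) (α : ℕ →₀ ℕ) :
    coeff α (expSeries p) = α.prod fun k m => ((m.factorial : ℝ)⁻¹) • p k ^ m := rfl

theorem pderiv_expSeries (p : ℕ → R) (b : ℕ) :
    pderiv R b (expSeries p) = C (p b) * expSeries p := by
  classical
  ext α
  have h0 : ∀ k ∈ insert b α.support, (((0 : ℕ).factorial : ℝ)⁻¹) • p k ^ 0 = 1 := by simp
  rw [coeff_pderiv, coeff_C_mul, coeff_expSeries, coeff_expSeries,
    Finsupp.prod_of_support_subset (α + single b 1) (s := insert b α.support) _ _ h0,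
    Finsupp.prod_of_support_subset α (s := insert b α.support) (Finset.subset_insert _ _) _ h0,
    ← Finset.insert_erase (Finset.mem_insert_self b α.support),
    Finset.prod_insert (Finset.notMem_erase _ _), Finset.prod_insert (Finset.notMem_erase _ _)]
  · have h1 : ∀ k ∈ (insert b α.support).erase b,
        (((((α + single b 1 : ℕ →₀ ℕ) k).factorial : ℕ) : ℝ)⁻¹) • p k ^ ((α + single b 1 : ℕ →₀ ℕ) k) =
          ((((α k).factorial : ℕ) : ℝ)⁻¹) • p k ^ (α k) := by
      intro k hk
      have : (α + single b 1 : ℕ →₀ ℕ) k = α k := by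
        rw [Finsupp.add_apply, Finsupp.single_eq_of_ne (Finset.ne_of_mem_erase hk), add_zero]
      rw [this]
    rw [Finset.prod_congr rfl h1]
    have h2 : (α + single b 1 : ℕ →₀ ℕ) b = α b + 1 := by simp
    have h3 : ((((α b + 1).factorial : ℕ) : ℝ)⁻¹ • p b ^ (α b + 1)) * ((α b : R) + 1) =
        p b * ((((α b).factorial : ℕ) : ℝ)⁻¹ • p b ^ (α b)) := by
      rw [inv_factorial_succ_smul, pow_succ', mul_smul_comm]
    rw [h2, mul_right_comm, h3, mul_assoc]
  · intro k hk
    rw [Finsupp.mem_support_iff, Finsupp.add_apply] at hk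
    rw [Finset.mem_insert, Finsupp.mem_support_iff]
    by_contra h
    push Not at h
    rw [h.2, Finsupp.single_eq_of_ne h.1] at hk
    exact hk rfl

theorem pderiv_C_mul {R : Type*} [CommRing R] (c : R) (b : ℕ) (F : MvPowerSeries ℕ R) :
    pderiv R b (C c * F) = C c * pderiv R b F := by
  rw [Derivation.leibniz, pderiv_C, smul_zero, add_zero, smul_eq_mul]

theorem pderiv_mapDerivation (D : RealDerivation R) (b : ℕ) (F : MvPowerSeries ℕ R) :
    pderiv R b (mapDerivation D F) = mapDerivation D (pderiv R b F) := by
  ext α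
  rw [coeff_pderiv, coeff_mapDerivation, coeff_mapDerivation, coeff_pderiv, D.leibniz]
  have : D ((α b : R) + 1) = 0 := by
    rw [map_add, D.map_natCast, D.map_one_eq_zero, add_zero]
  rw [this, smul_zero, zero_add, smul_eq_mul, mul_comm]

/-- The equations express a coefficient of degree d + 1 through one of degree d, up to an invertible
integer. -/
theorem eq_zero_of_pderiv_eq (p : ℕ → R) (F : MvPowerSeries ℕ R) (h0 : coeff 0 F = 0)
    (hF : ∀ b, pderiv R b F = C (p b) * F) : F = 0 := by
  have key : ∀ d : ℕ, ∀ α : ℕ →₀ ℕ, α.degree = d → coeff α F = 0 := by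
    intro d
    induction d with
    | zero =>
      intro α hα
      rw [Finsupp.degree_eq_zero_iff] at hα
      rw [hα, h0]
    | succ d ih =>
      intro α hα
      obtain ⟨b, hb⟩ : ∃ b, α b ≠ 0 := by
        by_contra! h
        rw [Finsupp.ext (g := 0) h, map_zero] at hα
        omega
      have hle : single b 1 ≤ α := Finsupp.single_le_iff.2 (Nat.one_le_iff_ne_zero.2 hb)
      have h1 := congrArg (coeff (α - single b 1)) (hF b)
      have h2 : coeff (α - single b 1) F = 0 := by
        apply ih
        rw [← tsub_add_cancel_of_le hle, map_add, Finsupp.degree_single] at hα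
        omega
      rw [coeff_pderiv, coeff_C_mul, tsub_add_cancel_of_le hle, h2, mul_zero] at h1
      exact (isUnit_succ _).mul_left_eq_zero.1 h1
  ext α
  exact key _ α rfl

/-- The logarithmic derivative of `exp(∑_k t_k p_k)` is `∑_k t_k D p_k`. -/
theorem mapDerivation_expSeries (D : RealDerivation R) (p : ℕ → R) :
    mapDerivation D (expSeries p) = timesSum (fun k => C (D (p k))) * expSeries p := by
  rw [← sub_eq_zero]
  refine eq_zero_of_pderiv_eq p _ ?_ fun b => ?_
  · rw [map_sub, coeff_mapDerivation, coeff_expSeries, Finsupp.prod_zero_index,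
      D.map_one_eq_zero, timesSum_mul, coeff_timesSum]
    simp
  · rw [map_sub, pderiv_mapDerivation, pderiv_expSeries, Derivation.leibniz, Derivation.leibniz,
      pderiv_expSeries, pderiv_timesSum, mapDerivation_C]
    have h0 : (timesSum fun k => pderiv R b (C (D (p k))) : MvPowerSeries ℕ R) = 0 := by
      ext α
      simp [coeff_timesSum, pderiv_C]
    rw [h0, zero_add]
    simp only [smul_eq_mul]
    ring

theorem map_expSeries {S : Type*} [CommRing S] [Algebra ℝ S] (φ : R →ₐ[ℝ] S) (p : ℕ → R) :
    MvPowerSeries.map (φ : R →+* S) (expSeries p) = expSeries fun k => φ (p k) := by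
  ext α
  rw [coeff_map, coeff_expSeries, coeff_expSeries, Finsupp.prod, Finsupp.prod, map_prod]
  refine Finset.prod_congr rfl fun k _ => ?_
  rw [RingHom.coe_coe, map_smul, map_pow]

namespace TimeOp

/-- F is a joint eigenvector of all the ∂/∂t_b, so a polynomial in them acts by its value at the
eigenvalues. -/
theorem diffAct_eq_of_pderiv (f : MvPolynomial ℕ ℝ) (p : ℕ → R) (F : MvPowerSeries ℕ R)
    (hF : ∀ b, pderiv R b F = C (p b) * F) :
    diffAct f F = C (MvPolynomial.aeval p f) * F := by
  induction f using MvPolynomial.induction_on generalizing F with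
  | C c =>
    rw [diffAct_C, MvPolynomial.aeval_C]
    ext α
    rw [coeff_C_mul, ← Algebra.smul_def]
    rfl
  | add f g hf hg => rw [diffAct_add_left, hf F hF, hg F hF, map_add, map_add, add_mul]
  | mul_X f b hf =>
    rw [diffAct_mul_X, hF b, hf, map_mul, MvPolynomial.aeval_X, map_mul, mul_assoc]
    intro c
    rw [pderiv_C_mul, hF c, mul_left_comm]

theorem act_eq_of_pderiv (A : TimeOp) (p : ℕ → R) (F : MvPowerSeries ℕ R)
    (hF : ∀ b, pderiv R b F = C (p b) * F) :
    A.act F = MvPowerSeries.map (MvPolynomial.aeval p : MvPolynomial ℕ ℝ →ₐ[ℝ] R).toRingHom A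
      * F := by
  ext α
  rw [coeff_act, coeff_mul]
  refine Finset.sum_congr rfl fun x _ => ?_
  rw [diffAct_eq_of_pderiv _ p F hF, coeff_C_mul, coeff_map]
  rfl

end TimeOp

end ExpSeries

/-! ### Operators in the times acting on the integrand -/

namespace MatrixModel

open MvPowerSeries TimeOp

/-- The power sums `p_k(z) = ∑_i z_i^k`. -/
noncomputable def powerSum {N : ℕ} (z : Fin N → ℝ) (k : ℕ) : ℝ := ∑ i, z i ^ k

theorem coeff_integrand (N : ℕ) (α : ℕ →₀ ℕ) (z : Fin N → ℝ) :
    coeff α (integrand N) z = vandermonde N z ^ 2 * coeff α (expSeries (powerSum z)) := by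
  rw [coeff_expSeries]
  change vandermonde N z ^ 2 * _ = _
  congr 1
  refine Finset.prod_congr rfl fun k _ => ?_
  beta_reduce
  rw [smul_eq_mul, powerSum, div_eq_inv_mul]

theorem integrand_eq (N : ℕ) : integrand N =
    C (fun z => vandermonde N z ^ 2) * expSeries (fun k z => powerSum z k) := by
  ext α z
  rw [coeff_integrand, coeff_C_mul, Pi.mul_apply]
  congr 1
  rw [coeff_expSeries, coeff_expSeries, Finsupp.prod, Finsupp.prod, Finset.prod_apply]
  rfl

theorem coeff_act_integrand (A : TimeOp) (N : ℕ) (z : Fin N → ℝ) (α : ℕ →₀ ℕ) :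
    coeff α (A.act (integrand N)) z = vandermonde N z ^ 2 *
      coeff α (MvPowerSeries.map (MvPolynomial.eval (powerSum z)) A * expSeries (powerSum z)) := by
  rw [act_eq_of_pderiv A (fun k z => powerSum z k), coeff_mul, coeff_mul, Finset.sum_apply,
    Finset.mul_sum]
  · refine Finset.sum_congr rfl fun x _ => ?_
    rw [Pi.mul_apply, coeff_integrand, coeff_map, coeff_map]
    have : (MvPolynomial.aeval fun k (z : Fin N → ℝ) => powerSum z k) (coeff x.1 A) z =
        MvPolynomial.eval (powerSum z) (coeff x.1 A) := by
      have h := MvPolynomial.map_aeval (fun k (z : Fin N → ℝ) => powerSum z k)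
        (Pi.evalRingHom (fun _ => ℝ) z) (coeff x.1 A)
      exact h
    change (MvPolynomial.aeval fun k (z : Fin N → ℝ) => powerSum z k) (coeff x.1 A) z * _ = _
    rw [this]
    ring
  · intro b
    rw [integrand_eq, pderiv_C_mul, pderiv_expSeries, mul_left_comm]

end MatrixModel

/-! ### Binomial identities for iterated operators -/

section Binomial

open Finset.HasAntidiagonal (antidiagonal)

variable {M : Type*} [AddCommGroup M]

theorem iterate_eq_sum_choose (T : M →+ M) (c : ℕ → ℕ → M)
    (h : ∀ j l, T (c j l) = c (j + 1) l + c j (l + 1)) (s : ℕ) :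
    T^[s] (c 0 0) = ∑ x ∈ antidiagonal s, s.choose x.1 • c x.1 x.2 := by
  induction s with
  | zero => simp
  | succ s ih =>
    rw [Function.iterate_succ_apply', ih, Finset.sum_antidiagonal_choose_succ_nsmul, map_sum,
      ← Finset.sum_add_distrib]
    refine Finset.sum_congr rfl fun x hx => ?_
    rw [map_nsmul, h, nsmul_add, add_comm]
    congr 2
    exact Nat.choose_symm_of_eq_add (Finset.HasAntidiagonal.mem_antidiagonal.1 hx).symm

/-- An adjoint Leibniz rule: at each step Pascal's rule pairs an application of A with an index
shift, and together they amount to T on the first argument. It serves both the field identity below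
and the total derivatives in z_i. -/
theorem sum_choose_iterate_eq {X : Type*} (A : M →+ M) (T : X → X) (b : X → ℕ → M)
    (h : ∀ f j, A (b f j) + b f (j + 1) = b (T f) j) (s : ℕ) (f : X) :
    ∑ x ∈ antidiagonal s, s.choose x.1 • A^[x.2] (b f x.1) = b (T^[s] f) 0 := by
  induction s generalizing f with
  | zero => simp
  | succ s ih =>
    rw [Function.iterate_succ_apply, ← ih,
      Finset.sum_antidiagonal_choose_succ_nsmul (fun j l => A^[l] (b f j)),
      ← Finset.sum_add_distrib]
    refine Finset.sum_congr rfl fun x hx => ?_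
    rw [← h, iterate_map_add, nsmul_add, ← Function.iterate_succ_apply]
    congr 2
    exact (Nat.choose_symm_of_eq_add (Finset.HasAntidiagonal.mem_antidiagonal.1 hx).symm).symm

variable {A : Type*} [CommRing A] [Algebra ℝ A]

/-- For P_j = (D + J)^j 1 one has (V - D)(f P_j) + f P_(j+1) = (Vf + Jf - Df) P_j, so the sum
collapses to (V + J - D)^s 1. -/
theorem sum_choose_iterate_bell (D : RealDerivation A) (J V : A) (s : ℕ) :
    ∑ x ∈ antidiagonal s, s.choose x.1 •
        (AddMonoidHom.mulLeft V - (D : A →+ A))^[x.2] (bell D J x.1) =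
      (-1) ^ s * bell D (-J - V) s := by
  have h := sum_choose_iterate_eq (AddMonoidHom.mulLeft V - (D : A →+ A))
    (fun f => V * f + J * f - D f) (fun f j => f * bell D J j) (fun f j => by
      change V * (f * bell D J j) - D (f * bell D J j) + f * bell D J (j + 1) = _
      rw [Derivation.leibniz, bell_succ, smul_eq_mul, smul_eq_mul]
      ring) s 1
  simp only [one_mul] at h
  rw [h, bell_zero, mul_one]
  clear h
  induction s with
  | zero => simp [bell_zero]
  | succ s ih =>
    rw [Function.iterate_succ_apply', ih, bell_succ, Derivation.leibniz, Derivation.leibniz_pow,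
      map_neg, Derivation.map_one_eq_zero]
    simp only [smul_eq_mul, neg_zero, mul_zero, smul_zero, add_zero]
    ring

theorem bell_succ_eq_iterate (D : RealDerivation A) (K : A) (s : ℕ) :
    bell D K (s + 1) = (D.toLinearMap + LinearMap.mulLeft ℝ K)^[s] K := by
  induction s with
  | zero => simp [bell_succ, bell_zero]
  | succ s ih =>
    rw [Function.iterate_succ_apply', ← ih, bell_succ D K (s + 1)]
    rfl

theorem map_bell {B : Type*} [CommRing B] [Algebra ℝ B] (D : RealDerivation A)
    (D' : RealDerivation B) (φ : A →+* B) (h : ∀ f, φ (D f) = D' (φ f)) (K : A) (s : ℕ) :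
    φ (bell D K s) = bell D' (φ K) s := by
  induction s with
  | zero => exact map_one φ
  | succ s ih => rw [bell_succ, bell_succ, map_add, map_mul, h, ih]

end Binomial

/-! ### Partial fractions of χ^(j+1)/χ -/

section PartialFractions

variable {ι : Type*} [Fintype ι]

/-- The coefficients of the partial fraction expansion of the logarithmic derivatives
`χ^(j+1) / χ` of a polynomial `χ` with simple roots `z_i`. -/
noncomputable def partialFractionCoeff (z : ι → ℝ) : ℕ → ι → ℝ
  | 0 => fun _ => 1
  | j + 1 => fun i =>
    ∑ l, (z i - z l)⁻¹ * (partialFractionCoeff z j i + partialFractionCoeff z j l)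

/-- Stated abstractly so as to cover d/dx on the cofactors χ/(x - z_i) and D + J on the fields 1/(x
- z_i). The two share their coefficients, and no division by χ is needed. -/
theorem iterate_eq_sum_partialFractionCoeff {M : Type*} [AddCommGroup M] [Module ℝ M]
    (z : ι → ℝ) (T : M →ₗ[ℝ] M) (G : ι → M)
    (hT : ∀ i, T (G i) = ∑ q, (z i - z q)⁻¹ • (G i - G q)) (j : ℕ) :
    T^[j] (∑ i, G i) = ∑ i, partialFractionCoeff z j i • G i := by
  induction j with
  | zero => simp [partialFractionCoeff]
  | succ j ih =>
    rw [Function.iterate_succ_apply', ih, map_sum]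
    simp only [map_smul, hT, smul_sub, Finset.sum_sub_distrib, Finset.smul_sum, smul_smul,
      partialFractionCoeff, Finset.sum_smul, mul_add, add_smul, Finset.sum_add_distrib]
    rw [sub_eq_add_neg]
    congr 1
    · refine Finset.sum_congr rfl fun i _ => Finset.sum_congr rfl fun q _ => ?_
      rw [mul_comm]
    · rw [Finset.sum_comm, ← Finset.sum_neg_distrib]
      refine Finset.sum_congr rfl fun i _ => ?_
      rw [← Finset.sum_neg_distrib]
      refine Finset.sum_congr rfl fun q _ => ?_
      rw [← neg_smul, ← neg_sub (z i), inv_neg]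
      congr 1
      ring

open Polynomial

variable [DecidableEq ι]

/-- The product of the linear factors `X - z_q` over all `q ≠ i`. -/
noncomputable def cofactor (z : ι → ℝ) (i : ι) : ℝ[X] := ∏ q ∈ Finset.univ.erase i, (X - C (z q))

/-- The difference of the cofactors of i and q is (z_i - z_q) times the product over all other
roots, which is one term of the product rule. -/
theorem derivative_cofactor {z : ι → ℝ} (hz : Function.Injective z) (i : ι) :
    derivative (cofactor z i) = ∑ q, (z i - z q)⁻¹ • (cofactor z i - cofactor z q) := by
  rw [← Finset.add_sum_erase _ _ (Finset.mem_univ i), sub_self, sub_self, smul_zero, zero_add,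
    cofactor, derivative_prod_finset]
  refine Finset.sum_congr rfl fun q hq => ?_
  have hqi : q ≠ i := Finset.ne_of_mem_erase hq
  have h1 : cofactor z i = (X - C (z q)) * ∏ l ∈ (Finset.univ.erase i).erase q, (X - C (z l)) :=
    (Finset.mul_prod_erase _ _ hq).symm
  have h2 : cofactor z q = (X - C (z i)) * ∏ l ∈ (Finset.univ.erase i).erase q, (X - C (z l)) := by
    rw [Finset.erase_right_comm, Finset.mul_prod_erase _ (fun l => X - C (z l))
      (Finset.mem_erase.2 ⟨hqi.symm, Finset.mem_univ _⟩)]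
    rfl
  have h3 : z i - z q ≠ 0 := sub_ne_zero.2 fun h => hqi (hz h).symm
  change _ = (z i - z q)⁻¹ • (cofactor z i - cofactor z q)
  rw [h1, h2, ← sub_mul, derivative_X_sub_C, mul_one,
    show (X - C (z q) - (X - C (z i)) : ℝ[X]) = C (z i - z q) by rw [map_sub]; ring,
    ← smul_eq_C_mul, smul_smul, inv_mul_cancel₀ h3, one_smul]

theorem eval_cofactor_ne_zero {z : ι → ℝ} (hz : Function.Injective z) (i : ι) :
    (cofactor z i).eval (z i) ≠ 0 := by
  rw [cofactor, eval_prod]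
  refine Finset.prod_ne_zero_iff.2 fun q hq => ?_
  rw [eval_sub, eval_X, eval_C]
  exact sub_ne_zero.2 fun h => Finset.ne_of_mem_erase hq (hz h).symm

theorem eval_cofactor_of_ne (z : ι → ℝ) {i l : ι} (h : l ≠ i) : (cofactor z l).eval (z i) = 0 := by
  rw [cofactor, eval_prod]
  refine Finset.prod_eq_zero (Finset.mem_erase.2 ⟨h.symm, Finset.mem_univ i⟩) ?_
  rw [eval_sub, eval_X, eval_C, sub_self]

theorem iterate_derivative_X_sub_C_mul (a : ℝ) (f : ℝ[X]) (j : ℕ) :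
    derivative^[j + 1] ((X - C a) * f) =
      (X - C a) * derivative^[j + 1] f + (j + 1 : ℝ[X]) * derivative^[j] f := by
  induction j with
  | zero => simp [derivative_mul]; ring
  | succ j ih =>
    rw [Function.iterate_succ_apply', ih, Function.iterate_succ_apply' _ (j + 1),
      Function.iterate_succ_apply' _ j]
    simp only [derivative_add, derivative_mul, derivative_sub, derivative_X, derivative_C,
      derivative_natCast, derivative_one]
    push_cast
    ring

/-- Evaluate χ^(j+1) at z_i in two ways: in its expansion over cofactors only the i-th survives, and
χ = (x - z_i) c_i gives (j + 1) c_i^(j)(z_i). -/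
theorem partialFractionCoeff_eq {z : ι → ℝ} (hz : Function.Injective z) (j : ℕ) (i : ι) :
    partialFractionCoeff z j i = ((cofactor z i).eval (z i))⁻¹ *
      ((j + 1 : ℝ) * (derivative^[j] (cofactor z i)).eval (z i)) := by
  have h1 : derivative (∏ q, (X - C (z q))) = ∑ i, cofactor z i := by
    rw [derivative_prod_finset]
    refine Finset.sum_congr rfl fun q _ => ?_
    rw [derivative_X_sub_C, mul_one]
    rfl
  have h2 := iterate_eq_sum_partialFractionCoeff z (derivative : ℝ[X] →ₗ[ℝ] ℝ[X]) (cofactor z)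
    (derivative_cofactor hz) j
  rw [← h1, ← Function.iterate_succ_apply, Nat.succ_eq_add_one,
    ← Finset.mul_prod_erase _ _ (Finset.mem_univ i)] at h2
  change derivative^[j + 1] ((X - C (z i)) * cofactor z i) = _ at h2
  rw [iterate_derivative_X_sub_C_mul] at h2
  have h3 := congrArg (eval (z i)) h2
  rw [eval_add, eval_mul, eval_mul, eval_sub, eval_X, eval_C, sub_self, zero_mul, zero_add,
    eval_finsetSum, Finset.sum_eq_single i] at h3
  · rw [eval_smul, smul_eq_mul] at h3
    rw [eq_inv_mul_iff_mul_eq₀ (eval_cofactor_ne_zero hz i), mul_comm, ← h3]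
    simp
  · intro l _ hl
    rw [eval_smul, eval_cofactor_of_ne z hl, smul_zero]
  · exact fun h => absurd (Finset.mem_univ i) h

end PartialFractions

/-! ### Specialisation of fields at given eigenvalues -/

namespace TimesField

open MvPowerSeries TimeOp
open Finset.HasAntidiagonal (antidiagonal mem_antidiagonal)
open Finsupp (single)

section

variable {R S : Type*} [CommRing R] [CommRing S]

theorem _root_.MvPowerSeries.map_timesSum (φ : R →+* S) (F : ℕ → MvPowerSeries ℕ R) :
    MvPowerSeries.map φ (timesSum F) = timesSum fun k => MvPowerSeries.map φ (F k) := by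
  ext α
  rw [coeff_map, coeff_timesSum, coeff_timesSum, map_sum]
  simp only [coeff_map]

/-- The field obtained by applying a ring homomorphism to the coefficients. -/
noncomputable def mapField (φ : R →+* S) : TimesField R →+* TimesField S :=
  MvPowerSeries.map (PowerSeries.map φ)

theorem coeff_coeff_mapField (φ : R →+* S) (f : TimesField R) (α : ℕ →₀ ℕ) (n : ℕ) :
    PowerSeries.coeff n (coeff α (mapField φ f)) = φ (PowerSeries.coeff n (coeff α f)) := by
  rw [mapField, coeff_map, PowerSeries.coeff_map]

theorem laurentCoeff_mapField (φ : R →+* S) (f : TimesField R) (j : ℤ) :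
    laurentCoeff j (mapField φ f) = MvPowerSeries.map φ (laurentCoeff j f) := by
  ext α
  rw [coeff_map, coeff_laurentCoeff, coeff_laurentCoeff]
  rcases lt_or_ge (j + weight α) 0 with h | h
  · rw [intCoeff_of_neg h, intCoeff_of_neg h, map_zero]
  · obtain ⟨n, hn⟩ := Int.eq_ofNat_of_zero_le h
    rw [hn, intCoeff_natCast, intCoeff_natCast, coeff_coeff_mapField]

theorem mapField_invX (φ : R →+* S) : mapField φ invX = invX := by
  rw [mapField, invX, MvPowerSeries.map_C, PowerSeries.map_X, invX]

theorem mapField_current (φ : R →+* S) (p : ℕ → R) :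
    mapField φ (current p) = current fun k => φ (p k) := by
  rw [current, map_mul, mapField_invX, current, mapField, MvPowerSeries.map_C]
  congr 2

theorem mapField_potential (φ : R →+* S) : mapField φ (potential R) = potential S := by
  rw [potential, map_mul, mapField_invX, mapField, MvPowerSeries.map_timesSum, potential]
  simp

variable [Algebra ℝ R] [Algebra ℝ S]

theorem mapField_deriv (φ : R →ₐ[ℝ] S) (f : TimesField R) :
    mapField (φ : R →+* S) (deriv R f) = deriv S (mapField (φ : R →+* S) f) := by
  rw [deriv_apply, deriv_apply, map_mul, mapField_invX]
  congr 1
  ext α n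
  rw [coeff_coeff_mapField, coeff_coeff_euler, coeff_coeff_euler, coeff_coeff_mapField,
    RingHom.coe_coe, map_smul]

end

section

/-- The field `1/(x-y)`. -/
noncomputable def pole (y : ℝ) : TimesField ℝ := current fun k => y ^ k

theorem current_powerSum {N : ℕ} (z : Fin N → ℝ) :
    current (MatrixModel.powerSum z) = ∑ i, pole (z i) := by
  simp only [pole, current]
  rw [← Finset.mul_sum, ← map_sum]
  congr 2
  ext n
  rw [map_sum]
  simp [powerSumSeries, MatrixModel.powerSum]

/-- The geometric series inverts 1 - y/x; identities between poles are then proved by clearing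
denominators. -/
theorem exists_pole_mul (y : ℝ) : ∃ g : TimesField ℝ,
    (1 - algebraMap ℝ (TimesField ℝ) y * invX) * g = 1 ∧ pole y = invX * g := by
  refine ⟨C (powerSumSeries fun k => y ^ k), ?_, rfl⟩
  have h : algebraMap ℝ (TimesField ℝ) y = C (PowerSeries.C y) := by
    rw [MvPowerSeries.algebraMap_apply]; rfl
  rw [h, invX, ← map_one C, ← map_mul, ← map_sub, ← map_mul]
  congr 1
  ext n
  cases n with
  | zero => simp [powerSumSeries]
  | succ n => simp [powerSumSeries, sub_mul, mul_assoc, PowerSeries.coeff_succ_X_mul, pow_succ',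
      PowerSeries.coeff_one]

theorem sub_mul_pole (y : ℝ) : (1 - algebraMap ℝ (TimesField ℝ) y * invX) * pole y = invX := by
  obtain ⟨g, h1, h2⟩ := exists_pole_mul y
  rw [h2]
  linear_combination invX * h1

theorem pole_mul_pole (y y' : ℝ) (h : y ≠ y') :
    pole y * pole y' = (y - y')⁻¹ • (pole y - pole y') := by
  obtain ⟨g, h1, -⟩ := exists_pole_mul y
  obtain ⟨g', h1', -⟩ := exists_pole_mul y'
  have e := sub_mul_pole y
  have e' := sub_mul_pole y'
  have key : (y - y') • (pole y * pole y') = pole y - pole y' := by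
    rw [Algebra.smul_def, map_sub]
    set Y := algebraMap ℝ (TimesField ℝ) y
    set Y' := algebraMap ℝ (TimesField ℝ) y'
    have : (1 - Y * invX) * (1 - Y' * invX) *
        ((Y - Y') * (pole y * pole y') - (pole y - pole y')) = 0 := by
      linear_combination ((Y - Y') * (1 - Y' * invX) * pole y' - (1 - Y' * invX)) * e +
        ((Y - Y') * invX + (1 - Y * invX)) * e'
    have h2 : (Y - Y') * (pole y * pole y') - (pole y - pole y') = 0 := by
      linear_combination g * g' * this - ((Y - Y') * (pole y * pole y') - (pole y - pole y')) *
        ((1 - Y' * invX) * g' * h1 + h1')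
    exact sub_eq_zero.1 h2
  rw [← key, smul_smul, inv_mul_cancel₀ (sub_ne_zero.2 h), one_smul]

theorem deriv_pole (y : ℝ) : deriv ℝ (pole y) = -(pole y * pole y) := by
  obtain ⟨g, h1, -⟩ := exists_pole_mul y
  have e := sub_mul_pole y
  have hX : deriv ℝ invX = -(invX * invX) := by rw [deriv_apply, euler_invX]; ring
  have hd := congrArg (deriv ℝ) e
  rw [Derivation.leibniz, map_sub, Derivation.map_one_eq_zero, Derivation.leibniz, hX,
    Derivation.map_algebraMap] at hd
  simp only [smul_eq_mul] at hd
  have : (1 - algebraMap ℝ (TimesField ℝ) y * invX) * (deriv ℝ (pole y) + pole y * pole y) = 0 := by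
    linear_combination hd + (pole y + invX) * e
  linear_combination g * this - (deriv ℝ (pole y) + pole y * pole y) * h1

theorem deriv_add_current_mul_pole {N : ℕ} {z : Fin N → ℝ} (hz : Function.Injective z)
    (i : Fin N) :
    deriv ℝ (pole (z i)) + current (MatrixModel.powerSum z) * pole (z i) =
      ∑ q, (z i - z q)⁻¹ • (pole (z i) - pole (z q)) := by
  rw [current_powerSum, Finset.sum_mul, ← Finset.add_sum_erase _ _ (Finset.mem_univ i),
    ← Finset.add_sum_erase (a := i) _ (fun q => (z i - z q)⁻¹ • (pole (z i) - pole (z q)))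
      (Finset.mem_univ i), deriv_pole, neg_add_cancel_left, sub_self (pole (z i)), smul_zero,
    zero_add]
  refine Finset.sum_congr rfl fun q hq => ?_
  rw [mul_comm]
  exact pole_mul_pole _ _ fun h => Finset.ne_of_mem_erase hq (hz h).symm

/-- At the eigenvalues J = χ'/χ, so the left side is χ^(j+1)/χ and the right side is its partial
fraction expansion. -/
theorem bell_current_powerSum {N : ℕ} {z : Fin N → ℝ} (hz : Function.Injective z) (j : ℕ) :
    bell (deriv ℝ) (current (MatrixModel.powerSum z)) (j + 1) =
      ∑ i, partialFractionCoeff z j i • pole (z i) := by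
  rw [bell_succ_eq_iterate]
  have h := iterate_eq_sum_partialFractionCoeff z ((deriv ℝ).toLinearMap +
    LinearMap.mulLeft ℝ (current (MatrixModel.powerSum z))) (fun i => pole (z i))
    (deriv_add_current_mul_pole hz) j
  rw [← h, current_powerSum]

theorem laurentCoeff_pole (y : ℝ) (k : ℕ) : laurentCoeff ((k : ℤ) + 1) (pole y) = C (y ^ k) := by
  classical
  ext α
  rw [pole, current, laurentCoeff_invX_mul, add_sub_cancel_right, coeff_laurentCoeff, coeff_C,
    coeff_C, show (k : ℤ) + weight α = ((k + weight α : ℕ) : ℤ) by push_cast; rfl, intCoeff_natCast]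
  split_ifs with h
  · rw [h, map_zero, powerSumSeries, PowerSeries.coeff_mk, add_zero]
  · exact map_zero _

end

end TimesField

/-! ### Residue duality and the symbol of the constraint operator -/

namespace TimesField

open MvPowerSeries TimeOp
open Finset.HasAntidiagonal (antidiagonal mem_antidiagonal)
open Finsupp (single)

/-- The derivation `d/dx` of polynomials in `x`. -/
noncomputable def polyDeriv : RealDerivation (Polynomial ℝ) := Polynomial.derivative'

theorem polyDeriv_apply (f : Polynomial ℝ) : polyDeriv f = Polynomial.derivative f := rfl

/-- The series `V'(x) = ∑_k k t_k x^(k-1)` with polynomial coefficients. -/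
noncomputable def polyPotential : MvPowerSeries ℕ (Polynomial ℝ) :=
  timesSum fun k => C (polyDeriv (Polynomial.X ^ k))

/-- The operator `d/dx + V'(x)` on series with polynomial coefficients. -/
noncomputable def covariantDeriv :
    MvPowerSeries ℕ (Polynomial ℝ) →+ MvPowerSeries ℕ (Polynomial ℝ) :=
  (mapDerivation polyDeriv : RealDerivation (MvPowerSeries ℕ (Polynomial ℝ))).toLinearMap.toAddMonoidHom +
    AddMonoidHom.mulLeft polyPotential

theorem covariantDeriv_apply (q : MvPowerSeries ℕ (Polynomial ℝ)) :
    covariantDeriv q = mapDerivation polyDeriv q + polyPotential * q := rfl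

theorem covariantDeriv_timesSum (F : ℕ → MvPowerSeries ℕ (Polynomial ℝ)) :
    covariantDeriv (timesSum F) = timesSum fun k => covariantDeriv (F k) := by
  simp only [covariantDeriv_apply]
  rw [timesSum_add, mapDerivation_timesSum, mul_timesSum]

theorem covariantDeriv_smul (c : ℝ) (q : MvPowerSeries ℕ (Polynomial ℝ)) :
    covariantDeriv (c • q) = c • covariantDeriv q := by
  rw [covariantDeriv_apply, covariantDeriv_apply, Derivation.map_smul, mul_smul_comm, smul_add]

theorem iterate_covariantDeriv_timesSum (F : ℕ → MvPowerSeries ℕ (Polynomial ℝ)) (a : ℕ) :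
    covariantDeriv^[a] (timesSum F) = timesSum fun k => covariantDeriv^[a] (F k) := by
  induction a with
  | zero => rfl
  | succ a ih =>
    simp only [Function.iterate_succ_apply']
    rw [ih, covariantDeriv_timesSum]

theorem iterate_covariantDeriv_smul (c : ℝ) (q : MvPowerSeries ℕ (Polynomial ℝ)) (a : ℕ) :
    covariantDeriv^[a] (c • q) = c • covariantDeriv^[a] q := by
  induction a with
  | zero => rfl
  | succ a ih => rw [Function.iterate_succ_apply', ih, covariantDeriv_smul,
      Function.iterate_succ_apply']

theorem polyDeriv_X_pow (k : ℕ) :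
    polyDeriv (Polynomial.X ^ k) = (k : ℝ) • Polynomial.X ^ (k - 1) := by
  rw [polyDeriv_apply, Polynomial.derivative_X_pow, Polynomial.smul_eq_C_mul]

theorem covariantDeriv_X_pow (k : ℕ) :
    covariantDeriv (C (Polynomial.X ^ k)) =
      (k : ℝ) • C (Polynomial.X ^ (k - 1)) +
        timesSum fun l => (l : ℝ) • C (Polynomial.X ^ (k + l - 1)) := by
  have hs : ∀ (c : ℝ) (f : Polynomial ℝ), (C (c • f) : MvPowerSeries ℕ (Polynomial ℝ)) =
      c • C f := fun c f => by
    rw [Algebra.smul_def, map_mul, Algebra.smul_def, MvPowerSeries.algebraMap_apply]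
  rw [covariantDeriv_apply, mapDerivation_C, polyDeriv_X_pow, hs, polyPotential, timesSum_mul]
  congr 2
  funext l
  rw [← map_mul, polyDeriv_X_pow, smul_mul_assoc, hs]
  rcases Nat.eq_zero_or_pos l with rfl | hl
  · simp
  · rw [← pow_add]
    congr 3
    omega

theorem map_real_smul {R S : Type*} [CommRing R] [CommRing S] [Algebra ℝ R] [Algebra ℝ S]
    (φ : R →ₐ[ℝ] S) (c : ℝ) (q : MvPowerSeries ℕ R) :
    MvPowerSeries.map (φ : R →+* S) (c • q) = c • MvPowerSeries.map (φ : R →+* S) q := by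
  ext α
  rw [coeff_map, coeff_real_smul, coeff_real_smul, coeff_map, RingHom.coe_coe, map_smul]

/-- The evaluation at `y` of a series with polynomial coefficients. -/
noncomputable def evalSeries (y : ℝ) : MvPowerSeries ℕ (Polynomial ℝ) →+* MvPowerSeries ℕ ℝ :=
  MvPowerSeries.map (Polynomial.aeval y : Polynomial ℝ →ₐ[ℝ] ℝ)

theorem evalSeries_C (y : ℝ) (f : Polynomial ℝ) : evalSeries y (C f) = C (f.eval y) := by
  rw [evalSeries, MvPowerSeries.map_C, RingHom.coe_coe, Polynomial.coe_aeval_eq_eval]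

/-- The operator `V'(x) - d/dx` on fields. -/
noncomputable def adjointDeriv : TimesField ℝ →+ TimesField ℝ :=
  AddMonoidHom.mulLeft (potential ℝ) - (deriv ℝ : TimesField ℝ →+ TimesField ℝ)

theorem laurentCoeff_adjointDeriv (k : ℕ) (f : TimesField ℝ) :
    laurentCoeff ((k : ℤ) + 1) (adjointDeriv f) =
      (k : ℝ) • laurentCoeff (((k - 1 : ℕ) : ℤ) + 1) f +
        timesSum fun l => (l : ℝ) • laurentCoeff (((k + l - 1 : ℕ) : ℤ) + 1) f := by
  change laurentCoeff ((k : ℤ) + 1) (potential ℝ * f - deriv ℝ f) = _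
  rw [map_sub, laurentCoeff_deriv, laurentCoeff_potential_mul, sub_eq_neg_add, ← neg_smul]
  congr 1
  · rcases Nat.eq_zero_or_pos k with rfl | hk
    · simp
    · rw [Nat.cast_sub hk]
      push_cast
      congr 1
      · ring
      · congr 2; ring
  · congr 1
    funext l
    rcases Nat.eq_zero_or_pos l with rfl | hl
    · simp
    · rw [Nat.cast_sub (by omega)]
      push_cast
      congr 3
      ring

/-- V' - D on fields is adjoint to D + V' on polynomials under the residue pairing: both act on the
index k by the same recursion, and for a = 0 both sides are y^k. -/
theorem laurentCoeff_iterate_adjointDeriv_pole (y : ℝ) (a k : ℕ) :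
    laurentCoeff ((k : ℤ) + 1) (adjointDeriv^[a] (pole y)) =
      evalSeries y (covariantDeriv^[a] (C (Polynomial.X ^ k))) := by
  induction a generalizing k with
  | zero =>
    rw [Function.iterate_zero, Function.iterate_zero, id, id, evalSeries_C, laurentCoeff_pole]
    simp
  | succ a ih =>
    rw [Function.iterate_succ_apply', laurentCoeff_adjointDeriv, Function.iterate_succ_apply,
      covariantDeriv_X_pow, iterate_map_add, iterate_covariantDeriv_smul,
      iterate_covariantDeriv_timesSum, map_add, evalSeries, map_real_smul,
      MvPowerSeries.map_timesSum, ← evalSeries]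
    simp only [ih, iterate_covariantDeriv_smul, evalSeries, map_real_smul]

theorem laurentCoeff_iterate_adjointDeriv_one (a k : ℕ) :
    laurentCoeff ((k : ℤ) + 1) (adjointDeriv^[a] 1) = 0 := by
  induction a generalizing k with
  | zero =>
    rw [Function.iterate_zero, id]
    classical
    ext1 α
    rw [coeff_laurentCoeff, coeff_one, show (k : ℤ) + 1 + weight α =
      ((k + 1 + weight α : ℕ) : ℤ) by push_cast; ring, intCoeff_natCast]
    split_ifs
    · rw [PowerSeries.coeff_one, if_neg (by omega), coeff_zero]
    · rw [map_zero, coeff_zero]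
  | succ a ih =>
    rw [Function.iterate_succ_apply', laurentCoeff_adjointDeriv]
    simp only [ih, smul_zero, zero_add]
    ext1 α
    simp [coeff_timesSum]

theorem iterate_covariantDeriv_C_mul (f g : Polynomial ℝ) (r : ℕ) :
    covariantDeriv^[r] (C (f * g)) = ∑ x ∈ antidiagonal r, r.choose x.1 •
      (C (Polynomial.derivative^[x.1] g) * covariantDeriv^[x.2] (C f)) := by
  have h := iterate_eq_sum_choose covariantDeriv
    (fun j l => C (Polynomial.derivative^[j] g) * covariantDeriv^[l] (C f)) (fun j l => by
      rw [covariantDeriv_apply, Derivation.leibniz, mapDerivation_C, Function.iterate_succ_apply',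
        Function.iterate_succ_apply', polyDeriv_apply, covariantDeriv_apply (covariantDeriv^[l] _)]
      simp only [smul_eq_mul]
      ring) r
  rw [← h]
  simp only [Function.iterate_zero, id]
  rw [map_mul, mul_comm]

theorem iterate_polyDeriv_mul_expSeries (q E : MvPowerSeries ℕ (Polynomial ℝ))
    (hE : mapDerivation polyDeriv E = polyPotential * E) (r : ℕ) :
    (mapDerivation polyDeriv)^[r] (q * E) = covariantDeriv^[r] q * E := by
  induction r with
  | zero => rfl
  | succ r ih =>
    rw [Function.iterate_succ_apply', ih, Function.iterate_succ_apply', Derivation.leibniz, hE,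
      covariantDeriv_apply]
    simp only [smul_eq_mul]
    ring

theorem coeff_iterate_mapDerivation (E : MvPowerSeries ℕ (Polynomial ℝ)) (r : ℕ) (α : ℕ →₀ ℕ) :
    coeff α ((mapDerivation polyDeriv)^[r] E) = Polynomial.derivative^[r] (coeff α E) := by
  induction r with
  | zero => rfl
  | succ r ih => rw [Function.iterate_succ_apply', Function.iterate_succ_apply',
      coeff_mapDerivation, ih, polyDeriv_apply]

/-- The differential operator in the times obtained from the total derivative operator of
order `r` with the factor `z^M`. -/
noncomputable def constraintOp (r M : ℕ) : TimeOp :=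
  -- The sign undoes the one in the duality for -J - V', and 1/(r + 1) cancels the factor r + 1
  -- coming from χ^(r+1)(z_i) = (r + 1) c_i^(r)(z_i).
  ((-1) ^ (r + 1) * ((r : ℝ) + 1)⁻¹) • laurentCoeff ((M : ℤ) + 1) (symmetrizedBell (r + 1))

theorem mapField_bell {N : ℕ} (z : Fin N → ℝ) (K : TimesField (MvPolynomial ℕ ℝ)) (s : ℕ) :
    mapField (MvPolynomial.eval (MatrixModel.powerSum z)) (bell (deriv _) K s) =
      bell (deriv ℝ) (mapField (MvPolynomial.eval (MatrixModel.powerSum z)) K) s :=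
  map_bell _ _ _ (fun f => mapField_deriv (MvPolynomial.aeval (MatrixModel.powerSum z)) f) K s

theorem mapField_symmetrizedBell {N : ℕ} (z : Fin N → ℝ) (s : ℕ) :
    mapField (MvPolynomial.eval (MatrixModel.powerSum z)) (symmetrizedBell s) =
      bell (deriv ℝ) (-current (MatrixModel.powerSum z) - potential ℝ) s +
        bell (deriv ℝ) (current (MatrixModel.powerSum z)) s := by
  rw [symmetrizedBell, map_add, mapField_bell, mapField_bell, map_sub, map_neg, mapField_current,
    mapField_potential]
  simp only [MvPolynomial.eval_X]

theorem laurentCoeff_bell_current {N : ℕ} {z : Fin N → ℝ} (hz : Function.Injective z)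
    (j a k : ℕ) :
    laurentCoeff ((k : ℤ) + 1) (adjointDeriv^[a]
      (bell (deriv ℝ) (current (MatrixModel.powerSum z)) (j + 1))) =
      ∑ i, partialFractionCoeff z j i •
        evalSeries (z i) (covariantDeriv^[a] (C (Polynomial.X ^ k))) := by
  have hs : ∀ (c : ℝ) f, adjointDeriv^[a] (c • f) = c • adjointDeriv^[a] f := by
    intro c f
    induction a with
    | zero => rfl
    | succ a ih =>
      rw [Function.iterate_succ_apply', Function.iterate_succ_apply', ih]
      change potential ℝ * _ - deriv ℝ _ = c • (potential ℝ * _ - deriv ℝ _)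
      rw [Derivation.map_smul, smul_sub, mul_smul_comm]
  have hsum : ∀ f : Fin N → TimesField ℝ, adjointDeriv^[a] (∑ i, f i) =
      ∑ i, adjointDeriv^[a] (f i) := by
    intro f
    clear hs
    induction a with
    | zero => rfl
    | succ a ih =>
      simp only [Function.iterate_succ_apply']
      rw [ih, map_sum]
  rw [bell_current_powerSum hz, hsum, map_sum]
  refine Finset.sum_congr rfl fun i _ => ?_
  rw [hs, laurentCoeff_smul, laurentCoeff_iterate_adjointDeriv_pole]

theorem laurentCoeff_neg_one_pow_mul (j : ℤ) (s : ℕ) (f : TimesField ℝ) :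
    laurentCoeff j ((-1) ^ s * f) = (-1 : ℝ) ^ s • laurentCoeff j f := by
  rw [← laurentCoeff_smul, Algebra.smul_def, map_pow, map_neg, map_one]

/-- By `sum_choose_iterate_bell` the left side is a binomial sum of iterates of V' - D on χ^(j)/χ.
Expanding in poles and using residue duality turns it into the Leibniz expansion of (D + V')^r (x^M
c_i) at z_i; the term j = 0 has no negative powers. -/
theorem laurentCoeff_bell_dual {N : ℕ} {z : Fin N → ℝ} (hz : Function.Injective z) (r M : ℕ) :
    (-1 : ℝ) ^ (r + 1) • laurentCoeff ((M : ℤ) + 1)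
      (bell (deriv ℝ) (-current (MatrixModel.powerSum z) - potential ℝ) (r + 1)) =
    ((r : ℝ) + 1) • ∑ i, ((cofactor z i).eval (z i))⁻¹ •
      evalSeries (z i) (covariantDeriv^[r] (C (Polynomial.X ^ M * cofactor z i))) := by
  rw [← laurentCoeff_neg_one_pow_mul, ← sum_choose_iterate_bell, ← adjointDeriv, map_sum,
    Finset.Nat.sum_antidiagonal_succ]
  have h0 : laurentCoeff ((M : ℤ) + 1) ((r + 1).choose 0 • adjointDeriv^[r + 1]
      (bell (deriv ℝ) (current (MatrixModel.powerSum z)) 0)) = 0 := by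
    rw [map_nsmul, bell_zero, laurentCoeff_iterate_adjointDeriv_one, nsmul_zero]
  rw [h0, zero_add]
  simp only [iterate_covariantDeriv_C_mul]
  simp only [map_nsmul, laurentCoeff_bell_current hz, map_sum,
    Finset.smul_sum, map_mul, evalSeries_C]
  rw [Finset.sum_comm]
  refine Finset.sum_congr rfl fun i _ => Finset.sum_congr rfl fun x _ => ?_
  rw [partialFractionCoeff_eq hz]
  have hC : ∀ (c : ℝ) (F : MvPowerSeries ℕ ℝ), C c * F = c • F := fun c F => by
    rw [Algebra.smul_def]; rfl
  rw [hC, ← Nat.cast_smul_eq_nsmul ℝ, ← Nat.cast_smul_eq_nsmul ℝ]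
  simp only [smul_smul]
  congr 1
  -- The factor j + 1 of the partial fraction coefficient converts binomials of r + 1 into binomials
  -- of r.
  have h := Nat.add_one_mul_choose_eq r x.1
  have h' : ((r : ℝ) + 1) * (r.choose x.1 : ℝ) = ((r + 1).choose (x.1 + 1) : ℝ) * ((x.1 : ℝ) + 1) := by
    exact_mod_cast h
  linear_combination (-((cofactor z i).eval (z i))⁻¹ *
    (Polynomial.derivative^[x.1] (cofactor z i)).eval (z i)) * h'

theorem map_constraintOp {N : ℕ} {z : Fin N → ℝ} (hz : Function.Injective z) (r M : ℕ) :
    MvPowerSeries.map (MvPolynomial.eval (MatrixModel.powerSum z)) (constraintOp r M) =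
      ∑ i, ((cofactor z i).eval (z i))⁻¹ •
        (evalSeries (z i) (covariantDeriv^[r] (C (Polynomial.X ^ M * cofactor z i))) -
          C ((-1) ^ r * (z i ^ M * (Polynomial.derivative^[r] (cofactor z i)).eval (z i)))) := by
  have h1 : MvPowerSeries.map (MvPolynomial.eval (MatrixModel.powerSum z)) (constraintOp r M) =
      ((-1) ^ (r + 1) * ((r : ℝ) + 1)⁻¹) • laurentCoeff ((M : ℤ) + 1)
        (mapField (MvPolynomial.eval (MatrixModel.powerSum z)) (symmetrizedBell (r + 1))) := by
    rw [laurentCoeff_mapField]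
    exact map_real_smul (MvPolynomial.aeval (MatrixModel.powerSum z)) _ _
  have hr : ((r : ℝ) + 1)⁻¹ * ((r : ℝ) + 1) = 1 := inv_mul_cancel₀ (by positivity)
  have h2 := laurentCoeff_bell_current hz r 0 M
  rw [Function.iterate_zero, id] at h2
  rw [h1, mapField_symmetrizedBell, map_add, smul_add, mul_comm, mul_smul, mul_smul,
    laurentCoeff_bell_dual hz, h2, smul_smul, hr, one_smul, Finset.smul_sum, Finset.smul_sum,
    ← Finset.sum_add_distrib]
  refine Finset.sum_congr rfl fun i _ => ?_
  rw [smul_sub, sub_eq_add_neg, Function.iterate_zero, id, evalSeries_C, Polynomial.eval_pow,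
    Polynomial.eval_X, partialFractionCoeff_eq hz]
  have hC : ∀ (c d : ℝ), c • (C d : MvPowerSeries ℕ ℝ) = C (c * d) := fun c F => by
    rw [Algebra.smul_def, map_mul]; rfl
  rw [hC, hC, hC, hC, ← map_neg]
  congr 2
  rw [pow_succ]
  linear_combination (-((-1) ^ r * ((cofactor z i).eval (z i))⁻¹ * z i ^ M *
    (Polynomial.derivative^[r] (cofactor z i)).eval (z i))) * hr

end TimesField

/-! ### The total derivative operator on the integrand -/

namespace MatrixModel

open MvPowerSeries TimeOp TimesField
open Finset.HasAntidiagonal (antidiagonal mem_antidiagonal)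
open Polynomial (derivative)

theorem iteratedDeriv_polynomial_eval (f : Polynomial ℝ) (k : ℕ) :
    iteratedDeriv k (fun s => f.eval s) = fun s => (derivative^[k] f).eval s := by
  induction k with
  | zero => simp
  | succ k ih =>
    rw [iteratedDeriv_succ, ih]
    funext s
    rw [Polynomial.deriv, Function.iterate_succ_apply']

/-- The factor of the Vandermonde determinant that does not depend on `z_i`. -/
noncomputable def vandermondeFactor {N : ℕ} (z : Fin N → ℝ) (i : Fin N) : ℝ :=
  ∏ a ∈ Finset.univ.erase i, ((if a < i then -1 else 1) *
    ∏ b ∈ (Finset.Ioi a).erase i, (z a - z b))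

/-- As a function of z_i alone, Δ is a constant times the cofactor polynomial; each a < i
contributes a sign because z_i is then subtracted. -/
theorem vandermonde_update {N : ℕ} (z : Fin N → ℝ) (i : Fin N) (s : ℝ) :
    vandermonde N (Function.update z i s) = vandermondeFactor z i * (cofactor z i).eval s := by
  rw [vandermonde, ← Finset.mul_prod_erase _ _ (Finset.mem_univ i)]
  have h1 : ∏ b ∈ Finset.Ioi i, (Function.update z i s i - Function.update z i s b) =
      ∏ a ∈ Finset.univ.erase i, if i < a then s - z a else 1 := by
    rw [← Finset.prod_filter]
    refine Finset.prod_congr ?_ fun b hb => ?_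
    · ext b
      simp only [Finset.mem_Ioi, Finset.mem_filter, Finset.mem_erase, Finset.mem_univ, and_true]
      exact ⟨fun h => ⟨h.ne', h⟩, fun h => h.2⟩
    · simp only [Finset.mem_filter, Finset.mem_erase] at hb
      rw [Function.update_self, Function.update_of_ne hb.1.1]
  have h2 : ∀ a ∈ Finset.univ.erase i,
      ∏ b ∈ Finset.Ioi a, (Function.update z i s a - Function.update z i s b) =
        (if a < i then z a - s else 1) * ∏ b ∈ (Finset.Ioi a).erase i, (z a - z b) := by
    intro a ha
    have hai := Finset.ne_of_mem_erase ha
    have h3 : ∏ b ∈ (Finset.Ioi a).erase i, (z a - z b) =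
        ∏ b ∈ (Finset.Ioi a).erase i, (Function.update z i s a - Function.update z i s b) := by
      refine Finset.prod_congr rfl fun b hb => ?_
      rw [Function.update_of_ne hai, Function.update_of_ne (Finset.ne_of_mem_erase hb)]
    rw [h3]
    split_ifs with h
    · rw [← Finset.mul_prod_erase _ _ (Finset.mem_Ioi.2 h), Function.update_self,
        Function.update_of_ne hai]
    · rw [Finset.erase_eq_of_notMem (by simpa using h), one_mul]
  rw [h1, Finset.prod_congr rfl h2, ← Finset.prod_mul_distrib, vandermondeFactor, cofactor,
    Polynomial.eval_prod, ← Finset.prod_mul_distrib]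
  refine Finset.prod_congr rfl fun a ha => ?_
  rw [Polynomial.eval_sub, Polynomial.eval_X, Polynomial.eval_C]
  rcases lt_or_gt_of_ne (Finset.ne_of_mem_erase ha) with h | h
  · rw [if_neg h.not_gt, if_pos h, if_pos h]; ring
  · rw [if_pos h, if_neg h.not_gt, if_neg h.not_gt]; ring

theorem partialD_vandermonde_update {N : ℕ} (z : Fin N → ℝ) (i : Fin N) (s : ℝ) (k : ℕ) :
    partialD i k (vandermonde N) (Function.update z i s) =
      vandermondeFactor z i * (derivative^[k] (cofactor z i)).eval s := by
  rw [partialD, Function.update_self]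
  simp only [Function.update_idem, vandermonde_update]
  have h : (fun s => vandermondeFactor z i * (cofactor z i).eval s) =
      fun s => (Polynomial.C (vandermondeFactor z i) * cofactor z i).eval s := by
    funext s
    rw [Polynomial.eval_mul, Polynomial.eval_C]
  rw [h, iteratedDeriv_polynomial_eval]
  beta_reduce
  rw [Polynomial.iterate_derivative_C_mul, Polynomial.eval_mul, Polynomial.eval_C]

/-- The power sums as polynomials in the variable `z_i`. -/
noncomputable def powerSumPoly {N : ℕ} (z : Fin N → ℝ) (i : Fin N) (k : ℕ) : Polynomial ℝ :=
  Polynomial.C (∑ q ∈ Finset.univ.erase i, z q ^ k) + Polynomial.X ^ k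

theorem eval_powerSumPoly {N : ℕ} (z : Fin N → ℝ) (i : Fin N) (k : ℕ) (s : ℝ) :
    (powerSumPoly z i k).eval s = powerSum (Function.update z i s) k := by
  rw [powerSumPoly, Polynomial.eval_add, Polynomial.eval_C, Polynomial.eval_pow, Polynomial.eval_X,
    powerSum, ← Finset.add_sum_erase _ _ (Finset.mem_univ i), Function.update_self, add_comm]
  congr 1
  refine Finset.sum_congr rfl fun q hq => ?_
  rw [Function.update_of_ne (Finset.ne_of_mem_erase hq)]

theorem evalSeries_expSeries {N : ℕ} (z : Fin N → ℝ) (i : Fin N) (s : ℝ) :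
    evalSeries s (expSeries (powerSumPoly z i)) = expSeries (powerSum (Function.update z i s)) := by
  rw [evalSeries, map_expSeries]
  congr 1
  funext k
  rw [Polynomial.coe_aeval_eq_eval, eval_powerSumPoly]

theorem mapDerivation_expSeries_powerSumPoly {N : ℕ} (z : Fin N → ℝ) (i : Fin N) :
    mapDerivation polyDeriv (expSeries (powerSumPoly z i)) =
      polyPotential * expSeries (powerSumPoly z i) := by
  rw [mapDerivation_expSeries, polyPotential]
  congr 2
  funext k
  rw [powerSumPoly, map_add, polyDeriv_apply (Polynomial.C _), Polynomial.derivative_C, zero_add]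

/-- With the term k = r included, the sum would be f^(r) g by the adjoint Leibniz rule; W_n^r omits
exactly that term. -/
theorem sum_range_adjoint_leibniz (f g : Polynomial ℝ) (r : ℕ) :
    ∑ k ∈ Finset.range r, ((-1) ^ k * (r.choose k : Polynomial ℝ)) *
        derivative^[r - k] (f * derivative^[k] g) =
      derivative^[r] f * g - (-1) ^ r * (f * derivative^[r] g) := by
  have h := sum_choose_iterate_eq (derivative : Polynomial ℝ →ₗ[ℝ] Polynomial ℝ).toAddMonoidHom
    (fun f => derivative f) (fun f j => Polynomial.C ((-1) ^ j) * (f * derivative^[j] g))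
    (fun f j => by
      change derivative _ + _ = _
      rw [Polynomial.derivative_C_mul, Polynomial.derivative_mul, Function.iterate_succ_apply',
        pow_succ, map_mul, map_neg, map_one]
      ring) r f
  rw [Finset.Nat.sum_antidiagonal_eq_sum_range_succ
    (fun a b => r.choose a • (derivative : Polynomial ℝ →ₗ[ℝ] Polynomial ℝ).toAddMonoidHom^[b]
      (Polynomial.C ((-1) ^ a) * (f * derivative^[a] g))), Finset.sum_range_succ] at h
  rw [eq_sub_iff_add_eq]
  simp only [pow_zero, map_one, one_mul, Function.iterate_zero, id] at h
  rw [← h]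
  congr 1
  · refine Finset.sum_congr rfl fun k _ => ?_
    change _ = _ • derivative^[r - k] _
    rw [Polynomial.iterate_derivative_C_mul, nsmul_eq_mul, map_pow, map_neg, map_one]
    ring
  · simp

theorem totalDerivative_integrand {N : ℕ} {z : Fin N → ℝ} (hz : Function.Injective z) (r : ℕ)
    (n : ℤ) (M : ℕ) (hM : n + r = M) (α : ℕ →₀ ℕ) :
    totalDerivative N r n (coeff α (integrand N)) z = vandermonde N z ^ 2 *
      ∑ i, ((cofactor z i).eval (z i))⁻¹ *
        ((derivative^[r] (Polynomial.X ^ M * cofactor z i *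
            coeff α (expSeries (powerSumPoly z i)))).eval (z i) -
          (-1) ^ r * (z i ^ M * (derivative^[r] (cofactor z i)).eval (z i)) *
            coeff α (expSeries (powerSum z))) := by
  have key : ∀ (k : ℕ) (i : Fin N), partialD i (r - k) (fun w => w i ^ (n + r) *
      (vandermonde N w)⁻¹ * partialD i k (vandermonde N) w * coeff α (integrand N) w) z =
      vandermondeFactor z i ^ 2 * (derivative^[r - k]
        ((Polynomial.X ^ M * cofactor z i * coeff α (expSeries (powerSumPoly z i))) *
          derivative^[k] (cofactor z i))).eval (z i) := by
    intro k i
    have h : (fun s : ℝ => (Function.update z i s) i ^ (n + r) *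
        (vandermonde N (Function.update z i s))⁻¹ *
        partialD i k (vandermonde N) (Function.update z i s) *
        coeff α (integrand N) (Function.update z i s)) =
        fun s => (Polynomial.C (vandermondeFactor z i ^ 2) *
          ((Polynomial.X ^ M * cofactor z i * coeff α (expSeries (powerSumPoly z i))) *
          derivative^[k] (cofactor z i))).eval s := by
      funext s
      rw [hM, zpow_natCast, Function.update_self, vandermonde_update, partialD_vandermonde_update,
        coeff_integrand, vandermonde_update, ← evalSeries_expSeries]
      simp only [Polynomial.eval_mul, Polynomial.eval_C, Polynomial.eval_pow, Polynomial.eval_X]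
      have : coeff α (evalSeries s (expSeries (powerSumPoly z i))) =
        (coeff α (expSeries (powerSumPoly z i))).eval s := rfl
      rw [this]
      by_cases h1 : vandermondeFactor z i = 0
      · rw [h1]; simp
      -- The variable s may meet another entry of z, where Δ⁻¹ is 0 by convention. Both sides vanish
      -- there, so the function is a polynomial on the whole line and can be differentiated as one.
      by_cases h2 : (cofactor z i).eval s = 0
      · rw [h2]; simp
      field_simp
    rw [partialD, h, iteratedDeriv_polynomial_eval]
    beta_reduce
    rw [Polynomial.iterate_derivative_C_mul, Polynomial.eval_mul, Polynomial.eval_C]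
  rw [totalDerivative]
  simp only [key, Finset.mul_sum]
  rw [Finset.sum_comm]
  refine Finset.sum_congr rfl fun i _ => ?_
  set h := Polynomial.X ^ M * cofactor z i * coeff α (expSeries (powerSumPoly z i)) with hh
  have h1 := congrArg (Polynomial.eval (z i)) (sum_range_adjoint_leibniz h (cofactor z i) r)
  have h2 : ∑ k ∈ Finset.range r, (-1) ^ k * (r.choose k : ℝ) * (vandermondeFactor z i ^ 2 *
      (derivative^[r - k] (h * derivative^[k] (cofactor z i))).eval (z i)) =
      vandermondeFactor z i ^ 2 * Polynomial.eval (z i) (derivative^[r] h * cofactor z i -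
        (-1) ^ r * (h * derivative^[r] (cofactor z i))) := by
    rw [← h1, Polynomial.eval_finsetSum, Finset.mul_sum]
    refine Finset.sum_congr rfl fun k _ => ?_
    simp only [Polynomial.eval_mul, Polynomial.eval_pow, Polynomial.eval_neg, Polynomial.eval_one,
      Polynomial.eval_natCast]
    ring
  have h3 : vandermonde N z = vandermondeFactor z i * (cofactor z i).eval (z i) := by
    rw [← vandermonde_update, Function.update_eq_self]
  have h4 : (coeff α (expSeries (powerSumPoly z i))).eval (z i) =
      coeff α (expSeries (powerSum z)) := by
    have : coeff α (evalSeries (z i) (expSeries (powerSumPoly z i))) =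
        (coeff α (expSeries (powerSumPoly z i))).eval (z i) := rfl
    rw [← this, evalSeries_expSeries, Function.update_eq_self]
  have h5 := eval_cofactor_ne_zero hz i
  rw [h2, h3, Polynomial.eval_sub]
  simp only [Polynomial.eval_mul, Polynomial.eval_pow, Polynomial.eval_neg, Polynomial.eval_one]
  have h6 : h.eval (z i) = z i ^ M * (cofactor z i).eval (z i) *
      coeff α (expSeries (powerSum z)) := by
    rw [hh, Polynomial.eval_mul, Polynomial.eval_mul, Polynomial.eval_pow, Polynomial.eval_X, h4]
  rw [h6]
  field_simp

theorem isConstraintOperator_constraintOp (r : ℕ) (n : ℤ) (M : ℕ) (hM : n + r = M) :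
    IsConstraintOperator r n (constraintOp r M) := by
  intro N z hz α
  rw [coeff_act_integrand, totalDerivative_integrand hz r n M hM, map_constraintOp hz,
    Finset.sum_mul, map_sum]
  congr 1
  refine Finset.sum_congr rfl fun i _ => ?_
  rw [smul_mul_assoc, coeff_real_smul, smul_eq_mul, sub_mul, map_sub, coeff_C_mul]
  congr 2
  -- Conjugation by the exponential turns d/dz_i into d/dz_i + V'(z_i).
  have h1 := iterate_polyDeriv_mul_expSeries (C (Polynomial.X ^ M * cofactor z i)) _
    (mapDerivation_expSeries_powerSumPoly z i) r
  have h2 : expSeries (powerSum z) = evalSeries (z i) (expSeries (powerSumPoly z i)) := by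
    rw [evalSeries_expSeries, Function.update_eq_self]
  rw [h2, ← map_mul, ← h1]
  change Polynomial.eval (z i) (coeff α _) = _
  rw [coeff_iterate_mapDerivation, coeff_C_mul]

end MatrixModel

/-! ### Uniqueness: independence of the power sums -/

namespace MatrixModel

open MvPowerSeries TimeOp TimesField

theorem vandermonde_ne_zero {N : ℕ} {z : Fin N → ℝ} (hz : Function.Injective z) :
    vandermonde N z ≠ 0 :=
  Finset.prod_ne_zero_iff.2 fun _ _ => Finset.prod_ne_zero_iff.2 fun _ hj =>
    sub_ne_zero.2 fun h => (Finset.mem_Ioi.1 hj).ne (hz h)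

/-- Multiplied by the Vandermonde polynomial, f(p(z)) vanishes identically, and polynomial rings
over ℝ have no zero divisors. -/
theorem eval_powerSum_eq_zero {N : ℕ} {f : MvPolynomial ℕ ℝ}
    (h : ∀ z : Fin N → ℝ, Function.Injective z → MvPolynomial.eval (powerSum z) f = 0)
    (z : Fin N → ℝ) : MvPolynomial.eval (powerSum z) f = 0 := by
  set g : MvPolynomial (Fin N) ℝ :=
    MvPolynomial.aeval (fun k => ∑ i, MvPolynomial.X i ^ k) f with hg
  set v : MvPolynomial (Fin N) ℝ :=
    ∏ i, ∏ j ∈ Finset.Ioi i, (MvPolynomial.X i - MvPolynomial.X j) with hv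
  have hge : ∀ z : Fin N → ℝ, MvPolynomial.eval z g = MvPolynomial.eval (powerSum z) f := by
    intro z
    rw [hg, MvPolynomial.map_aeval]
    refine MvPolynomial.eval₂Hom_congr ?_ ?_ rfl
    · ext c; simp
    · funext k
      simp [powerSum]
  have hve : ∀ z : Fin N → ℝ, MvPolynomial.eval z v = vandermonde N z := by
    intro z
    simp [hv, vandermonde]
  have hv0 : v ≠ 0 := by
    intro h0
    have h1 := hve fun i => (i : ℝ)
    rw [h0, map_zero] at h1
    exact vandermonde_ne_zero (fun a b hab => Fin.ext (Nat.cast_injective hab)) h1.symm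
  have hgv : g * v = 0 := by
    refine MvPolynomial.funext fun z => ?_
    rw [map_mul, hge, hve, map_zero]
    by_cases hz : Function.Injective z
    · rw [h z hz, zero_mul]
    · obtain ⟨a, b, hab, hne⟩ : ∃ a b, z a = z b ∧ a ≠ b := by
        simpa [Function.Injective] using hz
      have : vandermonde N z = 0 := by
        wlog hlt : a < b generalizing a b
        · exact this b a hab.symm hne.symm (lt_of_le_of_ne (not_lt.1 hlt) hne.symm)
        exact Finset.prod_eq_zero (Finset.mem_univ a)
          (Finset.prod_eq_zero (Finset.mem_Ioi.2 hlt) (sub_eq_zero.2 hab))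
      rw [this, mul_zero]
  rw [← hge, (mul_eq_zero.1 hgv).resolve_right hv0, map_zero]

theorem exists_powerSum_eq {m : ℕ} (x : Fin m → ℝ) (n : Fin m → ℕ) :
    ∃ (N : ℕ) (z : Fin N → ℝ), ∀ k, powerSum z k = ∑ j, n j * x j ^ k := by
  let e := Fintype.equivFin ((j : Fin m) × Fin (n j))
  refine ⟨_, fun i => x (e.symm i).1, fun k => ?_⟩
  rw [powerSum, Equiv.sum_comp e.symm (fun p => x p.1 ^ k), Fintype.sum_sigma]
  simp

/-- A polynomial in the power sums that vanishes for any number of variables is zero. -/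
theorem eq_zero_of_eval_powerSum {f : MvPolynomial ℕ ℝ}
    (h : ∀ (N : ℕ) (z : Fin N → ℝ), MvPolynomial.eval (powerSum z) f = 0) : f = 0 := by
  obtain ⟨m, hm⟩ : ∃ m, ∀ k ∈ f.vars, k < m := by
    obtain ⟨m, hm⟩ := f.vars.bddAbove
    exact ⟨m + 1, fun k hk => Nat.lt_succ_of_le (hm hk)⟩
  set x : Fin m → ℝ := fun j => (j : ℝ) with hx
  have hxi : Function.Injective x := fun a b hab => Fin.ext (Nat.cast_injective hab)
  set g : MvPolynomial (Fin m) ℝ :=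
    MvPolynomial.aeval (fun k => ∑ j, MvPolynomial.X j * MvPolynomial.C (x j ^ k)) f with hg
  have hge : ∀ y : Fin m → ℝ, MvPolynomial.eval y g =
      MvPolynomial.eval (fun k => ∑ j, y j * x j ^ k) f := by
    intro y
    rw [hg, MvPolynomial.map_aeval]
    refine MvPolynomial.eval₂Hom_congr ?_ ?_ rfl
    · ext c; simp
    · funext k
      simp
  -- At natural numbers y_j the sums ∑ y_j x_j^k are the power sums of the points x_j repeated y_j
  -- times, so g vanishes on an infinite grid.
  have hg0 : g = 0 := by
    refine MvPolynomial.funext_set (fun _ => Set.range ((↑) : ℕ → ℝ))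
      (fun _ => Set.infinite_range_of_injective Nat.cast_injective) fun y hy => ?_
    choose n hn using fun j => hy j (Set.mem_univ j)
    obtain ⟨N, z, hz⟩ := exists_powerSum_eq x n
    rw [hge, map_zero, ← h N z]
    congr 2
    funext k
    rw [hz]
    simp only [hn]
  refine MvPolynomial.funext fun a => ?_
  rw [map_zero]
  set B := (Matrix.vandermonde x).transpose with hB
  have hdet : IsUnit B.det := by
    rw [hB, Matrix.det_transpose]
    exact (Matrix.det_vandermonde_ne_zero_iff.2 hxi).isUnit
  -- Inverting the Vandermonde matrix gives real weights y with ∑ y_j x_j^k = a_k for all k < m, so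
  -- the values of f are values of g.
  set y := B⁻¹.mulVec fun k : Fin m => a k with hy
  have hya : B.mulVec y = fun k : Fin m => a k := by
    rw [hy, Matrix.mulVec_mulVec, Matrix.mul_nonsing_inv _ hdet, Matrix.one_mulVec]
  have h1 := hge y
  rw [hg0, map_zero] at h1
  rw [h1]
  refine MvPolynomial.eval₂Hom_congr' rfl (fun k hk _ => ?_) rfl
  have h2 := congrFun hya ⟨k, hm k hk⟩
  rw [← h2, Matrix.mulVec, dotProduct]
  refine Finset.sum_congr rfl fun j _ => ?_
  rw [hB, Matrix.transpose_apply, Matrix.vandermonde_apply, mul_comm]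

theorem coeff_zero_expSeries {R : Type*} [CommRing R] [Algebra ℝ R] (p : ℕ → R) :
    coeff 0 (expSeries p) = 1 := by
  rw [coeff_expSeries, Finsupp.prod_zero_index]

/-- A differential operator in the times is determined by its action on the integrands of the
matrix model. -/
theorem eq_of_act_integrand_eq {A B : TimeOp}
    (h : ∀ (N : ℕ) (z : Fin N → ℝ), Function.Injective z → ∀ α,
      coeff α (A.act (integrand N)) z = coeff α (B.act (integrand N)) z) : A = B := by
  ext1 α
  rw [← sub_eq_zero]
  refine eq_zero_of_eval_powerSum fun N => eval_powerSum_eq_zero fun z hz => ?_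
  have h1 : MvPowerSeries.map (MvPolynomial.eval (powerSum z)) A * expSeries (powerSum z) =
      MvPowerSeries.map (MvPolynomial.eval (powerSum z)) B * expSeries (powerSum z) := by
    ext β
    have h2 := h N z hz β
    rw [coeff_act_integrand, coeff_act_integrand] at h2
    exact mul_left_cancel₀ (pow_ne_zero 2 (vandermonde_ne_zero hz)) h2
  have h3 : expSeries (powerSum z) ≠ 0 := fun h0 => by
    have := coeff_zero_expSeries (powerSum z)
    rw [h0, map_zero] at this
    exact zero_ne_one this
  have h4 := congrArg (coeff α) (mul_right_cancel₀ h3 h1)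
  rw [coeff_map, coeff_map] at h4
  rw [map_sub, h4, sub_self]

end MatrixModel

/-! ### Conclusion -/

namespace TimesField

open TimeOp

theorem isReducibleToVirasoro_constraintOp (r M : ℕ) :
    (constraintOp r M).IsReducibleToVirasoro :=
  ((isReducible_symmetrizedBell (r + 1)).smul
    ((-1) ^ (r + 1) * ((r : ℝ) + 1)⁻¹)).congr (A' := fun m => constraintOp r m)
    (fun m => (laurentCoeff_smul ((m : ℤ) + 1) _ _).symm) |>.isReducibleToVirasoro M

end TimesField

/-- For `r ≥ 2` and `n ≥ -r` there is exactly one constraint operator obtained by inserting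
`W_n^r` into the Hermitian matrix model, and it is reducible to the Virasoro constraint
operators. -/
theorem theorem1 (r : ℕ) (hr : 2 ≤ r) (n : ℤ) (hn : -(r : ℤ) ≤ n) :
    ∃ W : TimeOp, MatrixModel.IsConstraintOperator r n W ∧
      (∀ W' : TimeOp, MatrixModel.IsConstraintOperator r n W' → W' = W) ∧
      W.IsReducibleToVirasoro := by
  obtain ⟨M, hM⟩ := Int.eq_ofNat_of_zero_le (show 0 ≤ n + r by linarith)
  have hW := MatrixModel.isConstraintOperator_constraintOp r n M hM
  exact ⟨TimesField.constraintOp r M, hW,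
    fun W' hW' => MatrixModel.eq_of_act_integrand_eq fun N z hz α =>
      (hW' N z hz α).trans (hW N z hz α).symm,
    TimesField.isReducibleToVirasoro_constraintOp r M⟩
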